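/- Let $a>0$. Let $\mathbb R^{1,3}$ be Minkowski spacetime with coordinates $x=(x_0,x_1,x_2,x_3)$, metric of signature $(-,+,+,+)$ and $\square=-\partial_0^2+\partial_1^2+\partial_2^2+\partial_3^2$. For $j\in C_0^\infty(\mathbb R^{1,3})$ let $E^{\pm}j$ be the retarded ($+$) and advanced ($-$) solution of $\square u=j$, i.e. the smooth solution vanishing outside the causal future, respectively past, $J^{\pm}(\mathrm{supp}\, j)$, and put $E(f,g)=\int f\,(E^+g-E^-g)\,d^4x$. For $O=\mathbb R^{1,3}$ or $O=W:=\{x: x_1>|x_0|\}$ (the Rindler wedge), the algebra $\mathscr A(O)$ of the massless Klein–Gordon field is the free unital complex $*$-algebra generated by symbols $\phi(f)$, $f\in C_0^\infty(O,\mathbb C)$, modulo the relations: $\phi(f)$ is linear in $f$; $\phi(\square f)=0$; $\phi(f)^*=\phi(\bar f)$; $[\phi(f),\phi(g)]=iE(f,g)\mathbf 1$. A state is a linear functional $\omega$ with $\omega(\mathbf 1)=1$ and $\omega(b^*b)\ge 0$ for all $b$. There is a natural $*$-homomorphism $\mathscr A(W)\to\mathscr A(\mathbb R^{1,3})$, $\phi(f)\mapsto\phi(f)$,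 along which states on $\mathscr A(\mathbb R^{1,3})$ restrict to $\mathscr A(W)$. The Minkowski vacuum is the Gaussian state $\omega_0$ on $\mathscr A(\mathbb R^{1,3})$ with vanishing one-point function and two-point function $$\omega_0(\phi(f)\phi(g))=\int_{\mathbb R^3}\frac{d^3\mathbf k}{(2\pi)^3}\Big(\int f\,u_{\mathbf k}\,d^4x\Big)\Big(\int g\,\overline{u_{\mathbf k}}\,d^4y\Big),\qquad u_{\mathbf k}(x)=\frac{e^{-i|\mathbf k|x_0+i\mathbf k\cdot\mathbf x}}{\sqrt{2|\mathbf k|}},$$ where $\mathbf x=(x_1,x_2,x_3)$, and where Gaussian means that all $n$-point functions are obtained from the two-point function by Wick's theorem. On $W$ introduce Rindler coordinates $(\eta,\xi,x_2,x_3)$ by $x_0=a^{-1}e^{a\xi}\sinh a\eta$, $x_1=a^{-1}e^{a\xi}\cosh a\eta$, and let $\varphi_t:\eta\mapsto\eta+t$ (the Lorentz boost with rapidity $at$) act on $\mathscr A(W)$ by the automorphisms $\alpha_t(\phi(f))=\phi(f\circ\varphi_{-t})$. **Theorem.** There is exactly one such state $\omega_0$, and its restriction $\omega$ to $\mathscr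 A(W)$ is a KMS state with respect to $(\alpha_t)_{t\in\mathbb R}$ at inverse temperature $\beta=2\pi/a$. That is, $\omega$ is a state and, for every $n$ and all $b_1,\dots,b_n\in\mathscr A(W)$, the function $F_{b_1,\dots,b_n}(t_1,\dots,t_n)=\omega(\alpha_{t_1}(b_1)\cdots\alpha_{t_n}(b_n))$ on $\mathbb R^n$ has a continuation, again denoted $F_{b_1,\dots,b_n}$, which is analytic in the tube $\{z\in\mathbb C^n: 0<\mathrm{Im}\,z_j-\mathrm{Im}\,z_i<\beta \text{ for } 1\le i<j\le n\}$, continuous and bounded on its closure, and satisfies, for $1\le k\le n$ and real $t_1,\dots,t_n$, $$F_{b_1,\dots,b_n}(t_1,\dots,t_{k-1},t_k+i\beta,\dots,t_n+i\beta)=F_{b_k,\dots,b_n,b_1,\dots,b_{k-1}}(t_k,\dots,t_n,t_1,\dots,t_{k-1}).$$ -/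

import Mathlib

open scoped ComplexConjugate ComplexOrder

namespace Unruh

noncomputable section

/-! ### Free unital complex `*`-algebras -/

/-- The free unital complex `*`-algebra on a set `X`: noncommutative polynomials over `ℂ` in the
letters `(x, true)`, standing for `x`, and `(x, false)`, standing for its adjoint. -/
def FreeStarAlgebra (X : Type) : Type := FreeAlgebra ℂ (X × Bool)

namespace FreeStarAlgebra

variable {X : Type}

instance : Ring (FreeStarAlgebra X) := inferInstanceAs (Ring (FreeAlgebra ℂ (X × Bool)))

instance : Algebra ℂ (FreeStarAlgebra X) :=
  inferInstanceAs (Algebra ℂ (FreeAlgebra ℂ (X × Bool)))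

/-- The letters. -/
def letter (p : X × Bool) : FreeStarAlgebra X := FreeAlgebra.ι ℂ p

/-- The generator belonging to `x`. -/
def gen (x : X) : FreeStarAlgebra X := letter (x, true)

theorem induct {C : FreeStarAlgebra X → Prop} (hs : ∀ c : ℂ, C (algebraMap ℂ _ c))
    (hl : ∀ p, C (letter p)) (hm : ∀ a b, C a → C b → C (a * b))
    (ha : ∀ a b, C a → C b → C (a + b)) (a : FreeStarAlgebra X) : C a :=
  FreeAlgebra.induction ℂ (X × Bool) (motive := C) hs hl hm ha a

/-- The opposite algebra with conjugated scalars, the target of the adjoint. -/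
def ConjOp (X : Type) : Type := (FreeStarAlgebra X)ᵐᵒᵖ

instance : Ring (ConjOp X) := inferInstanceAs (Ring (FreeStarAlgebra X)ᵐᵒᵖ)

instance : Algebra ℂ (ConjOp X) :=
  RingHom.toAlgebra' (((algebraMap ℂ (FreeStarAlgebra X)ᵐᵒᵖ).comp (starRingEnd ℂ) :
    ℂ →+* (FreeStarAlgebra X)ᵐᵒᵖ) : ℂ →+* ConjOp X)
    (fun c x => Algebra.commutes (A := (FreeStarAlgebra X)ᵐᵒᵖ) (starRingEnd ℂ c) x)

/-- The adjoint as an algebra homomorphism into the conjugate opposite algebra. -/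
def adjHom : FreeStarAlgebra X →ₐ[ℂ] ConjOp X :=
  FreeAlgebra.lift ℂ fun p : X × Bool =>
    (MulOpposite.op (letter (p.1, !p.2)) : (FreeStarAlgebra X)ᵐᵒᵖ)

/-- The adjoint: antilinear, order reversing, exchanging `x` with its adjoint. -/
def adj (a : FreeStarAlgebra X) : FreeStarAlgebra X :=
  MulOpposite.unop (show (FreeStarAlgebra X)ᵐᵒᵖ from adjHom a)

theorem adj_letter (p : X × Bool) : adj (letter p) = letter (p.1, !p.2) := by
  have h : adjHom (letter p) = (MulOpposite.op (letter (p.1, !p.2)) : (FreeStarAlgebra X)ᵐᵒᵖ) :=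
    FreeAlgebra.lift_ι_apply _ _
  unfold adj
  rw [h]
  rfl

theorem adj_scalar (c : ℂ) :
    adj (algebraMap ℂ (FreeStarAlgebra X) c) = algebraMap ℂ (FreeStarAlgebra X) (conj c) := by
  have h := (adjHom (X := X)).commutes c
  unfold adj
  rw [h]
  rfl

theorem adj_mul (a b : FreeStarAlgebra X) : adj (a * b) = adj b * adj a := by
  have h := map_mul (adjHom (X := X)) a b
  unfold adj
  rw [h]
  rfl

theorem adj_add (a b : FreeStarAlgebra X) : adj (a + b) = adj a + adj b := by
  have h := map_add (adjHom (X := X)) a b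
  unfold adj
  rw [h]
  rfl

theorem adj_adj (a : FreeStarAlgebra X) : adj (adj a) = a := by
  induction a using induct with
  | hs c => rw [adj_scalar, adj_scalar, Complex.conj_conj]
  | hl p => rw [adj_letter, adj_letter, Bool.not_not]
  | hm a b iha ihb => rw [adj_mul, adj_mul, iha, ihb]
  | ha a b iha ihb => rw [adj_add, adj_add, iha, ihb]

instance : StarRing (FreeStarAlgebra X) where
  star := adj
  star_involutive := adj_adj
  star_mul := adj_mul
  star_add := adj_add

theorem star_letter (p : X × Bool) : star (letter p) = letter (p.1, !p.2) := adj_letter p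

theorem star_scalar (c : ℂ) :
    star (algebraMap ℂ (FreeStarAlgebra X) c) = algebraMap ℂ (FreeStarAlgebra X) (conj c) :=
  adj_scalar c

instance : StarModule ℂ (FreeStarAlgebra X) where
  star_smul c a := by
    rw [Algebra.smul_def, star_mul, star_scalar, ← Algebra.commutes, ← Algebra.smul_def]
    rfl

/-- The `*`-homomorphism with prescribed values on the generators. -/
def lift {B : Type} [Ring B] [StarRing B] [Algebra ℂ B] [StarModule ℂ B] (F : X → B) :
    FreeStarAlgebra X →⋆ₐ[ℂ] B :=
  let h : FreeStarAlgebra X →ₐ[ℂ] B :=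
    FreeAlgebra.lift ℂ fun p : X × Bool => if p.2 then F p.1 else star (F p.1)
  have hl : ∀ p, h (letter p) = if p.2 then F p.1 else star (F p.1) := fun p =>
    FreeAlgebra.lift_ι_apply _ _
  { h with
    map_star' := fun a => by
      change h (star a) = star (h a)
      induction a using induct with
      | hs c =>
        rw [star_scalar, AlgHom.commutes, AlgHom.commutes, ← algebraMap_star_comm]
        rfl
      | hl p =>
        rw [star_letter, hl, hl]
        rcases p with ⟨x, _ | _⟩ <;> simp
      | hm a b iha ihb => rw [star_mul, map_mul, map_mul, star_mul, iha, ihb]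
      | ha a b iha ihb => rw [star_add, map_add, map_add, star_add, iha, ihb] }

theorem lift_gen {B : Type} [Ring B] [StarRing B] [Algebra ℂ B] [StarModule ℂ B] (F : X → B)
    (x : X) : lift F (gen x) = F x :=
  (FreeAlgebra.lift_ι_apply (R := ℂ) (A := B)
    (fun p : X × Bool => if p.2 then F p.1 else star (F p.1)) (x, true)).trans (if_pos rfl)

theorem lift_letter {B : Type} [Ring B] [StarRing B] [Algebra ℂ B] [StarModule ℂ B] (F : X → B)
    (p : X × Bool) : lift F (letter p) = if p.2 then F p.1 else star (F p.1) :=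
  FreeAlgebra.lift_ι_apply _ _

end FreeStarAlgebra

/-! ### Minkowski spacetime and the massless Klein-Gordon equation

Points of `ℝ^{1,3}` are `x = (x 0, x 1, x 2, x 3)` with time coordinate `x 0`; the metric has
signature `(-,+,+,+)`. -/

/-- Minkowski spacetime `ℝ^{1,3}`. -/
abbrev Spacetime : Type := Fin 4 → ℝ

/-- Complex test functions on spacetime with compact support in the open set `O`. -/
abbrev TestFn (O : TopologicalSpace.Opens Spacetime) : Type := TestFunction O ℂ ⊤

/-- Coordinate unit vectors. -/
def unitVec (μ : Fin 4) : Spacetime := Pi.single μ 1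

/-- The second partial derivative `∂_μ ∂_ν f (x)`. -/
def partial₂ (f : Spacetime → ℂ) (μ ν : Fin 4) (x : Spacetime) : ℂ :=
  iteratedFDeriv ℝ 2 f x ![unitVec μ, unitVec ν]

/-- The d'Alembertian `□ f = -∂₀² f + ∂₁² f + ∂₂² f + ∂₃² f`. -/
def box (f : Spacetime → ℂ) (x : Spacetime) : ℂ :=
  -partial₂ f 0 0 x + ∑ i : Fin 3, partial₂ f i.succ i.succ x

/-- `y` lies in the closed future light cone of `x`. -/
def CausalLE (x y : Spacetime) : Prop :=
  x 0 ≤ y 0 ∧ ∑ i : Fin 3, (y i.succ - x i.succ) ^ 2 ≤ (y 0 - x 0) ^ 2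

/-- The causal future `J⁺(S)`. -/
def causalFuture (S : Set Spacetime) : Set Spacetime := {x | ∃ y ∈ S, CausalLE y x}

/-- The causal past `J⁻(S)`. -/
def causalPast (S : Set Spacetime) : Set Spacetime := {x | ∃ y ∈ S, CausalLE x y}

/-- `u` is the retarded solution `E⁺ j` of `□ u = j`: the smooth solution that vanishes outside
the causal future of the support of `j`. -/
structure IsRetardedSolution (j u : Spacetime → ℂ) : Prop where
  smooth : ContDiff ℝ (⊤ : ℕ∞) u
  eqn : ∀ x, box u x = j x
  supp : Function.support u ⊆ causalFuture (tsupport j)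

/-- `u` is the advanced solution `E⁻ j` of `□ u = j`: the smooth solution that vanishes outside
the causal past of the support of `j`. -/
structure IsAdvancedSolution (j u : Spacetime → ℂ) : Prop where
  smooth : ContDiff ℝ (⊤ : ℕ∞) u
  eqn : ∀ x, box u x = j x
  supp : Function.support u ⊆ causalPast (tsupport j)

/-! ### The field algebra -/

/-- Complex conjugation of test functions. -/
def conjFn {O : TopologicalSpace.Opens Spacetime} (f : TestFn O) : TestFn O where
  toFun x := conj (f x)
  contDiff' := Complex.conjCLE.contDiff.comp f.contDiff
  hasCompactSupport' := f.hasCompactSupport.comp_left (g := conj) (map_zero _)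
  tsupport_subset' := by
    refine (closure_mono ?_).trans f.tsupport_subset
    exact Function.support_comp_subset (g := conj) (map_zero _) f

open FreeStarAlgebra in
/-- The defining relations of the algebra of the massless Klein-Gordon field on `O`: linearity,
field equation, hermiticity, the commutator `[φ(f), φ(g)] = i E(f, g) 1` with
`E(f, g) = ∫ f (E⁺ g - E⁻ g)`, and closure under adjoints, so that the quotient is by the two-sided
`*`-ideal they generate. (`O` is all of Minkowski spacetime or the wedge; the propagators of the
wedge are the restrictions of those of Minkowski spacetime.) -/
inductive FieldRel (O : TopologicalSpace.Opens Spacetime) :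
    FreeStarAlgebra (TestFn O) → FreeStarAlgebra (TestFn O) → Prop
  | linear (c₁ c₂ : ℂ) (f₁ f₂ : TestFn O) :
      FieldRel O (gen (c₁ • f₁ + c₂ • f₂)) (c₁ • gen f₁ + c₂ • gen f₂)
  | field (f h : TestFn O) (hf : ∀ x, h x = box f x) : FieldRel O (gen h) 0
  | hermitian (f : TestFn O) : FieldRel O (star (gen f)) (gen (conjFn f))
  | commutator (f g : TestFn O) (u v : Spacetime → ℂ) (hu : IsRetardedSolution g u)
      (hv : IsAdvancedSolution g v) :
      FieldRel O (gen f * gen g - gen g * gen f)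
        (algebraMap ℂ _ (Complex.I * ∫ x, f x * (u x - v x)))
  | adjoint {a b : FreeStarAlgebra (TestFn O)} (hab : FieldRel O a b) :
      FieldRel O (star a) (star b)

/-- The `*`-algebra `𝒜(O)` of the massless Klein-Gordon field. -/
def FieldAlgebra (O : TopologicalSpace.Opens Spacetime) : Type := RingQuot (FieldRel O)

namespace FieldAlgebra

variable {O O₁ O₂ O₃ : TopologicalSpace.Opens Spacetime}

instance : Ring (FieldAlgebra O) := inferInstanceAs (Ring (RingQuot (FieldRel O)))

instance : Algebra ℂ (FieldAlgebra O) := inferInstanceAs (Algebra ℂ (RingQuot (FieldRel O)))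

/-- The quotient map. -/
def mk (O : TopologicalSpace.Opens Spacetime) :
    FreeStarAlgebra (TestFn O) →ₐ[ℂ] FieldAlgebra O :=
  RingQuot.mkAlgHom ℂ (FieldRel O)

theorem mk_surjective : Function.Surjective (mk O) := RingQuot.mkAlgHom_surjective ℂ (FieldRel O)

theorem mk_rel {a b : FreeStarAlgebra (TestFn O)} (hab : FieldRel O a b) : mk O a = mk O b :=
  RingQuot.mkAlgHom_rel ℂ hab

/-- The adjoint followed by the quotient map, as a homomorphism into the opposite ring. -/
def adjMk (O : TopologicalSpace.Opens Spacetime) :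
    FreeStarAlgebra (TestFn O) →+* (FieldAlgebra O)ᵐᵒᵖ where
  toFun a := MulOpposite.op (mk O (star a))
  map_one' := by rw [star_one, map_one, MulOpposite.op_one]
  map_zero' := by rw [star_zero, map_zero, MulOpposite.op_zero]
  map_mul' a b := by rw [star_mul, map_mul, MulOpposite.op_mul]
  map_add' a b := by rw [star_add, map_add, MulOpposite.op_add]

/-- The adjoint on the quotient. -/
def adj (O : TopologicalSpace.Opens Spacetime) : FieldAlgebra O →+* (FieldAlgebra O)ᵐᵒᵖ :=
  RingQuot.lift ⟨adjMk O, fun _ _ hab =>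
    congrArg MulOpposite.op (mk_rel (FieldRel.adjoint hab))⟩

theorem adj_mk (a : FreeStarAlgebra (TestFn O)) :
    adj O (mk O a) = MulOpposite.op (mk O (star a)) := by
  have h : mk O a = RingQuot.mkRingHom (FieldRel O) a :=
    RingHom.congr_fun (RingQuot.mkAlgHom_coe ℂ (FieldRel O)) a
  rw [h]
  exact RingQuot.lift_mkRingHom_apply (adjMk O) _ a

instance : StarRing (FieldAlgebra O) where
  star a := (adj O a).unop
  star_involutive a := by
    obtain ⟨a, rfl⟩ := mk_surjective a
    change (adj O (adj O (mk O a)).unop).unop = mk O a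
    rw [adj_mk, MulOpposite.unop_op, adj_mk, star_star, MulOpposite.unop_op]
  star_mul a b := by
    change (adj O (a * b)).unop = (adj O b).unop * (adj O a).unop
    rw [map_mul, MulOpposite.unop_mul]
  star_add a b := by
    change (adj O (a + b)).unop = (adj O a).unop + (adj O b).unop
    rw [map_add, MulOpposite.unop_add]

theorem mk_star (a : FreeStarAlgebra (TestFn O)) : mk O (star a) = star (mk O a) :=
  (congrArg MulOpposite.unop (adj_mk a)).symm

instance : StarModule ℂ (FieldAlgebra O) where
  star_smul c a := by
    obtain ⟨a, rfl⟩ := mk_surjective a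
    rw [← map_smul, ← mk_star, star_smul, map_smul, mk_star]

/-- The smeared field `φ(f)`. -/
def φ (f : TestFn O) : FieldAlgebra O := mk O (FreeStarAlgebra.gen f)

theorem φ_star (f : TestFn O) : star (φ f) = φ (conjFn f) := by
  unfold φ
  rw [← mk_star]
  exact mk_rel (FieldRel.hermitian f)

/-- Maps of test functions that respect the structure entering the relations. -/
structure IsFieldMap (T : TestFn O₁ → TestFn O₂) : Prop where
  linear : ∀ (c₁ c₂ : ℂ) (f₁ f₂ : TestFn O₁), T (c₁ • f₁ + c₂ • f₂) = c₁ • T f₁ + c₂ • T f₂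
  conj_eq : ∀ f, T (conjFn f) = conjFn (T f)
  field : ∀ f h : TestFn O₁, (∀ x, h x = box f x) → ∀ x, T h x = box (T f) x
  commutator : ∀ (f g : TestFn O₁) (u v : Spacetime → ℂ), IsRetardedSolution g u →
    IsAdvancedSolution g v → ∃ u' v' : Spacetime → ℂ, IsRetardedSolution (T g) u' ∧
      IsAdvancedSolution (T g) v' ∧
        ∫ x, f x * (u x - v x) = ∫ x, T f x * (u' x - v' x)

theorem lift_rel {T : TestFn O₁ → TestFn O₂} (hT : IsFieldMap T)
    {a b : FreeStarAlgebra (TestFn O₁)} (hab : FieldRel O₁ a b) :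
    FreeStarAlgebra.lift (fun f => φ (T f)) a = FreeStarAlgebra.lift (fun f => φ (T f)) b := by
  induction hab with
  | linear c₁ c₂ f₁ f₂ =>
    rw [map_add, map_smul, map_smul]
    simp only [FreeStarAlgebra.lift_gen]
    rw [hT.linear]
    unfold φ
    rw [mk_rel (FieldRel.linear _ _ _ _), map_add, map_smul, map_smul]
  | field f h hf =>
    rw [map_zero, FreeStarAlgebra.lift_gen]
    unfold φ
    rw [mk_rel (FieldRel.field _ _ (hT.field f h hf)), map_zero]
  | hermitian f =>
    rw [map_star, FreeStarAlgebra.lift_gen, FreeStarAlgebra.lift_gen, φ_star, hT.conj_eq]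
  | commutator f g u v hu hv =>
    obtain ⟨u', v', hu', hv', e⟩ := hT.commutator f g u v hu hv
    rw [map_sub, map_mul, map_mul, FreeStarAlgebra.lift_gen, FreeStarAlgebra.lift_gen, e]
    unfold φ
    rw [← map_mul, ← map_mul, ← map_sub, mk_rel (FieldRel.commutator _ _ _ _ hu' hv')]
    rw [AlgHom.commutes, AlgHomClass.commutes]
  | adjoint _ ih => rw [map_star, map_star, ih]

/-- The `*`-homomorphism `φ(f) ↦ φ(T f)`. -/
def map (T : TestFn O₁ → TestFn O₂) (hT : IsFieldMap T) : FieldAlgebra O₁ →⋆ₐ[ℂ] FieldAlgebra O₂ :=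
  let h : FieldAlgebra O₁ →ₐ[ℂ] FieldAlgebra O₂ :=
    RingQuot.liftAlgHom ℂ ⟨(FreeStarAlgebra.lift fun f => φ (T f)).toAlgHom,
      fun _ _ hab => lift_rel hT hab⟩
  have hh : ∀ a, h (mk O₁ a) = FreeStarAlgebra.lift (fun f => φ (T f)) a := fun a =>
    RingQuot.liftAlgHom_mkAlgHom_apply ℂ _ _ a
  { h with
    map_star' := fun a => by
      change h (star a) = star (h a)
      obtain ⟨a, rfl⟩ := mk_surjective a
      rw [← mk_star, hh, hh, map_star] }

theorem map_φ (T : TestFn O₁ → TestFn O₂) (hT : IsFieldMap T) (f : TestFn O₁) :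
    map T hT (φ f) = φ (T f) :=
  (RingQuot.liftAlgHom_mkAlgHom_apply ℂ _ _ _).trans (FreeStarAlgebra.lift_gen _ _)

theorem hom_ext {B : Type} [Ring B] [StarRing B] [Algebra ℂ B] {F G : FieldAlgebra O →⋆ₐ[ℂ] B}
    (h : ∀ f, F (φ f) = G (φ f)) : F = G := by
  ext a
  obtain ⟨a, rfl⟩ := mk_surjective a
  induction a using FreeStarAlgebra.induct with
  | hs c => rw [AlgHom.commutes, AlgHomClass.commutes, AlgHomClass.commutes]
  | hl p =>
    rcases p with ⟨f, _ | _⟩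
    · have e : FreeStarAlgebra.letter (f, false) = star (FreeStarAlgebra.gen f) :=
        (FreeStarAlgebra.star_letter (f, true)).symm
      rw [e, mk_star, map_star, map_star]
      exact congrArg star (h f)
    · exact h f
  | hm a b iha ihb => rw [map_mul, map_mul, map_mul, iha, ihb]
  | ha a b iha ihb => rw [map_add, map_add, map_add, iha, ihb]

end FieldAlgebra

/-! ### States, and the KMS condition for a one-parameter group of automorphisms -/

section KMS

variable {A : Type} [Ring A] [StarRing A] [Algebra ℂ A]

/-- A state: a normalized positive linear functional. -/
structure IsState (ω : A →ₗ[ℂ] ℂ) : Prop where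
  normalized : ω 1 = 1
  positive : ∀ a, 0 ≤ ω (star a * a)

/-- The tube `{z ∈ ℂⁿ | 0 < Im z_j - Im z_i < β for i < j}`. -/
def tube (β : ℝ) (n : ℕ) : Set (Fin n → ℂ) :=
  {z | ∀ i j, i < j → 0 < (z j).im - (z i).im ∧ (z j).im - (z i).im < β}

/-- The list `α_{t_1}(a_1), …, α_{t_n}(a_n)`. -/
def evolved (α : Multiplicative ℝ →* (A ≃⋆ₐ[ℂ] A)) {n : ℕ} (a : Fin n → A) (t : Fin n → ℝ) :
    List A :=
  List.ofFn fun i => α (Multiplicative.ofAdd (t i)) (a i)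

/-- `ω` is a KMS state at inverse temperature `β` for the one-parameter group `α`: it is a state,
and each function `F(t) = ω(α_{t_1}(a_1) ⋯ α_{t_n}(a_n))` has a continuation `G` that is analytic
in the tube, continuous and bounded on its closure, and satisfies
`G(t_1, …, t_{k-1}, t_k + iβ, …, t_n + iβ)
  = ω(α_{t_k}(a_k) ⋯ α_{t_n}(a_n) α_{t_1}(a_1) ⋯ α_{t_{k-1}}(a_{k-1}))`. -/
structure IsKMSState (α : Multiplicative ℝ →* (A ≃⋆ₐ[ℂ] A)) (β : ℝ) (ω : A →ₗ[ℂ] ℂ) : Prop where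
  state : IsState ω
  kms : ∀ (n : ℕ) (a : Fin n → A), ∃ G : (Fin n → ℂ) → ℂ,
    AnalyticOnNhd ℂ G (tube β n) ∧
    ContinuousOn G (closure (tube β n)) ∧
    (∃ C : ℝ, ∀ z ∈ closure (tube β n), ‖G z‖ ≤ C) ∧
    (∀ t : Fin n → ℝ, G (fun i => (t i : ℂ)) = ω (evolved α a t).prod) ∧
    ∀ (k : Fin n) (t : Fin n → ℝ),
      G (fun i => (t i : ℂ) + if k ≤ i then Complex.I * (β : ℂ) else 0) =
        ω (((evolved α a t).drop k).prod * ((evolved α a t).take k).prod)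

end KMS

/-! ### The Minkowski vacuum -/

/-- The positive frequency modes `u_k(x) = exp(-i |k| x₀ + i k·x) / √(2 |k|)` of the massless
field. -/
def mode (k : EuclideanSpace ℝ (Fin 3)) (x : Spacetime) : ℂ :=
  Complex.exp (Complex.I * ((∑ i : Fin 3, k i * x i.succ - ‖k‖ * x 0 : ℝ) : ℂ)) /
    (Real.sqrt (2 * ‖k‖) : ℂ)

/-- The vacuum two-point function `W₂(x, y) = ∫ u_k(x) conj(u_k(y)) d³k / (2π)³`, smeared with
test functions `f` in `x` and `g` in `y`. -/
def vacuumTwoPoint (f g : Spacetime → ℂ) : ℂ :=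
  ∫ k : EuclideanSpace ℝ (Fin 3), ((1 / (2 * Real.pi) ^ 3 : ℝ) : ℂ) *
    ((∫ x, f x * mode k x) * ∫ y, g y * conj (mode k y))

/-- The functional `ω` is Gaussian with vanishing one-point function and two-point function `w`:
its `n`-point functions are given by Wick's theorem, here written as the recursion
`ω(φ(f) φ(f_1) ⋯ φ(f_n)) = ∑_j w(f, f_j) ω(φ(f_1) ⋯ (omit φ(f_j)) ⋯ φ(f_n))`. -/
def IsGaussian {O : TopologicalSpace.Opens Spacetime} (w : TestFn O → TestFn O → ℂ)
    (ω : FieldAlgebra O →ₗ[ℂ] ℂ) : Prop :=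
  ∀ (f : TestFn O) (l : List (TestFn O)),
    ω (FieldAlgebra.φ f * (l.map FieldAlgebra.φ).prod) =
      ∑ j : Fin l.length, w f (l.get j) * ω ((l.eraseIdx j).map FieldAlgebra.φ).prod

/-- `ω` is the Minkowski vacuum: the Gaussian state on the algebra of all of Minkowski spacetime
with vanishing one-point function and the vacuum two-point function. -/
structure IsMinkowskiVacuum (ω : FieldAlgebra ⊤ →ₗ[ℂ] ℂ) : Prop where
  state : IsState ω
  gaussian : IsGaussian (fun f g => vacuumTwoPoint f g) ω

/-! ### Inclusion of algebras -/

/-- Test functions on a smaller set regarded as test functions on a larger one. -/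
def inclFn {O₁ O₂ : TopologicalSpace.Opens Spacetime} (h : O₁ ≤ O₂) (f : TestFn O₁) :
    TestFn O₂ where
  toFun := f
  contDiff' := f.contDiff
  hasCompactSupport' := f.hasCompactSupport
  tsupport_subset' := f.tsupport_subset.trans h

theorem inclFn_isFieldMap {O₁ O₂ : TopologicalSpace.Opens Spacetime} (h : O₁ ≤ O₂) :
    FieldAlgebra.IsFieldMap (inclFn h) where
  linear _ _ _ _ := rfl
  conj_eq _ := rfl
  field _ _ hf := hf
  commutator _ _ u v hu hv := ⟨u, v, hu, hv, rfl⟩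

/-- The `*`-homomorphism `φ(f) ↦ φ(f)` of field algebras induced by an inclusion. -/
def inclusion {O₁ O₂ : TopologicalSpace.Opens Spacetime} (h : O₁ ≤ O₂) :
    FieldAlgebra O₁ →⋆ₐ[ℂ] FieldAlgebra O₂ :=
  FieldAlgebra.map (inclFn h) (inclFn_isFieldMap h)

/-! ### The Rindler wedge and the boosts -/

/-- The Rindler wedge `W = {x | x₁ > |x₀|}`. -/
def wedge : TopologicalSpace.Opens Spacetime where
  carrier := {x | |x 0| < x 1}
  is_open' := isOpen_lt (by fun_prop) (by fun_prop)

/-- The Lorentz boost with rapidity `θ` in the `(x₀, x₁)`-plane, as a function. -/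
def boostFun (θ : ℝ) (x : Spacetime) : Spacetime :=
  ![Real.cosh θ * x 0 + Real.sinh θ * x 1, Real.sinh θ * x 0 + Real.cosh θ * x 1, x 2, x 3]

theorem boostFun_add (θ θ' : ℝ) (x : Spacetime) :
    boostFun (θ + θ') x = boostFun θ (boostFun θ' x) := by
  funext i
  fin_cases i <;> simp [boostFun, Real.cosh_add, Real.sinh_add] <;> ring

theorem boostFun_zero (x : Spacetime) : boostFun 0 x = x := by
  funext i
  fin_cases i <;> simp [boostFun]

/-- The Lorentz boost with rapidity `θ` in the `(x₀, x₁)`-plane. -/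
def boost (θ : ℝ) : Spacetime ≃L[ℝ] Spacetime :=
  LinearEquiv.toContinuousLinearEquiv
    { toFun := boostFun θ
      map_add' := fun x y => by
        funext i
        fin_cases i <;> simp [boostFun] <;> ring
      map_smul' := fun c x => by
        funext i
        fin_cases i <;> simp [boostFun] <;> ring
      invFun := boostFun (-θ)
      left_inv := fun x => by rw [← boostFun_add, neg_add_cancel, boostFun_zero]
      right_inv := fun x => by rw [← boostFun_add, add_neg_cancel, boostFun_zero] }

theorem boost_apply (θ : ℝ) (x : Spacetime) : boost θ x = boostFun θ x := rfl

theorem boost_add (θ θ' : ℝ) (x : Spacetime) : boost (θ + θ') x = boost θ (boost θ' x) :=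
  boostFun_add θ θ' x

theorem boost_zero (x : Spacetime) : boost 0 x = x := boostFun_zero x

theorem boost_neg_boost (θ : ℝ) (x : Spacetime) : boost (-θ) (boost θ x) = x := by
  rw [← boost_add, neg_add_cancel, boost_zero]

theorem boost_boost_neg (θ : ℝ) (x : Spacetime) : boost θ (boost (-θ) x) = x := by
  rw [← boost_add, add_neg_cancel, boost_zero]

/-- The point of the wedge with Rindler coordinates `(η, ξ, x₂, x₃)`. -/
def rindlerPoint (a η ξ x₂ x₃ : ℝ) : Spacetime :=
  ![a⁻¹ * Real.exp (a * ξ) * Real.sinh (a * η), a⁻¹ * Real.exp (a * ξ) * Real.cosh (a * η), x₂, x₃]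

/-- In Rindler coordinates the boost with rapidity `a t` is the translation `η ↦ η + t`. -/
theorem boost_rindlerPoint (a t η ξ x₂ x₃ : ℝ) :
    boost (a * t) (rindlerPoint a η ξ x₂ x₃) = rindlerPoint a (η + t) ξ x₂ x₃ := by
  funext i
  fin_cases i <;>
    simp [boost_apply, boostFun, rindlerPoint, mul_add, Real.cosh_add, Real.sinh_add] <;> ring

theorem boost_mem_wedge (θ : ℝ) {x : Spacetime} (hx : boost θ x ∈ wedge) : x ∈ wedge := by
  change |boost θ x 0| < boost θ x 1 at hx
  change |x 0| < x 1
  have h0 : boost θ x 0 = Real.cosh θ * x 0 + Real.sinh θ * x 1 := by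
    simp [boost_apply, boostFun]
  have h1 : boost θ x 1 = Real.sinh θ * x 0 + Real.cosh θ * x 1 := by
    simp [boost_apply, boostFun]
  rw [h0, h1, abs_lt] at hx
  rw [abs_lt]
  have e1 := Real.exp_pos θ
  have e2 := Real.exp_pos (-θ)
  rw [← Real.cosh_add_sinh] at e1
  rw [← Real.cosh_sub_sinh] at e2
  obtain ⟨ha, hb⟩ := hx
  constructor
  · have : 0 < (Real.cosh θ + Real.sinh θ) * (x 0 + x 1) := by linarith
    have := pos_of_mul_pos_right this e1.le
    linarith
  · have : 0 < (Real.cosh θ - Real.sinh θ) * (x 1 - x 0) := by linarith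
    have := pos_of_mul_pos_right this e2.le
    linarith

theorem partial₂_comp_boost {f : Spacetime → ℂ} (hf : ContDiff ℝ 2 f) (θ : ℝ) (μ ν : Fin 4)
    (x : Spacetime) : partial₂ (fun y => f (boost θ y)) μ ν x =
      iteratedFDeriv ℝ 2 f (boost θ x) ![boost θ (unitVec μ), boost θ (unitVec ν)] := by
  unfold partial₂
  have h := (boost θ : Spacetime →L[ℝ] Spacetime).iteratedFDeriv_comp_right hf x (i := 2) le_rfl
  have h' : (fun y => f (boost θ y)) = f ∘ (boost θ : Spacetime →L[ℝ] Spacetime) := rfl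
  rw [h', h]
  simp only [ContinuousMultilinearMap.compContinuousLinearMap_apply]
  congr 1
  funext i
  fin_cases i <;> rfl

theorem boost_unitVec (θ : ℝ) :
    boost θ (unitVec 0) = Real.cosh θ • unitVec 0 + Real.sinh θ • unitVec 1 ∧
    boost θ (unitVec 1) = Real.sinh θ • unitVec 0 + Real.cosh θ • unitVec 1 ∧
    boost θ (unitVec 2) = unitVec 2 ∧ boost θ (unitVec 3) = unitVec 3 := by
  refine ⟨?_, ?_, ?_, ?_⟩ <;> funext i <;> fin_cases i <;>
    simp [boost_apply, boostFun, unitVec]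

theorem box_comp_boost {f : Spacetime → ℂ} (hf : ContDiff ℝ 2 f) (θ : ℝ) (x : Spacetime) :
    box (fun y => f (boost θ y)) x = box f (boost θ x) := by
  obtain ⟨h0, h1, h2, h3⟩ := boost_unitVec θ
  unfold box
  simp only [partial₂_comp_boost hf, Fin.sum_univ_three, Fin.succ_zero_eq_one,
    Fin.succ_one_eq_two, show (2 : Fin 3).succ = 3 from rfl, h0, h1, h2, h3]
  unfold partial₂
  simp only [iteratedFDeriv_two_apply, Matrix.cons_val_zero, Matrix.cons_val_one, map_add,
    map_smul, add_apply, smul_apply, Complex.real_smul]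
  have hc : (Real.cosh θ : ℂ) ^ 2 - (Real.sinh θ : ℂ) ^ 2 = 1 := by
    exact_mod_cast Real.cosh_sq_sub_sinh_sq θ
  set D := fderiv ℝ (fderiv ℝ f) (boost θ x)
  linear_combination (D (unitVec 1) (unitVec 1) - D (unitVec 0) (unitVec 0)) * hc

theorem causalLE_boost (θ : ℝ) {x y : Spacetime} (h : CausalLE x y) :
    CausalLE (boost θ x) (boost θ y) := by
  obtain ⟨h0, h1⟩ := h
  simp only [CausalLE, boost_apply, boostFun, Fin.sum_univ_three, Fin.succ_zero_eq_one,
    Fin.succ_one_eq_two, show (2 : Fin 3).succ = 3 from rfl, Matrix.cons_val_zero,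
    Matrix.cons_val_one, Matrix.cons_val] at h1 ⊢
  have hc := Real.cosh_sq_sub_sinh_sq θ
  have e1 := Real.exp_pos θ
  have e2 := Real.exp_pos (-θ)
  rw [← Real.cosh_add_sinh] at e1
  rw [← Real.cosh_sub_sinh] at e2
  have h2 : (y 1 - x 1) ^ 2 ≤ (y 0 - x 0) ^ 2 := by
    nlinarith [sq_nonneg (y 2 - x 2), sq_nonneg (y 3 - x 3)]
  obtain ⟨h3, h4⟩ := abs_le.mp (abs_le_of_sq_le_sq h2 (by linarith))
  constructor
  · nlinarith [mul_nonneg e1.le (show 0 ≤ (y 0 - x 0) + (y 1 - x 1) by linarith),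
      mul_nonneg e2.le (show 0 ≤ (y 0 - x 0) - (y 1 - x 1) by linarith)]
  · have e : (Real.cosh θ * y 0 + Real.sinh θ * y 1 - (Real.cosh θ * x 0 + Real.sinh θ * x 1)) ^ 2
        - (Real.sinh θ * y 0 + Real.cosh θ * y 1 - (Real.sinh θ * x 0 + Real.cosh θ * x 1)) ^ 2
        = (y 0 - x 0) ^ 2 - (y 1 - x 1) ^ 2 := by
      linear_combination ((y 0 - x 0) ^ 2 - (y 1 - x 1) ^ 2) * hc
    linarith

theorem tsupport_comp_boost (f : Spacetime → ℂ) (θ : ℝ) :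
    tsupport (fun x => f (boost θ x)) = boost θ ⁻¹' tsupport f :=
  tsupport_comp_eq_preimage f (boost θ).toHomeomorph

theorem retarded_boost {j u : Spacetime → ℂ} (θ : ℝ) (h : IsRetardedSolution j u) :
    IsRetardedSolution (fun x => j (boost (-θ) x)) (fun x => u (boost (-θ) x)) where
  smooth := h.smooth.comp (boost (-θ)).contDiff
  eqn x := by
    rw [box_comp_boost (h.smooth.of_le (WithTop.coe_le_coe.2 (le_top : (2 : ℕ∞) ≤ ⊤))), h.eqn]
  supp x hx := by
    obtain ⟨y, hy, hyx⟩ := h.supp (show boost (-θ) x ∈ Function.support u from hx)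
    refine ⟨boost θ y, ?_, ?_⟩
    · rw [tsupport_comp_boost, Set.mem_preimage, boost_neg_boost]
      exact hy
    · have := causalLE_boost θ hyx
      rwa [boost_boost_neg] at this

theorem advanced_boost {j u : Spacetime → ℂ} (θ : ℝ) (h : IsAdvancedSolution j u) :
    IsAdvancedSolution (fun x => j (boost (-θ) x)) (fun x => u (boost (-θ) x)) where
  smooth := h.smooth.comp (boost (-θ)).contDiff
  eqn x := by
    rw [box_comp_boost (h.smooth.of_le (WithTop.coe_le_coe.2 (le_top : (2 : ℕ∞) ≤ ⊤))), h.eqn]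
  supp x hx := by
    obtain ⟨y, hy, hyx⟩ := h.supp (show boost (-θ) x ∈ Function.support u from hx)
    refine ⟨boost θ y, ?_, ?_⟩
    · rw [tsupport_comp_boost, Set.mem_preimage, boost_neg_boost]
      exact hy
    · have := causalLE_boost θ hyx
      rwa [boost_boost_neg] at this

theorem det_boost (θ : ℝ) :
    LinearMap.det ((boost θ : Spacetime →L[ℝ] Spacetime) : Spacetime →ₗ[ℝ] Spacetime) = 1 := by
  rw [← LinearMap.det_toMatrix']
  have h : LinearMap.toMatrix' ((boost θ : Spacetime →L[ℝ] Spacetime) : Spacetime →ₗ[ℝ] Spacetime)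
      = !![Real.cosh θ, Real.sinh θ, 0, 0; Real.sinh θ, Real.cosh θ, 0, 0; 0, 0, 1, 0;
        0, 0, 0, 1] := by
    ext i k
    rw [LinearMap.toMatrix'_apply]
    fin_cases i <;> fin_cases k <;> simp [boost_apply, boostFun]
  rw [h]
  simp [Matrix.det_succ_row_zero, Fin.sum_univ_succ, Fin.succAbove]
  nlinarith [Real.cosh_sq_sub_sinh_sq θ]

theorem integral_comp_boost (θ : ℝ) (F : Spacetime → ℂ) :
    ∫ x, F (boost θ x) = ∫ x, F x := by
  have hm : MeasureTheory.MeasurePreserving (boost θ) := by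
    refine ⟨(boost θ).continuous.measurable, ?_⟩
    have h := MeasureTheory.Measure.map_linearMap_addHaar_eq_smul_addHaar
      (MeasureTheory.volume : MeasureTheory.Measure Spacetime) (f :=
        ((boost θ : Spacetime →L[ℝ] Spacetime) : Spacetime →ₗ[ℝ] Spacetime))
      (by rw [det_boost]; exact one_ne_zero)
    rw [det_boost] at h
    simpa using h
  exact hm.integral_comp (boost θ).toHomeomorph.measurableEmbedding F

/-- The boosted test function `f ∘ (boost θ)⁻¹`. -/
def boostFn (θ : ℝ) (f : TestFn wedge) : TestFn wedge where
  toFun x := f (boost (-θ) x)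
  contDiff' := f.contDiff.comp (boost (-θ)).contDiff
  hasCompactSupport' := f.hasCompactSupport.comp_homeomorph (boost (-θ)).toHomeomorph
  tsupport_subset' := by
    rw [tsupport_comp_boost]
    intro x hx
    exact boost_mem_wedge (-θ) (f.tsupport_subset hx)

theorem boostFn_isFieldMap (θ : ℝ) : FieldAlgebra.IsFieldMap (boostFn θ) where
  linear _ _ _ _ := rfl
  conj_eq _ := rfl
  field f h hf x := by
    refine (hf (boost (-θ) x)).trans (box_comp_boost ?_ (-θ) x).symm
    exact f.contDiff.of_le (WithTop.coe_le_coe.2 (le_top : (2 : ℕ∞) ≤ ⊤))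
  commutator f g u v hu hv :=
    ⟨_, _, retarded_boost θ hu, advanced_boost θ hv,
      (integral_comp_boost (-θ) fun x => f x * (u x - v x)).symm⟩

/-- The boost with rapidity `θ` acting on the Rindler algebra by `φ(f) ↦ φ(f ∘ (boost θ)⁻¹)`. -/
def boostHom (θ : ℝ) : FieldAlgebra wedge →⋆ₐ[ℂ] FieldAlgebra wedge :=
  FieldAlgebra.map (boostFn θ) (boostFn_isFieldMap θ)

theorem boostHom_zero (x : FieldAlgebra wedge) : boostHom 0 x = x := by
  have h : boostHom 0 = StarAlgHom.id ℂ (FieldAlgebra wedge) := by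
    refine FieldAlgebra.hom_ext fun f => ?_
    rw [boostHom, FieldAlgebra.map_φ]
    change FieldAlgebra.φ (boostFn 0 f) = FieldAlgebra.φ f
    congr 1
    ext x
    change f (boost (-0) x) = f x
    rw [neg_zero, boost_zero]
  rw [h]
  rfl

theorem boostHom_add (θ θ' : ℝ) (x : FieldAlgebra wedge) :
    boostHom (θ + θ') x = boostHom θ (boostHom θ' x) := by
  have h : boostHom (θ + θ') = (boostHom θ).comp (boostHom θ') := by
    refine FieldAlgebra.hom_ext fun f => ?_
    rw [StarAlgHom.comp_apply]
    simp only [boostHom, FieldAlgebra.map_φ]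
    congr 1
    ext x
    change f (boost (-(θ + θ')) x) = f (boost (-θ') (boost (-θ) x))
    rw [← boost_add, neg_add_rev]
  rw [h, StarAlgHom.comp_apply]

/-- The boost with rapidity `θ` as an automorphism of the Rindler algebra. -/
def boostAut (θ : ℝ) : FieldAlgebra wedge ≃⋆ₐ[ℂ] FieldAlgebra wedge :=
  StarAlgEquiv.ofBijective (boostHom θ)
    ⟨Function.LeftInverse.injective (g := boostHom (-θ)) fun x => by
        rw [← boostHom_add, neg_add_cancel, boostHom_zero],
      Function.RightInverse.surjective (g := boostHom (-θ)) fun x => by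
        rw [← boostHom_add, add_neg_cancel, boostHom_zero]⟩

/-- The one-parameter group of automorphisms of the Rindler algebra induced by the isometries
`η ↦ η + t`, that is, by the boosts with rapidity `a t`. -/
def rindlerGroup (a : ℝ) :
    Multiplicative ℝ →* (FieldAlgebra wedge ≃⋆ₐ[ℂ] FieldAlgebra wedge) where
  toFun t := boostAut (a * t.toAdd)
  map_one' := by
    ext x
    change boostHom (a * 0) x = x
    rw [mul_zero, boostHom_zero]
  map_mul' s t := by
    ext x
    change boostHom (a * (s.toAdd + t.toAdd)) x = boostHom (a * s.toAdd) (boostHom (a * t.toAdd) x)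
    rw [mul_add, boostHom_add]

end

end Unruh

/-!
The vacuum is constructed in a Fock representation. Polynomials in variables `Xᵢ` serve as the Fock
space: multiplication by a linear form creates, a constant-coefficient derivation annihilates, and
their sum obeys the canonical commutation relations as well as Wick's theorem
(`fieldOp_commutator`, `constantCoeff_fockVector`). A map `K` of test functions into a Hilbert space
that solves the field equation and whose two-point function `⟨K f̄, K g⟩` has the right
antisymmetric part therefore defines a Gaussian functional on the field algebra
(`IsOneParticle.exists_state`). Positivity holds for finitely many modes because the field
operators are then symmetric for the form in which monomials are orthogonal with squares `α!`; the
general case is a limit of such truncations along a Hilbert basis (`freeVev_positive`). Uniqueness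
is clear, since the words in the fields span the algebra and Wick's theorem determines their values.

For the vacuum, `K f` is the positive-frequency Fourier transform of `f` in `L²(ℝ³)`. Its
antisymmetric part is identified (`vacuumTwoPoint_sub`) without the explicit propagators: `f` is
expanded by Fourier inversion on time slices into partial waves `h(x₀) e^{ik·x}`, the wave equation
with such a source is solved by Duhamel's formula, and Green's identity moves the d'Alembertian
between this solution and `E^± g`.

By Wick's theorem the KMS condition reduces to the two-point function
(`IsThermalTwoPoint.hasKMSContinuation`): sums of products of functions of the differences
`z_j - z_i` inherit analyticity, continuity and boundedness, and exchanging two blocks of fields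
transposes the two-point function between them, which a Wick sum of symmetric weights does not
notice (`wickSum_append_comm`).

For the two-point function itself, a boost acts on a plane wave by shifting the rapidity of its
momentum. The relative rapidity `θ` is distributed evenly over both plane waves, so that for
`0 ≤ Im θ ≤ 2π` each has a rapidity with imaginary part between `0` and `π`; there plane waves are
bounded by `1` on the wedge (`norm_planeWave_onShell_le_one`), and the integral over momenta
converges to a holomorphic function of `θ`. It is bounded uniformly in `Re θ` because the measure
`d³k / |k|` is Lorentz invariant (`integral_momBoost`). At `Im θ = 2π` both momenta are boosted by
`iπ`, which reflects them up to a rotation about the first axis and so exchanges positive with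
negative frequencies, that is, the two arguments of the two-point function
(`thermalTwoPoint_upper`). This is the geometric reason for the temperature `a / 2π`.
-/

namespace Unruh

noncomputable section

/-! ### Wick sums -/

/-- The sum over all pairings of the entries of a list, each pair `p, q`, with `p` in front of `q`,
being weighted with `w p q`: the `n`-point function that Wick's theorem assigns to the two-point
function `w`. -/
def wickSum {V : Type} (w : V → V → ℂ) : List V → ℂ
  | [] => 1
  | f :: l => ∑ j : Fin l.length, w f (l.get j) * wickSum w (l.eraseIdx j)
termination_by l => l.length
decreasing_by
  have := List.length_eraseIdx_le l j
  simp only [List.length_cons]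
  omega

theorem wickSum_nil {V : Type} (w : V → V → ℂ) : wickSum w [] = 1 := by
  rw [wickSum]

theorem wickSum_cons {V : Type} (w : V → V → ℂ) (f : V) (l : List V) :
    wickSum w (f :: l) = ∑ j : Fin l.length, w f (l.get j) * wickSum w (l.eraseIdx j) := by
  rw [wickSum]

/-- A functional on words that satisfies the Wick recursion is the Wick sum. -/
theorem eq_wickSum {V : Type} (w : V → V → ℂ) (W : List V → ℂ) (h0 : W [] = 1)
    (h : ∀ f l, W (f :: l) = ∑ j : Fin l.length, w f (l.get j) * W (l.eraseIdx j))
    (l : List V) : W l = wickSum w l := by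
  induction hn : l.length using Nat.strong_induction_on generalizing l with
  | _ n ih =>
    cases l with
    | nil => rw [h0, wickSum_nil]
    | cons f l =>
      rw [h, wickSum_cons]
      refine Finset.sum_congr rfl fun j _ => ?_
      rw [ih _ ?_ _ rfl]
      have := List.length_eraseIdx_le l j
      simp only [List.length_cons] at hn
      omega

theorem wickSum_map {V V' : Type} (w : V → V → ℂ) (T : V' → V) (l : List V') :
    wickSum w (l.map T) = wickSum (fun p q => w (T p) (T q)) l := by
  refine eq_wickSum _ (fun l => wickSum w (l.map T)) (wickSum_nil w) (fun f l => ?_) l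
  simp only [List.map_cons, wickSum_cons]
  refine Fintype.sum_equiv (finCongr (by simp)) _ _ fun j => ?_
  simp [List.eraseIdx_map]

/-- Every class of functions that contains the constants `0` and `1` and is closed under sums and
products contains the Wick sums of its members. -/
theorem wickSum_mem {V α : Type} {P : (α → ℂ) → Prop} (h0 : P fun _ => 0) (h1 : P fun _ => 1)
    (hadd : ∀ u v, P u → P v → P fun z => u z + v z)
    (hmul : ∀ u v, P u → P v → P fun z => u z * v z) (w : α → V → V → ℂ) (l : List V)
    (hl : l.Pairwise fun p q => P fun z => w z p q) : P fun z => wickSum (w z) l := by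
  induction hn : l.length using Nat.strong_induction_on generalizing l with
  | _ n ih =>
    cases l with
    | nil => simpa only [wickSum_nil] using h1
    | cons f l =>
      simp only [wickSum_cons]
      have hs : ∀ s : Finset (Fin l.length),
          P fun z => ∑ j ∈ s, w z f (l.get j) * wickSum (w z) (l.eraseIdx j) := by
        intro s
        classical
        induction s using Finset.induction_on with
        | empty => simpa using h0
        | insert j s hj ihs =>
          simp only [Finset.sum_insert hj]
          refine hadd _ _ (hmul _ _ ?_ ?_) ihs
          · exact (List.pairwise_cons.1 hl).1 _ (List.get_mem _ _)
          · refine ih _ ?_ _ ((List.pairwise_cons.1 hl).2.sublist (List.eraseIdx_sublist _ _)) rfl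
            have := List.length_eraseIdx_le l j
            simp only [List.length_cons] at hn
            omega
      exact hs _

theorem wickSum_congr {V : Type} {w w' : V → V → ℂ} {l : List V}
    (hl : l.Pairwise fun p q => w p q = w' p q) : wickSum w l = wickSum w' l :=
  wickSum_mem (α := Bool) (P := fun h => h true = h false) rfl rfl
    (fun _ _ hu hv => congrArg₂ (· + ·) hu hv) (fun _ _ hu hv => congrArg₂ (· * ·) hu hv)
    (fun b => if b then w else w') l (by simpa using hl)

theorem tendsto_wickSum {V σ : Type} {F : Filter σ} {w : σ → V → V → ℂ} {w' : V → V → ℂ}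
    (h : ∀ p q, Filter.Tendsto (fun s => w s p q) F (nhds (w' p q))) (l : List V) :
    Filter.Tendsto (fun s => wickSum (w s) l) F (nhds (wickSum w' l)) :=
  wickSum_mem (α := Option σ)
    (P := fun h => Filter.Tendsto (fun s => h (some s)) F (nhds (h none)))
    tendsto_const_nhds tendsto_const_nhds (fun _ _ hu hv => hu.add hv)
    (fun _ _ hu hv => hu.mul hv) (fun o => o.elim w' w) l
    (List.pairwise_of_forall fun p q => h p q)

/-! ### Field operators on polynomials -/

section FieldOp

open MvPolynomial

variable {ι : Type}

/-- The polynomial `∑ cᵢ Xᵢ`; multiplication by it is the creation operator of `c`. -/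
def creation : (ι →₀ ℂ) →ₗ[ℂ] MvPolynomial ι ℂ := Finsupp.linearCombination ℂ X

/-- The annihilation operator: the derivation with `Xᵢ ↦ dᵢ`. -/
def annihilation (d : ι → ℂ) : Derivation ℂ (MvPolynomial ι ℂ) (MvPolynomial ι ℂ) :=
  mkDerivation ℂ fun i => C (d i)

/-- The pairing `∑ cᵢ dᵢ` of a creation with an annihilation operator. -/
def contraction (d : ι → ℂ) (c : ι →₀ ℂ) : ℂ := Finsupp.linearCombination ℂ d c

theorem annihilation_creation (d : ι → ℂ) (c : ι →₀ ℂ) :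
    annihilation d (creation c) = C (contraction d c) := by
  unfold annihilation creation contraction
  induction c using Finsupp.induction_linear with
  | zero => simp
  | add c c' h h' => simp only [map_add, h, h']
  | single i r => simp [smul_eq_C_mul]

theorem annihilation_comm (d d' : ι → ℂ) (p : MvPolynomial ι ℂ) :
    annihilation d (annihilation d' p) = annihilation d' (annihilation d p) := by
  have h : ⁅annihilation d, annihilation d'⁆ = 0 := by
    apply derivation_ext
    intro i
    rw [Derivation.commutator_apply]
    simp [annihilation]
  have := DFunLike.congr_fun h p
  rw [Derivation.commutator_apply] at this
  exact sub_eq_zero.1 this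

/-- The sum of a creation and an annihilation operator on the polynomials, which play the role of
the Fock space with vacuum `1`. -/
def fieldOp (c : ι →₀ ℂ) (d : ι → ℂ) : Module.End ℂ (MvPolynomial ι ℂ) :=
  LinearMap.mulLeft ℂ (creation c) + (annihilation d).toLinearMap

theorem fieldOp_apply (c : ι →₀ ℂ) (d : ι → ℂ) (p : MvPolynomial ι ℂ) :
    fieldOp c d p = creation c * p + annihilation d p := rfl

/-- The canonical commutation relation. -/
theorem fieldOp_commutator (c c' : ι →₀ ℂ) (d d' : ι → ℂ) :
    fieldOp c d * fieldOp c' d' - fieldOp c' d' * fieldOp c d =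
      algebraMap ℂ _ (contraction d c' - contraction d' c) := by
  refine LinearMap.ext fun p => ?_
  rw [LinearMap.sub_apply, Module.End.mul_apply, Module.End.mul_apply,
    Module.algebraMap_end_apply]
  simp only [fieldOp_apply, map_add, Derivation.leibniz, annihilation_creation, smul_eq_mul,
    annihilation_comm d d', sub_smul, smul_eq_C_mul]
  ring

theorem annihilation_fieldOp (d : ι → ℂ) (c : ι →₀ ℂ) (d' : ι → ℂ) (p : MvPolynomial ι ℂ) :
    annihilation d (fieldOp c d' p) =
      fieldOp c d' (annihilation d p) + contraction d c • p := by
  simp only [fieldOp_apply, map_add, Derivation.leibniz, annihilation_creation, smul_eq_mul,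
    annihilation_comm d d', smul_eq_C_mul]
  ring

variable {V : Type} (c : V → ι →₀ ℂ) (d : V → ι → ℂ)

/-- The vector obtained by applying a product of field operators to the vacuum. -/
def fockVector (l : List V) : MvPolynomial ι ℂ := (l.map fun f => fieldOp (c f) (d f)).prod 1

theorem fockVector_cons (f : V) (l : List V) :
    fockVector c d (f :: l) = fieldOp (c f) (d f) (fockVector c d l) := by
  simp [fockVector]

theorem annihilation_fockVector (e : ι → ℂ) (l : List V) :
    annihilation e (fockVector c d l) =
      ∑ j : Fin l.length, contraction e (c (l.get j)) • fockVector c d (l.eraseIdx j) := by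
  induction l with
  | nil => simp [fockVector]
  | cons g l ih =>
    rw [fockVector_cons, annihilation_fieldOp, ih, map_sum]
    rw [show ∑ j : Fin (g :: l).length, contraction e (c ((g :: l).get j)) •
      fockVector c d ((g :: l).eraseIdx j) = _ from Fin.sum_univ_succ _]
    simp [fockVector_cons, add_comm]

/-- Wick's theorem: vacuum expectation values of products of field operators are Wick sums. -/
theorem constantCoeff_fockVector (l : List V) :
    constantCoeff (fockVector c d l) = wickSum (fun f g => contraction (d f) (c g)) l := by
  refine eq_wickSum _ (fun l => constantCoeff (fockVector c d l)) ?_ (fun f l => ?_) l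
  · simp [fockVector]
  · have h : constantCoeff (creation (c f)) = 0 := by
      unfold creation
      induction c f using Finsupp.induction_linear with
      | zero => simp
      | add c c' h h' => simp only [map_add, h, h', add_zero]
      | single i r => simp
    rw [fockVector_cons, fieldOp_apply, map_add, map_mul, h, zero_mul, zero_add,
      annihilation_fockVector, map_sum]
    simp [smul_eq_C_mul]

end FieldOp

/-- For a symmetric weight the field operators commute, so the Wick sum does not depend on the
order of the entries. -/
theorem wickSum_perm {n : ℕ} {w : Fin n → Fin n → ℂ} (hw : ∀ i j, w i j = w j i)
    {l l' : List (Fin n)} (h : l.Perm l') : wickSum w l = wickSum w l' := by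
  have hc : (fun f g => contraction (w f) (Finsupp.single g (1 : ℂ))) = w := by
    funext f g
    simp [contraction]
  rw [← hc, ← constantCoeff_fockVector (fun g => Finsupp.single g (1 : ℂ)) w,
    ← constantCoeff_fockVector (fun g => Finsupp.single g (1 : ℂ)) w]
  unfold fockVector
  rw [List.Perm.prod_eq' (h.map _)]
  refine List.Pairwise.map _ (fun i j _ => ?_) (List.pairwise_of_forall (R := fun _ _ => True)
    fun _ _ => trivial)
  have := fieldOp_commutator (Finsupp.single i (1 : ℂ)) (Finsupp.single j 1) (w i) (w j)
  rw [show contraction (w i) (Finsupp.single j (1 : ℂ)) -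
    contraction (w j) (Finsupp.single i 1) = 0 by simp [contraction, hw i j], map_zero] at this
  exact sub_eq_zero.1 this

/-- Exchanging two blocks of a Wick sum amounts to transposing the weight between them. -/
theorem wickSum_append_comm {V : Type} {w w' : V → V → ℂ} {A B : List V}
    (hA : A.Pairwise fun p q => w p q = w' p q) (hB : B.Pairwise fun p q => w p q = w' p q)
    (hAB : ∀ p ∈ A, ∀ q ∈ B, w p q = w' q p) : wickSum w (A ++ B) = wickSum w' (B ++ A) := by
  set L := A ++ B with hL
  set I := (List.finRange L.length).take A.length with hI
  set J := (List.finRange L.length).drop A.length with hJ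
  have hIJ : I ++ J = List.finRange L.length := List.take_append_drop _ _
  have hmap : (List.finRange L.length).map L.get = L := by
    rw [← List.ofFn_eq_map, List.ofFn_get]
  have hIA : I.map L.get = A := by
    rw [hI, List.map_take, hmap, hL, List.take_left]
  have hJB : J.map L.get = B := by
    rw [hJ, List.map_drop, hmap, hL, List.drop_left]
  have hlt : (I ++ J).Pairwise (· < ·) := by
    rw [hIJ]
    exact List.pairwise_lt_finRange _
  obtain ⟨hI', hJ', hIJ'⟩ := List.pairwise_append.1 hlt
  -- the weight of two positions, whatever their order
  let s : Fin L.length → Fin L.length → ℂ := fun i j =>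
    if i < j then w (L.get i) (L.get j) else if j < i then w (L.get j) (L.get i) else 0
  have hs : ∀ i j, s i j = s j i := by
    intro i j
    rcases lt_trichotomy i j with h | h | h
    · simp [s, h, h.not_gt]
    · rw [h]
    · simp [s, h, h.not_gt]
  have hs1 : ∀ i j, i < j → s i j = w (L.get i) (L.get j) := fun i j h => by simp only [s, if_pos h]
  have hs2 : ∀ i j, i < j → s j i = w (L.get i) (L.get j) := fun i j h => by rw [hs, hs1 i j h]
  rw [← hIA, List.pairwise_map] at hA
  rw [← hJB, List.pairwise_map] at hB
  have e1 : wickSum w L = wickSum s (I ++ J) := by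
    conv_lhs => rw [← hmap, ← hIJ, wickSum_map]
    exact wickSum_congr (hlt.imp fun {i j} h => (hs1 i j h).symm)
  have e2 : wickSum w' (B ++ A) = wickSum s (J ++ I) := by
    conv_lhs => rw [← hIA, ← hJB, ← List.map_append, wickSum_map]
    refine wickSum_congr (List.pairwise_append.2 ⟨?_, ?_, ?_⟩)
    · exact hJ'.imp₂ (fun i j h h' => by rw [hs1 i j h, h']) hB
    · exact hI'.imp₂ (fun i j h h' => by rw [hs1 i j h, h']) hA
    · intro j hj i hi
      rw [hs2 i j (hIJ' i hi j hj)]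
      refine (hAB _ ?_ _ ?_).symm
      · rw [← hIA]
        exact List.mem_map_of_mem hi
      · rw [← hJB]
        exact List.mem_map_of_mem hj
  rw [e1, e2]
  exact wickSum_perm hs List.perm_append_comm

/-! ### The inner product of the Fock space and positivity -/

section Bargmann

open MvPolynomial

variable {ι : Type}

/-- The bilinear form on polynomials for which the monomials `X^α` are orthogonal with square
`α!`. -/
def bargmann : MvPolynomial ι ℂ →ₗ[ℂ] MvPolynomial ι ℂ →ₗ[ℂ] ℂ :=
  (basisMonomials ι ℂ).constr ℂ fun α => ((α.prod fun _ n => n.factorial : ℕ) : ℂ) • lcoeff ℂ α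

theorem bargmann_monomial (α : ι →₀ ℕ) (r : ℂ) (q : MvPolynomial ι ℂ) :
    bargmann (monomial α r) q = r * (((α.prod fun _ n => n.factorial : ℕ) : ℂ) * coeff α q) := by
  have h : monomial α r = r • basisMonomials ι ℂ α := by simp [smul_monomial]
  rw [h, map_smul]
  unfold bargmann
  rw [Module.Basis.constr_basis]
  simp [lcoeff]

theorem bargmann_eq_sum (p q : MvPolynomial ι ℂ) :
    bargmann p q = ∑ α ∈ p.support,
      coeff α p * (((α.prod fun _ n => n.factorial : ℕ) : ℂ) * coeff α q) := by
  conv_lhs => rw [p.as_sum]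
  rw [map_sum, LinearMap.sum_apply]
  simp only [bargmann_monomial]

theorem bargmann_symm (p q : MvPolynomial ι ℂ) : bargmann p q = bargmann q p := by
  induction p using MvPolynomial.induction_on' with
  | add p p' h h' => rw [map_add, map_add, LinearMap.add_apply, h, h']
  | monomial α r =>
    induction q using MvPolynomial.induction_on' with
    | add q q' h h' => rw [map_add, map_add, LinearMap.add_apply, h, h']
    | monomial β t =>
      classical
      rw [bargmann_monomial, bargmann_monomial, coeff_monomial, coeff_monomial]
      by_cases h : α = β
      · subst h
        simp
        ring
      · simp [h, Ne.symm h]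

theorem prod_factorial_add_single (α : ι →₀ ℕ) (i : ι) :
    ((α + Finsupp.single i 1).prod fun _ n => n.factorial) =
      (α i + 1) * α.prod fun _ n => n.factorial := by
  classical
  have h : ∀ β : ι →₀ ℕ, (β.prod fun _ n => n.factorial) =
      (β i).factorial * (β.erase i).prod fun _ n => n.factorial := fun β =>
    (Finsupp.mul_prod_erase' β i _ fun _ => rfl).symm
  have he : (α + Finsupp.single i 1).erase i = α.erase i := by
    ext k
    by_cases hk : k = i
    · simp [hk]
    · simp [hk]
  rw [h, h α, he]
  simp [Nat.factorial_succ, mul_assoc]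

theorem bargmann_X_mul (i : ι) (p q : MvPolynomial ι ℂ) :
    bargmann (X i * p) q = bargmann p (pderiv i q) := by
  induction p using MvPolynomial.induction_on' with
  | add p p' h h' => simp only [mul_add, map_add, LinearMap.add_apply, h, h']
  | monomial α r =>
    have : X i * monomial α r = monomial (α + Finsupp.single i 1) r := by
      rw [X, monomial_mul, one_mul, add_comm]
    rw [this, bargmann_monomial, bargmann_monomial, prod_factorial_add_single, coeff_pderiv]
    push_cast
    ring

theorem annihilation_zero (p : MvPolynomial ι ℂ) : annihilation (0 : ι → ℂ) p = 0 := by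
  have : annihilation (0 : ι → ℂ) = 0 := derivation_ext fun i => by simp [annihilation]
  rw [this]
  rfl

theorem annihilation_add (d d' : ι → ℂ) (p : MvPolynomial ι ℂ) :
    annihilation (d + d') p = annihilation d p + annihilation d' p := by
  have : annihilation (d + d') = annihilation d + annihilation d' :=
    derivation_ext fun i => by simp [annihilation]
  rw [this]
  rfl

theorem annihilation_single [DecidableEq ι] (i : ι) (r : ℂ) (p : MvPolynomial ι ℂ) :
    annihilation (Pi.single i r) p = r • pderiv i p := by
  have : annihilation (Pi.single i r) = r • pderiv i := derivation_ext fun k => by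
    by_cases h : k = i
    · subst h
      simp [annihilation, smul_eq_C_mul]
    · simp [annihilation, h, pderiv_X]
  rw [this]
  rfl

theorem bargmann_creation_mul (c : ι →₀ ℂ) (p q : MvPolynomial ι ℂ) :
    bargmann (creation c * p) q = bargmann p (annihilation c q) := by
  classical
  induction c using Finsupp.induction_linear with
  | zero => simp [annihilation_zero]
  | add c c' h h' =>
    rw [map_add, add_mul, map_add, LinearMap.add_apply, h, h', Finsupp.coe_add, annihilation_add,
      map_add]
  | single i r =>
    rw [Finsupp.single_eq_pi_single, annihilation_single]
    simp [creation, bargmann_X_mul]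

theorem map_conj_annihilation (c : ι →₀ ℂ) (p : MvPolynomial ι ℂ) :
    map (starRingEnd ℂ) (annihilation (fun i => conj (c i)) p) =
      annihilation c (map (starRingEnd ℂ) p) := by
  classical
  induction c using Finsupp.induction_linear with
  | zero =>
    have h : (fun i : ι => conj ((0 : ι →₀ ℂ) i)) = 0 := by
      funext i
      simp
    rw [h, Finsupp.coe_zero, annihilation_zero, annihilation_zero, map_zero]
  | add c c' h h' =>
    have h2 : (fun i : ι => conj ((c + c') i)) = (fun i => conj (c i)) + fun i => conj (c' i) := by
      funext i
      simp
    rw [h2, annihilation_add, map_add, h, h', Finsupp.coe_add, annihilation_add]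
  | single i r =>
    have h2 : (fun k : ι => conj (Finsupp.single i r k)) = Pi.single i (conj r) := by
      funext k
      by_cases h : k = i
      · subst h
        simp
      · simp [h]
    rw [h2, Finsupp.single_eq_pi_single, annihilation_single, annihilation_single, pderiv_map]
    simp [smul_eq_C_mul]

theorem map_conj_creation (c : ι →₀ ℂ) :
    map (starRingEnd ℂ) (creation c) =
      creation (c.mapRange (starRingEnd ℂ) (map_zero _)) := by
  unfold creation
  induction c using Finsupp.induction_linear with
  | zero => simp
  | add c c' h h' => rw [map_add, map_add, h, h', Finsupp.mapRange_add (map_add _), map_add]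
  | single i r => simp [smul_eq_C_mul]

/-- The adjoint of a field operator. -/
theorem bargmann_fieldOp (c c' : ι →₀ ℂ) (p q : MvPolynomial ι ℂ) :
    bargmann (map (starRingEnd ℂ) (fieldOp c (fun i => conj (c' i)) p)) q =
      bargmann (map (starRingEnd ℂ) p) (fieldOp c' (fun i => conj (c i)) q) := by
  rw [fieldOp_apply, fieldOp_apply, map_add, map_mul, map_add, LinearMap.add_apply,
    map_conj_creation, bargmann_creation_mul, map_conj_annihilation, map_add,
    bargmann_symm _ (creation c' * q), bargmann_creation_mul, bargmann_symm q, add_comm]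
  rfl

theorem bargmann_conj_self_nonneg (p : MvPolynomial ι ℂ) :
    0 ≤ bargmann (map (starRingEnd ℂ) p) p := by
  rw [bargmann_eq_sum]
  refine Finset.sum_nonneg fun α _ => ?_
  rw [coeff_map]
  have h : conj (coeff α p) * (((α.prod fun _ n => n.factorial : ℕ) : ℂ) * coeff α p) =
      ((α.prod fun _ n => n.factorial : ℕ) : ℂ) * (star (coeff α p) * coeff α p) := by
    simp only [starRingEnd_apply]
    ring
  rw [h]
  exact mul_nonneg (Nat.cast_nonneg _) (star_mul_self_nonneg _)

end Bargmann

/-! ### Quasi-free functionals on the free algebra -/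

section Free

open FreeStarAlgebra

variable {X ι : Type}

theorem FreeStarAlgebra.span_words :
    Submodule.span ℂ (Set.range fun l : List (X × Bool) => (l.map letter).prod) = ⊤ := by
  rw [eq_top_iff]
  have h : Algebra.adjoin ℂ (Set.range (letter : X × Bool → FreeStarAlgebra X)) = ⊤ :=
    FreeAlgebra.adjoin_range_ι (R := ℂ) (X := X × Bool)
  rw [← Algebra.top_toSubmodule, ← h, Algebra.adjoin_eq_span]
  refine Submodule.span_mono fun a ha => ?_
  obtain ⟨l, hl, rfl⟩ := Submonoid.exists_list_of_mem_closure ha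
  have hl' : l ∈ Set.range (List.map (letter : X × Bool → FreeStarAlgebra X)) := by
    rw [Set.range_list_map]
    exact hl
  obtain ⟨l', rfl⟩ := hl'
  exact ⟨l', rfl⟩

/-- The field label that a letter stands for, the adjoint being described by the involution `J` of
the labels. -/
def letterLabel (J : X → X) (p : X × Bool) : X := if p.2 then p.1 else J p.1

/-- The representation of the free algebra by field operators. -/
def freeRep (J : X → X) (c : X → ι →₀ ℂ) (d : X → ι → ℂ) :
    FreeStarAlgebra X →ₐ[ℂ] Module.End ℂ (MvPolynomial ι ℂ) :=
  FreeAlgebra.lift ℂ fun p : X × Bool => fieldOp (c (letterLabel J p)) (d (letterLabel J p))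

theorem freeRep_letter (J : X → X) (c : X → ι →₀ ℂ) (d : X → ι → ℂ) (p : X × Bool) :
    freeRep J c d (letter p) = fieldOp (c (letterLabel J p)) (d (letterLabel J p)) :=
  FreeAlgebra.lift_ι_apply _ _

/-- The vacuum expectation value in the representation by field operators: the vacuum is the
polynomial `1`, and the projection onto it is the constant coefficient. -/
def freeVev (J : X → X) (c : X → ι →₀ ℂ) (d : X → ι → ℂ) : FreeStarAlgebra X →ₗ[ℂ] ℂ where
  toFun a := MvPolynomial.constantCoeff (freeRep J c d a 1)
  map_add' a b := by simp
  map_smul' r a := by simp [MvPolynomial.smul_eq_C_mul]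

theorem freeVev_word (J : X → X) (c : X → ι →₀ ℂ) (d : X → ι → ℂ) (l : List (X × Bool)) :
    freeVev J c d (l.map letter).prod =
      wickSum (fun f g => contraction (d f) (c g)) (l.map (letterLabel J)) := by
  rw [← constantCoeff_fockVector]
  change MvPolynomial.constantCoeff (freeRep J c d (l.map letter).prod 1) = _
  rw [map_list_prod, List.map_map, fockVector, List.map_map]
  congr 4
  funext p
  exact freeRep_letter J c d p

theorem bargmann_freeRep (J : X → X) (hJ : ∀ f, J (J f) = f) (c : X → ι →₀ ℂ)
    (a : FreeStarAlgebra X) (p q : MvPolynomial ι ℂ) :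
    bargmann (MvPolynomial.map (starRingEnd ℂ)
      (freeRep J c (fun f i => conj (c (J f) i)) a p)) q =
      bargmann (MvPolynomial.map (starRingEnd ℂ) p)
        (freeRep J c (fun f i => conj (c (J f) i)) (star a) q) := by
  induction a using FreeStarAlgebra.induct generalizing p q with
  | hs r =>
    rw [star_scalar, AlgHom.commutes, AlgHom.commutes]
    simp [Module.algebraMap_end_apply, MvPolynomial.smul_eq_C_mul]
    simp only [← MvPolynomial.smul_eq_C_mul, map_smul, LinearMap.smul_apply]
  | hl x =>
    have h : J (letterLabel J x) = letterLabel J (x.1, !x.2) := by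
      rcases x with ⟨f, _ | _⟩ <;> simp [letterLabel, hJ]
    have h' : J (letterLabel J (x.1, !x.2)) = letterLabel J x := by rw [← h, hJ]
    rw [star_letter, freeRep_letter, freeRep_letter, bargmann_fieldOp, h, h']
  | hm a b iha ihb =>
    rw [star_mul, map_mul, map_mul, Module.End.mul_apply, Module.End.mul_apply, iha, ihb]
  | ha a b iha ihb =>
    rw [star_add, map_add, map_add, LinearMap.add_apply, LinearMap.add_apply, map_add, map_add,
      LinearMap.add_apply, iha, ihb, map_add]

/-- Positivity for finitely many degrees of freedom. -/
theorem freeVev_star_mul_self_nonneg (J : X → X) (hJ : ∀ f, J (J f) = f) (c : X → ι →₀ ℂ)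
    (a : FreeStarAlgebra X) : 0 ≤ freeVev J c (fun f i => conj (c (J f) i)) (star a * a) := by
  have h : ∀ q : MvPolynomial ι ℂ,
      MvPolynomial.constantCoeff q = bargmann (MvPolynomial.map (starRingEnd ℂ) 1) q := by
    intro q
    rw [map_one, MvPolynomial.one_def, bargmann_monomial]
    simp [MvPolynomial.constantCoeff_eq]
  change 0 ≤ MvPolynomial.constantCoeff (freeRep J c _ (star a * a) 1)
  rw [h, map_mul, Module.End.mul_apply, ← bargmann_freeRep J hJ]
  exact bargmann_conj_self_nonneg _

/-- Positivity of a quasi-free functional whose two-point function is given by the inner product of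
a Hilbert space `H`: truncating to finitely many members of an orthonormal basis of `H` reduces it
to the case of finitely many degrees of freedom. -/
theorem freeVev_positive {H : Type} [NormedAddCommGroup H] [InnerProductSpace ℂ H]
    [CompleteSpace H] (K : X → H) (J : X → X) (hJ : ∀ f, J (J f) = f) (c : X → ι →₀ ℂ)
    (d : X → ι → ℂ) (h : ∀ f g, contraction (d f) (c g) = inner ℂ (K (J f)) (K g))
    (a : FreeStarAlgebra X) : 0 ≤ freeVev J c d (star a * a) := by
  classical
  obtain ⟨w, b, -⟩ := exists_hilbertBasis ℂ H
  let cs : Finset w → X → w →₀ ℂ := fun s f => ∑ i ∈ s, Finsupp.single i (inner ℂ (b i) (K f))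
  have hcs : ∀ s f i, cs s f i = if i ∈ s then inner ℂ (b i) (K f) else 0 := by
    intro s f i
    simp [cs, Finsupp.finsetSum_apply, Finsupp.single_apply]
  have hlim : ∀ f g, Filter.Tendsto
      (fun s => contraction (fun i => conj (cs s (J f) i)) (cs s g)) Filter.atTop
      (nhds (contraction (d f) (c g))) := by
    intro f g
    rw [h]
    refine (b.hasSum_inner_mul_inner (K (J f)) (K g)).congr fun s => ?_
    unfold contraction
    rw [Finsupp.linearCombination_apply, Finsupp.sum_of_support_subset (s := s)]
    · refine Finset.sum_congr rfl fun i hi => ?_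
      rw [hcs, hcs, if_pos hi, if_pos hi, inner_conj_symm, smul_eq_mul, mul_comm]
    · intro i hi
      by_contra hn
      rw [Finsupp.mem_support_iff, hcs, if_neg hn] at hi
      exact hi rfl
    · simp
  have htend : ∀ x : FreeStarAlgebra X, Filter.Tendsto
      (fun s => freeVev J (cs s) (fun f i => conj (cs s (J f) i)) x) Filter.atTop
      (nhds (freeVev J c d x)) := by
    intro x
    have hx : x ∈ Submodule.span ℂ (Set.range fun l : List (X × Bool) => (l.map letter).prod) := by
      rw [FreeStarAlgebra.span_words]
      trivial
    induction hx using Submodule.span_induction with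
    | mem x hx =>
      obtain ⟨l, rfl⟩ := hx
      simp only [freeVev_word]
      exact tendsto_wickSum hlim _
    | zero => simp
    | add x y _ _ hx hy => simpa only [map_add] using hx.add hy
    | smul r x _ hx => simpa only [map_smul] using hx.const_smul r
  exact ge_of_tendsto' (htend _) fun s => freeVev_star_mul_self_nonneg J hJ (cs s) a

end Free

/-! ### Gaussian functionals on the field algebra -/

section Field

open FreeStarAlgebra FieldAlgebra

variable {O : TopologicalSpace.Opens Spacetime}

theorem conjFn_conjFn (f : TestFn O) : conjFn (conjFn f) = f := by
  ext x
  exact Complex.conj_conj _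

theorem FieldAlgebra.mk_letter (p : TestFn O × Bool) :
    mk O (letter p) = φ (letterLabel conjFn p) := by
  rcases p with ⟨f, _ | _⟩
  · have h : letter (f, false) = star (gen f) := (star_letter (f, true)).symm
    rw [h]
    exact mk_rel (FieldRel.hermitian f)
  · rfl

theorem FieldAlgebra.mk_word (l : List (TestFn O × Bool)) :
    mk O (l.map letter).prod = ((l.map (letterLabel conjFn)).map φ).prod := by
  rw [map_list_prod, List.map_map, List.map_map]
  congr 2
  funext p
  exact FieldAlgebra.mk_letter p

theorem FieldAlgebra.span_words :
    Submodule.span ℂ (Set.range fun l : List (TestFn O) => (l.map φ).prod) = ⊤ := by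
  rw [eq_top_iff]
  rintro a -
  obtain ⟨a, rfl⟩ := mk_surjective a
  have ha : a ∈ Submodule.span ℂ
      (Set.range fun l : List (TestFn O × Bool) => (l.map letter).prod) := by
    rw [FreeStarAlgebra.span_words]
    trivial
  induction ha using Submodule.span_induction with
  | mem x hx =>
    obtain ⟨l, rfl⟩ := hx
    rw [FieldAlgebra.mk_word]
    exact Submodule.subset_span ⟨_, rfl⟩
  | zero =>
    rw [map_zero]
    exact zero_mem _
  | add x y _ _ hx hy =>
    rw [map_add]
    exact add_mem hx hy
  | smul r x _ hx =>
    rw [map_smul]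
    exact Submodule.smul_mem _ _ hx

theorem IsGaussian.apply_word {w : TestFn O → TestFn O → ℂ} {ω : FieldAlgebra O →ₗ[ℂ] ℂ}
    (h : IsGaussian w ω) (h1 : ω 1 = 1) (l : List (TestFn O)) :
    ω (l.map φ).prod = wickSum w l := by
  refine eq_wickSum w (fun l => ω (l.map φ).prod) (by simpa using h1) (fun f l => ?_) l
  simp only [List.map_cons, List.prod_cons]
  exact h f l

theorem IsGaussian.unique {w : TestFn O → TestFn O → ℂ} {ω ω' : FieldAlgebra O →ₗ[ℂ] ℂ}
    (h : IsGaussian w ω) (h1 : ω 1 = 1) (h' : IsGaussian w ω') (h1' : ω' 1 = 1) : ω = ω' := by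
  refine LinearMap.ext_on (s := Set.range fun l : List (TestFn O) => (l.map φ).prod)
    FieldAlgebra.span_words ?_
  rintro _ ⟨l, rfl⟩
  rw [h.apply_word h1, h'.apply_word h1']

theorem partial₂_conj {f : Spacetime → ℂ} (hf : ContDiff ℝ 2 f) (μ ν : Fin 4) (x : Spacetime) :
    partial₂ (fun y => conj (f y)) μ ν x = conj (partial₂ f μ ν x) := by
  unfold partial₂
  have h := Complex.conjCLE.toContinuousLinearMap.iteratedFDeriv_comp_left (x := x)
    hf.contDiffAt (i := 2) le_rfl
  have h' : (fun y => conj (f y)) = Complex.conjCLE.toContinuousLinearMap ∘ f := rfl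
  rw [h', h]
  rfl

theorem TestFn.contDiff_two (f : TestFn O) : ContDiff ℝ 2 f :=
  f.contDiff.of_le (WithTop.coe_le_coe.2 (le_top : (2 : ℕ∞) ≤ ⊤))

theorem box_conjFn (f : TestFn O) (x : Spacetime) : box (conjFn f) x = conj (box f x) := by
  have h : ((conjFn f : TestFn O) : Spacetime → ℂ) = fun y => conj (f y) := rfl
  rw [h]
  unfold box
  simp only [partial₂_conj (TestFn.contDiff_two f), map_add, map_neg, map_sum]

/-- A one-particle structure: a complex linear map `K` of test functions into a Hilbert space that
solves the field equation and for which the antisymmetric part of the two-point function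
`⟨K f̄, K g⟩` is `i` times the commutator function. -/
structure IsOneParticle {H : Type} [NormedAddCommGroup H] [InnerProductSpace ℂ H]
    (K : TestFn O → H) : Prop where
  linear : ∀ (c₁ c₂ : ℂ) (f₁ f₂ : TestFn O), K (c₁ • f₁ + c₂ • f₂) = c₁ • K f₁ + c₂ • K f₂
  field : ∀ f h : TestFn O, (∀ x, h x = box f x) → K h = 0
  commutator : ∀ (f g : TestFn O) (u v : Spacetime → ℂ), IsRetardedSolution g u →
    IsAdvancedSolution g v → inner ℂ (K (conjFn f)) (K g) - inner ℂ (K (conjFn g)) (K f) =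
      Complex.I * ∫ x, f x * (u x - v x)

theorem fieldOp_linear {ι : Type} (r₁ r₂ : ℂ) (c₁ c₂ : ι →₀ ℂ) (d₁ d₂ : ι → ℂ) :
    fieldOp (r₁ • c₁ + r₂ • c₂) (r₁ • d₁ + r₂ • d₂) = r₁ • fieldOp c₁ d₁ + r₂ • fieldOp c₂ d₂ := by
  have h : annihilation (r₁ • d₁ + r₂ • d₂) = r₁ • annihilation d₁ + r₂ • annihilation d₂ :=
    MvPolynomial.derivation_ext fun i => by
      simp [annihilation, MvPolynomial.smul_eq_C_mul]
  refine LinearMap.ext fun p => ?_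
  simp only [fieldOp_apply, h, map_add, map_smul, LinearMap.add_apply, LinearMap.smul_apply,
    Derivation.add_apply, Derivation.smul_apply, add_mul, smul_mul_assoc, smul_add]
  abel

variable {H : Type} [NormedAddCommGroup H] [InnerProductSpace ℂ H]

/-- The two-point function of the field operators of a one-particle structure. Creation operators
need finitely many coefficients, which an algebraic basis provides; it need not be orthonormal. -/
theorem contraction_repr {ι : Type} (b : Module.Basis ι ℂ H) (x y : H) :
    contraction (fun i => inner ℂ x (b i)) (b.repr y) = inner ℂ x y := by
  conv_rhs => rw [← b.linearCombination_repr y]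
  unfold contraction
  rw [Finsupp.linearCombination_apply, Finsupp.linearCombination_apply, Finsupp.sum,
    Finsupp.sum, inner_sum]
  simp only [inner_smul_right, smul_eq_mul]

/-- The field operators of a one-particle structure satisfy the relations of the field algebra.
The adjoint relations are carried along, since the relations are closed under adjoints. -/
theorem IsOneParticle.freeRep_rel {K : TestFn O → H} (hK : IsOneParticle K) {ι : Type}
    (b : Module.Basis ι ℂ H) {x y : FreeStarAlgebra (TestFn O)} (hxy : FieldRel O x y) :
    freeRep conjFn (fun f => b.repr (K f)) (fun f i => inner ℂ (K (conjFn f)) (b i)) x =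
        freeRep conjFn (fun f => b.repr (K f)) (fun f i => inner ℂ (K (conjFn f)) (b i)) y ∧
      freeRep conjFn (fun f => b.repr (K f)) (fun f i => inner ℂ (K (conjFn f)) (b i)) (star x) =
        freeRep conjFn (fun f => b.repr (K f)) (fun f i => inner ℂ (K (conjFn f)) (b i))
          (star y) := by
  set π := freeRep (conjFn (O := O)) (fun f => b.repr (K f))
    (fun f i => inner ℂ (K (conjFn f)) (b i)) with hπ
  have hg : ∀ f, π (gen f) = fieldOp (b.repr (K f)) (fun i => inner ℂ (K (conjFn f)) (b i)) :=
    fun f => freeRep_letter _ _ _ (f, true)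
  have hsg : ∀ f, π (star (gen f)) =
      fieldOp (b.repr (K (conjFn f))) (fun i => inner ℂ (K f) (b i)) := by
    intro f
    have h := freeRep_letter (conjFn (O := O)) (fun f => b.repr (K f))
      (fun f i => inner ℂ (K (conjFn f)) (b i)) (f, false)
    rw [show star (gen f) = letter (f, false) from star_letter (f, true), hπ, h]
    simp [letterLabel, conjFn_conjFn]
  have hcon : ∀ f g, contraction (fun i => inner ℂ (K f) (b i)) (b.repr (K g)) =
      inner ℂ (K f) (K g) := fun f g => contraction_repr b _ _
  have hconj : ∀ (c₁ c₂ : ℂ) (f₁ f₂ : TestFn O), conjFn (c₁ • f₁ + c₂ • f₂) =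
      conj c₁ • conjFn f₁ + conj c₂ • conjFn f₂ := by
    intro c₁ c₂ f₁ f₂
    ext x
    change conj (c₁ * f₁ x + c₂ * f₂ x) = conj c₁ * conj (f₁ x) + conj c₂ * conj (f₂ x)
    simp
  induction hxy with
  | linear c₁ c₂ f₁ f₂ =>
    constructor
    · rw [map_add, map_smul, map_smul, hg, hg, hg, hK.linear, map_add, map_smul, map_smul,
        ← fieldOp_linear]
      congr 1
      funext i
      rw [hconj, hK.linear, inner_add_left, inner_smul_left, inner_smul_left]
      simp
    · rw [star_add, star_smul, star_smul, map_add, map_smul, map_smul, hsg, hsg, hsg, hconj,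
        hK.linear, map_add, map_smul, map_smul, ← fieldOp_linear]
      congr 1
      funext i
      rw [hK.linear, inner_add_left, inner_smul_left, inner_smul_left]
      simp
  | field f h hf =>
    have h1 : K h = 0 := hK.field f h hf
    have h2 : K (conjFn h) = 0 := hK.field (conjFn f) (conjFn h) fun x => by
      rw [box_conjFn, ← hf]
      rfl
    have h3 : fieldOp (0 : ι →₀ ℂ) (0 : ι → ℂ) = 0 := by
      simpa using fieldOp_linear 0 0 (0 : ι →₀ ℂ) 0 (0 : ι → ℂ) 0
    rw [star_zero, map_zero, hg, hsg, h1, h2]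
    simp only [map_zero, inner_zero_left]
    exact ⟨h3, h3⟩
  | hermitian f =>
    rw [star_star, hsg, hg, hg, hsg, conjFn_conjFn]
    exact ⟨rfl, rfl⟩
  | commutator f g u v hu hv =>
    have h := hK.commutator f g u v hu hv
    constructor
    · rw [map_sub, map_mul, map_mul, AlgHom.commutes, hg, hg, fieldOp_commutator, hcon, hcon, h]
    · rw [star_sub, star_mul, star_mul, map_sub, map_mul, map_mul, hsg, hsg, fieldOp_commutator,
        hcon, hcon, ← h, star_scalar, AlgHom.commutes]
      simp [inner_conj_symm]
  | adjoint _ ih => exact ⟨ih.2, by rw [star_star, star_star]; exact ih.1⟩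

/-- Every one-particle structure defines a Gaussian state. -/
theorem IsOneParticle.exists_state [CompleteSpace H] {K : TestFn O → H} (hK : IsOneParticle K) :
    ∃ ω : FieldAlgebra O →ₗ[ℂ] ℂ,
      IsState ω ∧ IsGaussian (fun f g => inner ℂ (K (conjFn f)) (K g)) ω := by
  let b := Module.Basis.ofVectorSpace ℂ H
  let c : TestFn O → _ →₀ ℂ := fun f => b.repr (K f)
  let d : TestFn O → _ → ℂ := fun f i => inner ℂ (K (conjFn f)) (b i)
  have hcon : ∀ f g, contraction (d f) (c g) = inner ℂ (K (conjFn f)) (K g) := fun f g =>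
    contraction_repr b _ _
  let π : FieldAlgebra O →ₐ[ℂ] Module.End ℂ _ :=
    RingQuot.liftAlgHom ℂ ⟨freeRep conjFn c d, fun _ _ hab => (hK.freeRep_rel b hab).1⟩
  have hπ : ∀ a, π (FieldAlgebra.mk O a) = freeRep conjFn c d a := fun a =>
    RingQuot.liftAlgHom_mkAlgHom_apply ℂ _ _ a
  let ω : FieldAlgebra O →ₗ[ℂ] ℂ :=
    { toFun := fun a => MvPolynomial.constantCoeff (π a 1)
      map_add' := fun a b => by simp
      map_smul' := fun r a => by simp [MvPolynomial.smul_eq_C_mul] }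
  have hω : ∀ a, ω (FieldAlgebra.mk O a) = freeVev conjFn c d a := by
    intro a
    change MvPolynomial.constantCoeff (π (FieldAlgebra.mk O a) 1) = _
    rw [hπ]
    rfl
  have hword : ∀ l : List (TestFn O),
      ω (l.map φ).prod = wickSum (fun f g => inner ℂ (K (conjFn f)) (K g)) l := by
    intro l
    have h := FieldAlgebra.mk_word (l.map fun f => (f, true))
    have hl : (l.map fun f => (f, true)).map (letterLabel conjFn) = l := by
      rw [List.map_map]
      exact List.map_id l
    rw [hl] at h
    rw [← h, hω, freeVev_word, hl]
    simp only [hcon]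
  refine ⟨ω, ⟨?_, fun a => ?_⟩, fun f l => ?_⟩
  · simpa [wickSum_nil] using hword []
  · obtain ⟨a, rfl⟩ := mk_surjective a
    rw [← mk_star, ← map_mul, hω]
    exact freeVev_positive K conjFn conjFn_conjFn c d hcon a
  · have h := hword (f :: l)
    rw [List.map_cons, List.prod_cons] at h
    rw [h, wickSum_cons]
    simp only [hword]

end Field

/-! ### From the two-point function to the KMS condition -/

section Multilinear

/-- An entry of a list enters the product of the rotated list through a two-sided multiplication. -/
theorem exists_rotate_prod_set {A : Type} [Ring A] (l : List A) (i k : ℕ) (hi : i < l.length) :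
    ∃ u v : A, ∀ x, ((l.set i x).drop k).prod * ((l.set i x).take k).prod = u * x * v := by
  by_cases h : i < k
  · refine ⟨(l.drop k).prod * ((l.take k).take i).prod, ((l.take k).drop (i + 1)).prod,
      fun x => ?_⟩
    rw [List.drop_set, if_pos h, List.take_set, List.prod_set, if_pos (by simp; omega)]
    simp only [mul_assoc]
  · refine ⟨((l.drop k).take (i - k)).prod, ((l.drop k).drop (i - k + 1)).prod * (l.take k).prod,
      fun x => ?_⟩
    rw [List.drop_set, if_neg h, List.take_set_of_le (by omega), List.prod_set,
      if_pos (by simp; omega)]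
    simp only [mul_assoc]

variable {A : Type} [Ring A] [StarRing A] [Algebra ℂ A]

/-- The KMS condition for one tuple of elements. -/
def HasKMSContinuation (α : Multiplicative ℝ →* (A ≃⋆ₐ[ℂ] A)) (β : ℝ) (ω : A →ₗ[ℂ] ℂ) {n : ℕ}
    (a : Fin n → A) : Prop :=
  ∃ G : (Fin n → ℂ) → ℂ,
    AnalyticOnNhd ℂ G (tube β n) ∧
    ContinuousOn G (closure (tube β n)) ∧
    (∃ C : ℝ, ∀ z ∈ closure (tube β n), ‖G z‖ ≤ C) ∧
    (∀ t : Fin n → ℝ, G (fun i => (t i : ℂ)) = ω (evolved α a t).prod) ∧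
    ∀ (k : Fin n) (t : Fin n → ℝ),
      G (fun i => (t i : ℂ) + if k ≤ i then Complex.I * (β : ℂ) else 0) =
        ω (((evolved α a t).drop k).prod * ((evolved α a t).take k).prod)

variable {α : Multiplicative ℝ →* (A ≃⋆ₐ[ℂ] A)} {β : ℝ} {ω : A →ₗ[ℂ] ℂ} {n : ℕ}

theorem evolved_update (a : Fin n → A) (t : Fin n → ℝ) (i : Fin n) (x : A) :
    evolved α (Function.update a i x) t =
      (evolved α a t).set i (α (Multiplicative.ofAdd (t i)) x) := by
  unfold evolved
  refine List.ext_getElem (by simp) fun j h1 h2 => ?_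
  rw [List.getElem_set]
  simp only [List.getElem_ofFn]
  by_cases h : (i : ℕ) = j
  · have : (⟨j, by simpa using h1⟩ : Fin n) = i := Fin.ext h.symm
    rw [if_pos h, this, Function.update_self]
  · rw [if_neg h, Function.update_of_ne]
    intro h'
    exact h (congrArg Fin.val h').symm

/-- The KMS condition is linear in each entry. -/
theorem HasKMSContinuation.update_linear {a : Fin n → A} {i : Fin n} {x y : A} (r s : ℂ)
    (hx : HasKMSContinuation α β ω (Function.update a i x))
    (hy : HasKMSContinuation α β ω (Function.update a i y)) :
    HasKMSContinuation α β ω (Function.update a i (r • x + s • y)) := by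
  obtain ⟨G, h1, h2, ⟨C, h3⟩, h4, h5⟩ := hx
  obtain ⟨G', h1', h2', ⟨C', h3'⟩, h4', h5'⟩ := hy
  have key : ∀ (t : Fin n → ℝ) (k : ℕ),
      ω (((evolved α (Function.update a i (r • x + s • y)) t).drop k).prod *
        ((evolved α (Function.update a i (r • x + s • y)) t).take k).prod) =
      r * ω (((evolved α (Function.update a i x) t).drop k).prod *
        ((evolved α (Function.update a i x) t).take k).prod) +
      s * ω (((evolved α (Function.update a i y) t).drop k).prod *
        ((evolved α (Function.update a i y) t).take k).prod) := by
    intro t k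
    obtain ⟨u, v, huv⟩ := exists_rotate_prod_set (evolved α a t) i k (by simp [evolved])
    simp only [evolved_update, huv, map_add, map_smul, mul_add, add_mul, mul_smul_comm,
      smul_mul_assoc, smul_eq_mul]
  refine ⟨fun z => r * G z + s * G' z, ?_, ?_, ⟨‖r‖ * C + ‖s‖ * C', fun z hz => ?_⟩, fun t => ?_,
    fun k t => ?_⟩
  · exact (analyticOnNhd_const.mul h1).add (analyticOnNhd_const.mul h1')
  · exact (continuousOn_const.mul h2).add (continuousOn_const.mul h2')
  · refine (norm_add_le _ _).trans ?_
    rw [norm_mul, norm_mul]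
    gcongr
    · exact h3 z hz
    · exact h3' z hz
  · have := key t 0
    simp only [List.drop_zero, List.take_zero, List.prod_nil, mul_one] at this
    simp only
    rw [h4, h4', this]
  · simp only
    rw [h5, h5', key]

/-- It suffices to check the KMS condition on a set that spans the algebra. -/
theorem HasKMSContinuation.of_span {S : Set A} (hS : Submodule.span ℂ S = ⊤)
    (h : ∀ a : Fin n → A, (∀ i, a i ∈ S) → HasKMSContinuation α β ω a) (a : Fin n → A) :
    HasKMSContinuation α β ω a := by
  classical
  have key : ∀ (s : Finset (Fin n)) (a : Fin n → A), (∀ i ∉ s, a i ∈ S) →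
      HasKMSContinuation α β ω a := by
    intro s
    induction s using Finset.induction_on with
    | empty => exact fun a ha => h a fun i => ha i (Finset.notMem_empty i)
    | insert i s hi ih =>
      intro a ha
      have hw : ∀ x ∈ S, HasKMSContinuation α β ω (Function.update a i x) := by
        intro x hx
        refine ih _ fun j hj => ?_
        by_cases hji : j = i
        · subst hji
          simpa using hx
        · rw [Function.update_of_ne hji]
          exact ha j (by simp [hji, hj])
      have hx : ∀ x, HasKMSContinuation α β ω (Function.update a i x) := by
        intro x
        have hxS : x ∈ Submodule.span ℂ S := by
          rw [hS]
          trivial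
        -- if `S` is empty, the algebra is zero and so is every correlation function
        rcases S.eq_empty_or_nonempty with he | ⟨x₀, hx₀⟩
        · rw [he, Submodule.span_empty] at hS
          have h0 : ∀ y : A, y = 0 := fun y => by
            have : y ∈ (⊥ : Submodule ℂ A) := by
              rw [hS]
              trivial
            simpa using this
          exact ⟨fun _ => 0, analyticOnNhd_const, continuousOn_const, ⟨0, by simp⟩,
            fun t => by rw [h0 (List.prod _), map_zero],
            fun k t => by rw [h0 (_ * _), map_zero]⟩
        induction hxS using Submodule.span_induction with
        | mem x hx => exact hw x hx
        | zero => simpa using (hw x₀ hx₀).update_linear 0 0 (hw x₀ hx₀)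
        | add x y _ _ hx hy => simpa using hx.update_linear 1 1 hy
        | smul r x _ hx => simpa using hx.update_linear r 0 hx
      simpa using hx (a i)
  exact key Finset.univ a fun i hi => absurd (Finset.mem_univ i) hi

end Multilinear

/-- The two-point function `w` on the wedge has, as a function of the difference `θ` of the
rapidities by which its arguments are boosted, a bounded continuation `F f g` to the strip
`0 ≤ Im θ ≤ 2π` whose boundary value at `Im θ = 2π` is the two-point function in the opposite
order. -/
structure IsThermalTwoPoint (w : TestFn wedge → TestFn wedge → ℂ)
    (F : TestFn wedge → TestFn wedge → ℂ → ℂ) : Prop where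
  continuousOn : ∀ f g, ContinuousOn (F f g) {θ | 0 ≤ θ.im ∧ θ.im ≤ 2 * Real.pi}
  bounded : ∀ f g, ∃ C : ℝ, ∀ θ : ℂ, 0 ≤ θ.im → θ.im ≤ 2 * Real.pi → ‖F f g θ‖ ≤ C
  differentiableOn : ∀ f g, DifferentiableOn ℂ (F f g) {θ | 0 < θ.im ∧ θ.im < 2 * Real.pi}
  lower : ∀ f g (s t : ℝ), F f g ((t - s : ℝ) : ℂ) = w (boostFn s f) (boostFn t g)
  upper : ∀ f g (s t : ℝ), F f g ((t - s : ℝ) + 2 * Real.pi * Complex.I) =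
    w (boostFn t g) (boostFn s f)

section KMSWords

open FieldAlgebra

theorem closure_tube_subset (β : ℝ) (n : ℕ) :
    closure (tube β n) ⊆
      {z | ∀ i j, i < j → 0 ≤ (z j).im - (z i).im ∧ (z j).im - (z i).im ≤ β} := by
  refine closure_minimal (fun z hz i j hij => ⟨(hz i j hij).1.le, (hz i j hij).2.le⟩) ?_
  have : {z : Fin n → ℂ | ∀ i j, i < j → 0 ≤ (z j).im - (z i).im ∧ (z j).im - (z i).im ≤ β} =
      ⋂ i, ⋂ j, ⋂ _ : i < j, {z | 0 ≤ (z j).im - (z i).im ∧ (z j).im - (z i).im ≤ β} := by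
    ext z
    simp
  rw [this]
  refine isClosed_iInter fun i => isClosed_iInter fun j => isClosed_iInter fun _ => ?_
  have hc : Continuous fun z : Fin n → ℂ => (z j).im - (z i).im :=
    (Complex.continuous_im.comp (continuous_apply j)).sub
      (Complex.continuous_im.comp (continuous_apply i))
  exact (isClosed_le continuous_const hc).inter (isClosed_le hc continuous_const)

theorem rindlerGroup_apply_word (a t : ℝ) (l : List (TestFn wedge)) :
    rindlerGroup a (Multiplicative.ofAdd t) (l.map φ).prod =
      (l.map fun f => φ (boostFn (a * t) f)).prod := by
  change boostHom (a * t) (l.map φ).prod = _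
  rw [map_list_prod, List.map_map]
  congr 2
  funext f
  exact map_φ _ (boostFn_isFieldMap (a * t)) f

/-- Wick's theorem reduces the KMS condition to the two-point function. -/
theorem IsThermalTwoPoint.hasKMSContinuation {w : TestFn wedge → TestFn wedge → ℂ}
    {F : TestFn wedge → TestFn wedge → ℂ → ℂ} (hF : IsThermalTwoPoint w F)
    {ω : FieldAlgebra wedge →ₗ[ℂ] ℂ}
    (hω : ∀ l : List (TestFn wedge), ω (l.map φ).prod = wickSum w l)
    {a : ℝ} (ha : 0 < a) {n : ℕ} (b : Fin n → FieldAlgebra wedge) :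
    HasKMSContinuation (rindlerGroup a) (2 * Real.pi / a) ω b := by
  refine HasKMSContinuation.of_span FieldAlgebra.span_words (fun b hb => ?_) b
  choose l hl using hb
  obtain rfl : (fun i => ((l i).map φ).prod) = b := funext hl
  clear hl
  -- the fields that occur, each labelled with the number of its factor
  let blocks : List (List (Fin n × TestFn wedge)) := List.ofFn fun i => (l i).map fun f => (i, f)
  have hsorted : blocks.flatten.Pairwise fun p q => p.1 ≤ q.1 := by
    rw [List.pairwise_flatten]
    constructor
    · intro m hm
      obtain ⟨i, rfl⟩ := (List.mem_ofFn' _ _).1 hm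
      rw [List.pairwise_map]
      exact List.pairwise_of_forall fun _ _ => le_rfl
    · rw [List.pairwise_ofFn]
      intro i j hij p hp q hq
      obtain ⟨f, -, rfl⟩ := List.mem_map.1 hp
      obtain ⟨g, -, rfl⟩ := List.mem_map.1 hq
      exact hij.le
  let T : (Fin n → ℝ) → Fin n × TestFn wedge → TestFn wedge := fun t p => boostFn (a * t p.1) p.2
  have hev : ∀ t, evolved (rindlerGroup a) (fun i => ((l i).map φ).prod) t =
      blocks.map fun m => ((m.map (T t)).map φ).prod := by
    intro t
    unfold evolved
    rw [List.map_ofFn]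
    congr 1
    funext i
    rw [rindlerGroup_apply_word]
    simp [T, Function.comp_def]
  have hprod : ∀ t (B : List (List (Fin n × TestFn wedge))),
      (B.map fun m => ((m.map (T t)).map φ).prod).prod = ((B.flatten.map (T t)).map φ).prod := by
    intro t B
    simp [List.prod_flatten, List.map_flatten, Function.comp_def]
  let W : (Fin n → ℂ) → Fin n × TestFn wedge → Fin n × TestFn wedge → ℂ :=
    fun z p q => F p.2 q.2 (a * (z q.1 - z p.1))
  have hreal : ∀ (t : Fin n → ℝ) p q,
      F p.2 q.2 (a * ((t q.1 : ℂ) - t p.1)) = w (T t p) (T t q) := by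
    intro t p q
    rw [← hF.lower]
    congr 1
    push_cast
    ring
  have him : ∀ (z : Fin n → ℂ) i j, (a * (z j - z i)).im = a * ((z j).im - (z i).im) := by
    intro z i j
    simp
  have hβ : a * (2 * Real.pi / a) = 2 * Real.pi := by field_simp
  -- the pairs that can occur are either in one block, where the weight is constant, or ordered
  have hpair : ∀ P : ((Fin n → ℂ) → ℂ) → Prop, (∀ r : ℂ, P fun _ => r) →
      (∀ (f g : TestFn wedge) (i j : Fin n), i < j → P fun z => F f g (a * (z j - z i))) →
      blocks.flatten.Pairwise fun p q => P fun z => W z p q := by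
    intro P hc hlt
    refine hsorted.imp fun {p q} hpq => ?_
    rcases hpq.eq_or_lt with h | h
    · have : (fun z => W z p q) = fun _ => F p.2 q.2 0 := by
        funext z
        simp only [W, h, sub_self, mul_zero]
      rw [this]
      exact hc _
    · exact hlt _ _ _ _ h
  have hclos : ∀ z ∈ closure (tube (2 * Real.pi / a) n), ∀ i j, i < j →
      0 ≤ (a * (z j - z i)).im ∧ (a * (z j - z i)).im ≤ 2 * Real.pi := by
    intro z hz i j hij
    obtain ⟨h1, h2⟩ := closure_tube_subset _ _ hz i j hij
    rw [him, ← hβ]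
    exact ⟨mul_nonneg ha.le h1, mul_le_mul_of_nonneg_left h2 ha.le⟩
  refine ⟨fun z => wickSum (W z) blocks.flatten, ?_, ?_, ?_, fun t => ?_, fun k t => ?_⟩
  · refine wickSum_mem (P := fun h => AnalyticOnNhd ℂ h (tube (2 * Real.pi / a) n))
      analyticOnNhd_const analyticOnNhd_const (fun _ _ hu hv => hu.add hv)
      (fun _ _ hu hv => hu.mul hv) W _
      (hpair (fun h => AnalyticOnNhd ℂ h (tube (2 * Real.pi / a) n))
        (fun _ => analyticOnNhd_const) ?_)
    intro f g i j hij
    have hopen : IsOpen {θ : ℂ | 0 < θ.im ∧ θ.im < 2 * Real.pi} :=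
      (isOpen_lt continuous_const Complex.continuous_im).inter
        (isOpen_lt Complex.continuous_im continuous_const)
    refine ((hF.differentiableOn f g).analyticOnNhd hopen).comp (f := fun z : Fin n → ℂ =>
      (a : ℂ) * (z j - z i)) ?_ ?_
    · exact analyticOnNhd_const.mul
        (((ContinuousLinearMap.proj (R := ℂ) (φ := fun _ : Fin n => ℂ) j).analyticOnNhd _).sub
          ((ContinuousLinearMap.proj (R := ℂ) (φ := fun _ : Fin n => ℂ) i).analyticOnNhd _))
    · intro z hz
      obtain ⟨h1, h2⟩ := hz i j hij
      change 0 < (a * (z j - z i)).im ∧ (a * (z j - z i)).im < 2 * Real.pi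
      rw [him, ← hβ]
      exact ⟨mul_pos ha h1, mul_lt_mul_of_pos_left h2 ha⟩
  · refine wickSum_mem (P := fun h => ContinuousOn h (closure (tube (2 * Real.pi / a) n)))
      continuousOn_const continuousOn_const (fun _ _ hu hv => hu.add hv)
      (fun _ _ hu hv => hu.mul hv) W _
      (hpair (fun h => ContinuousOn h (closure (tube (2 * Real.pi / a) n)))
        (fun _ => continuousOn_const) ?_)
    intro f g i j hij
    refine (hF.continuousOn f g).comp (Continuous.continuousOn (by fun_prop)) ?_
    exact fun z hz => hclos z hz i j hij
  · refine wickSum_mem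
      (P := fun h => ∃ C : ℝ, ∀ z ∈ closure (tube (2 * Real.pi / a) n), ‖h z‖ ≤ C)
      ⟨0, by simp⟩ ⟨1, by simp⟩ ?_ ?_ W _
      (hpair (fun h => ∃ C : ℝ, ∀ z ∈ closure (tube (2 * Real.pi / a) n), ‖h z‖ ≤ C)
        (fun r => ⟨‖r‖, fun _ _ => le_rfl⟩) ?_)
    · rintro u v ⟨C, hC⟩ ⟨C', hC'⟩
      exact ⟨C + C', fun z hz => (norm_add_le _ _).trans (add_le_add (hC z hz) (hC' z hz))⟩
    · rintro u v ⟨C, hC⟩ ⟨C', hC'⟩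
      refine ⟨C * C', fun z hz => ?_⟩
      rw [norm_mul]
      exact mul_le_mul (hC z hz) (hC' z hz) (norm_nonneg _) ((norm_nonneg _).trans (hC z hz))
    · intro f g i j hij
      obtain ⟨C, hC⟩ := hF.bounded f g
      exact ⟨C, fun z hz => hC _ (hclos z hz i j hij).1 (hclos z hz i j hij).2⟩
  · rw [hev, hprod, hω, wickSum_map]
    exact congrArg (fun v => wickSum v blocks.flatten)
      (funext fun p => funext fun q => hreal t p q)
  · rw [hev, ← List.map_drop, ← List.map_take, hprod, hprod, ← List.prod_append, ← List.map_append,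
      ← List.map_append, hω, wickSum_map]
    have hsplit : blocks.flatten = (blocks.take k).flatten ++ (blocks.drop k).flatten := by
      rw [← List.flatten_append, List.take_append_drop]
    have hlow : ∀ p ∈ (blocks.take k).flatten, ¬ k ≤ p.1 := by
      intro p hp
      obtain ⟨m, hm, hpm⟩ := List.mem_flatten.1 hp
      obtain ⟨i, hi, rfl⟩ := List.mem_take_iff_getElem.1 hm
      simp only [blocks, List.getElem_ofFn, List.mem_map] at hpm
      obtain ⟨f, -, rfl⟩ := hpm
      rw [not_le]
      exact (lt_min_iff.1 hi).1
    have hhigh : ∀ p ∈ (blocks.drop k).flatten, k ≤ p.1 := by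
      intro p hp
      obtain ⟨m, hm, hpm⟩ := List.mem_flatten.1 hp
      obtain ⟨i, hi, rfl⟩ := List.mem_drop_iff_getElem.1 hm
      simp only [blocks, List.getElem_ofFn, List.mem_map] at hpm
      obtain ⟨f, -, rfl⟩ := hpm
      exact Fin.le_def.2 (Nat.le_add_right _ _)
    rw [hsplit]
    refine wickSum_append_comm ?_ ?_ ?_
    · refine List.pairwise_of_forall_mem_list fun p hp q hq => ?_
      simp only [W, if_neg (hlow p hp), if_neg (hlow q hq), add_zero]
      exact hreal t p q
    · refine List.pairwise_of_forall_mem_list fun p hp q hq => ?_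
      simp only [W, if_pos (hhigh p hp), if_pos (hhigh q hq), add_sub_add_right_eq_sub]
      exact hreal t p q
    · intro p hp q hq
      simp only [W, if_neg (hlow p hp), if_pos (hhigh q hq), add_zero]
      rw [← hF.upper]
      congr 1
      have hβ' : (a : ℂ) * ((2 * Real.pi / a : ℝ) : ℂ) = 2 * Real.pi := by
        rw [← Complex.ofReal_mul, hβ]
        push_cast
        rfl
      push_cast at hβ' ⊢
      linear_combination Complex.I * hβ'

end KMSWords

/-! ### Integration by parts and the Fourier-Laplace transform -/

section Green

open MeasureTheory

theorem partial₂_eq_fderiv (u : Spacetime → ℂ) (μ ν : Fin 4) (x : Spacetime) :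
    partial₂ u μ ν x = fderiv ℝ (fderiv ℝ u) x (unitVec μ) (unitVec ν) := by
  simp [partial₂, iteratedFDeriv_two_apply]

theorem hasLineDerivAt_fderiv_unitVec {u : Spacetime → ℂ} (hu : ContDiff ℝ 2 u) (μ : Fin 4)
    (x : Spacetime) :
    HasLineDerivAt ℝ (fun y => fderiv ℝ u y (unitVec μ)) (partial₂ u μ μ x) x (unitVec μ) := by
  have h1 : DifferentiableAt ℝ (fderiv ℝ u) x :=
    ((hu.fderiv_right (m := 1) (by norm_num)).differentiable (by norm_num)).differentiableAt
  have h2 := (h1.hasFDerivAt.clm_apply (hasFDerivAt_const (unitVec μ) x)).hasLineDerivAt (unitVec μ)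
  rw [partial₂_eq_fderiv]
  simpa using h2

theorem continuous_partial₂ {u : Spacetime → ℂ} (hu : ContDiff ℝ 2 u) (μ ν : Fin 4) :
    Continuous (partial₂ u μ ν) := by
  have h : Continuous (fderiv ℝ (fderiv ℝ u)) :=
    (hu.fderiv_right (m := 1) (by norm_num)).continuous_fderiv (by norm_num)
  rw [show partial₂ u μ ν = fun x => fderiv ℝ (fderiv ℝ u) x (unitVec μ) (unitVec ν) from
    funext fun x => partial₂_eq_fderiv u μ ν x]
  exact (h.clm_apply continuous_const).clm_apply continuous_const

theorem partial₂_eq_zero_of_notMem {u : Spacetime → ℂ} {x : Spacetime} (hx : x ∉ tsupport u)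
    (μ ν : Fin 4) : partial₂ u μ ν x = 0 := by
  have h : x ∉ tsupport (fderiv ℝ (fderiv ℝ u)) := fun h =>
    hx (tsupport_fderiv_subset ℝ (tsupport_fderiv_subset ℝ h))
  rw [partial₂_eq_fderiv, image_eq_zero_of_notMem_tsupport h]
  rfl

/-- Integration by parts, twice in the same direction. It suffices that `u` or the other factor
vanishes at each point outside a compact set. -/
theorem integral_mul_partial₂ {u χ χ₁ χ₂ : Spacetime → ℂ} (hu : ContDiff ℝ 2 u) (μ : Fin 4)
    (h : Continuous χ) (h₁ : Continuous χ₁) (h₂ : Continuous χ₂)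
    (hd : ∀ x, HasLineDerivAt ℝ χ (χ₁ x) x (unitVec μ))
    (hd₁ : ∀ x, HasLineDerivAt ℝ χ₁ (χ₂ x) x (unitVec μ)) {S : Set Spacetime} (hS : IsCompact S)
    (hz : ∀ x ∉ S, (χ x = 0 ∧ χ₁ x = 0 ∧ χ₂ x = 0) ∨ x ∉ tsupport u) :
    ∫ x, χ x * partial₂ u μ μ x = ∫ x, χ₂ x * u x := by
  set u₁ : Spacetime → ℂ := fun y => fderiv ℝ u y (unitVec μ) with hu₁
  have hc : Continuous u := hu.continuous
  have hc₁ : Continuous u₁ := (hu.continuous_fderiv (by norm_num)).clm_apply continuous_const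
  have hud : ∀ x, HasLineDerivAt ℝ u (u₁ x) x (unitVec μ) := fun x =>
    ((hu.differentiable (by norm_num)).differentiableAt).hasFDerivAt.hasLineDerivAt (unitVec μ)
  have z0 : ∀ x ∉ tsupport u, u x = 0 := fun x hx => image_eq_zero_of_notMem_tsupport hx
  have z1 : ∀ x ∉ tsupport u, u₁ x = 0 := fun x hx => by
    have h : x ∉ tsupport (fderiv ℝ u) := fun h => hx (tsupport_fderiv_subset ℝ h)
    simp only [hu₁, image_eq_zero_of_notMem_tsupport h]
    rfl
  have z2 : ∀ x ∉ tsupport u, partial₂ u μ μ x = 0 := fun x hx =>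
    partial₂_eq_zero_of_notMem hx μ μ
  have hint : ∀ {p q : Spacetime → ℂ}, Continuous p → Continuous q →
      (∀ x ∉ S, p x * q x = 0) → Integrable fun x => p x * q x := fun hp hq hpq =>
    (hp.mul hq).integrable_of_hasCompactSupport (HasCompactSupport.intro hS hpq)
  have i02 := hint h (continuous_partial₂ hu μ μ) fun x hx => by
    rcases hz x hx with ⟨h, -, -⟩ | h
    · rw [h, zero_mul]
    · rw [z2 x h, mul_zero]
  have i01 := hint h hc₁ fun x hx => by
    rcases hz x hx with ⟨h, -, -⟩ | h
    · rw [h, zero_mul]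
    · rw [z1 x h, mul_zero]
  have i11 := hint h₁ hc₁ fun x hx => by
    rcases hz x hx with ⟨-, h, -⟩ | h
    · rw [h, zero_mul]
    · rw [z1 x h, mul_zero]
  have i10 := hint h₁ hc fun x hx => by
    rcases hz x hx with ⟨-, h, -⟩ | h
    · rw [h, zero_mul]
    · rw [z0 x h, mul_zero]
  have i20 := hint h₂ hc fun x hx => by
    rcases hz x hx with ⟨-, -, h⟩ | h
    · rw [h, zero_mul]
    · rw [z0 x h, mul_zero]
  have e1 := integral_bilinear_hasLineDerivAt_right_eq_neg_left_of_integrable (μ := volume)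
    (B := ContinuousLinearMap.mul ℝ ℂ) (f := χ) (f' := χ₁) (g := u₁) (g' := partial₂ u μ μ)
    (v := unitVec μ) i11 i02 i01 (fun x _ => hd x)
    (fun x _ => hasLineDerivAt_fderiv_unitVec hu μ x)
  have e2 := integral_bilinear_hasLineDerivAt_right_eq_neg_left_of_integrable (μ := volume)
    (B := ContinuousLinearMap.mul ℝ ℂ) (f := χ₁) (f' := χ₂) (g := u) (g' := u₁)
    (v := unitVec μ) i20 i11 i10 (fun x _ => hd₁ x) (fun x _ => hud x)
  simp only [ContinuousLinearMap.mul_apply'] at e1 e2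
  rw [e1, e2, neg_neg]

end Green

section FourierLaplace

open MeasureTheory

/-- The Minkowski product `κ₁ x₁ + κ₂ x₂ + κ₃ x₃ - κ₀ x₀` of a complex momentum with a point. -/
def phase (κ : Fin 4 → ℂ) (x : Spacetime) : ℂ :=
  κ 1 * x 1 + κ 2 * x 2 + κ 3 * x 3 - κ 0 * x 0

/-- The plane wave with complex momentum `κ`. -/
def planeWave (κ : Fin 4 → ℂ) (x : Spacetime) : ℂ := Complex.exp (Complex.I * phase κ x)

/-- The Fourier-Laplace transform of a function on spacetime. -/
def lorentzFT (f : Spacetime → ℂ) (κ : Fin 4 → ℂ) : ℂ := ∫ x, f x * planeWave κ x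

theorem continuous_planeWave_uncurry :
    Continuous fun p : (Fin 4 → ℂ) × Spacetime => planeWave p.1 p.2 := by
  unfold planeWave phase
  fun_prop

theorem continuous_planeWave (κ : Fin 4 → ℂ) : Continuous (planeWave κ) := by
  unfold planeWave phase
  fun_prop

theorem norm_planeWave (κ : Fin 4 → ℂ) (x : Spacetime) :
    ‖planeWave κ x‖ = Real.exp (-(phase κ x).im) := by
  unfold planeWave
  rw [Complex.norm_exp]
  simp

/-- The momentum components with the signs of the metric. -/
def lower (κ : Fin 4 → ℂ) (μ : Fin 4) : ℂ := if μ = 0 then -κ 0 else κ μ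

theorem phase_add_smul (κ : Fin 4 → ℂ) (x : Spacetime) (μ : Fin 4) (t : ℝ) :
    phase κ (x + t • unitVec μ) = phase κ x + t * lower κ μ := by
  unfold phase lower unitVec
  fin_cases μ <;> simp <;> ring

theorem hasLineDerivAt_planeWave (κ : Fin 4 → ℂ) (x : Spacetime) (μ : Fin 4) :
    HasLineDerivAt ℝ (planeWave κ) (Complex.I * lower κ μ * planeWave κ x) x (unitVec μ) := by
  unfold HasLineDerivAt planeWave
  simp only [phase_add_smul]
  have h : HasDerivAt (fun t : ℂ => Complex.exp (Complex.I * (phase κ x + t * lower κ μ)))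
      (Complex.exp (Complex.I * (phase κ x + (0 : ℝ) * lower κ μ)) * (Complex.I * lower κ μ))
      ((0 : ℝ) : ℂ) := by
    have h1 : HasDerivAt (fun t : ℂ => Complex.I * (phase κ x + t * lower κ μ))
        (Complex.I * lower κ μ) ((0 : ℝ) : ℂ) := by
      simpa using (((hasDerivAt_id ((0 : ℝ) : ℂ)).mul_const (lower κ μ)).const_add
        (phase κ x)).const_mul Complex.I
    exact h1.cexp
  have h2 := h.comp_ofReal
  simpa [mul_comm, mul_assoc, mul_left_comm] using h2

/-- The transform turns derivatives into multiplication by momenta. -/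
theorem lorentzFT_partial₂ {f : Spacetime → ℂ} (hf : ContDiff ℝ 2 f) (hc : HasCompactSupport f)
    (κ : Fin 4 → ℂ) (μ : Fin 4) :
    lorentzFT (partial₂ f μ μ) κ = -κ μ ^ 2 * lorentzFT f κ := by
  have h := integral_mul_partial₂ hf μ (χ := planeWave κ)
    (χ₁ := fun x => Complex.I * lower κ μ * planeWave κ x)
    (χ₂ := fun x => Complex.I * lower κ μ * (Complex.I * lower κ μ * planeWave κ x))
    (continuous_planeWave κ) (continuous_const.mul (continuous_planeWave κ))
    (continuous_const.mul (continuous_const.mul (continuous_planeWave κ)))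
    (fun x => hasLineDerivAt_planeWave κ x μ)
    (fun x => by
      have := HasDerivAt.const_mul (Complex.I * lower κ μ) (hasLineDerivAt_planeWave κ x μ)
      exact this)
    hc (fun x hx => Or.inr hx)
  unfold lorentzFT
  rw [← integral_const_mul]
  calc ∫ x, partial₂ f μ μ x * planeWave κ x = ∫ x, planeWave κ x * partial₂ f μ μ x := by
        simp only [mul_comm]
    _ = _ := h
    _ = _ := by
        refine integral_congr_ae (Filter.Eventually.of_forall fun x => ?_)
        have hl : lower κ μ ^ 2 = κ μ ^ 2 := by
          unfold lower
          split_ifs with h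
          · rw [h]
            ring
          · rfl
        simp only
        rw [← hl]
        linear_combination (lower κ μ ^ 2 * planeWave κ x * f x) * Complex.I_sq

theorem continuous_lorentzFT {f : Spacetime → ℂ} (hf : Continuous f) (hc : HasCompactSupport f) :
    Continuous (lorentzFT f) := by
  have h := continuous_parametric_integral_of_continuous (μ := (volume : Measure Spacetime))
    (f := fun (κ : Fin 4 → ℂ) x => f x * planeWave κ x)
    ((hf.comp continuous_snd).mul continuous_planeWave_uncurry) hc
  refine h.congr fun κ => ?_
  refine setIntegral_eq_integral_of_forall_compl_eq_zero fun x hx => ?_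
  rw [image_eq_zero_of_notMem_tsupport hx, zero_mul]

theorem norm_lorentzFT_le {f : Spacetime → ℂ} (hf : Continuous f) (hc : HasCompactSupport f)
    {κ : Fin 4 → ℂ} (hκ : ∀ x ∈ tsupport f, ‖planeWave κ x‖ ≤ 1) :
    ‖lorentzFT f κ‖ ≤ ∫ x, ‖f x‖ := by
  refine norm_integral_le_of_norm_le (hf.integrable_of_hasCompactSupport hc).norm
    (Filter.Eventually.of_forall fun x => ?_)
  rw [norm_mul]
  by_cases hx : x ∈ tsupport f
  · exact mul_le_of_le_one_right (norm_nonneg _) (hκ x hx)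
  · rw [image_eq_zero_of_notMem_tsupport hx]
    simp

theorem sq_mul_norm_lorentzFT_le {f : Spacetime → ℂ} (hf : ContDiff ℝ 2 f)
    (hc : HasCompactSupport f) {κ : Fin 4 → ℂ} (hκ : ∀ x ∈ tsupport f, ‖planeWave κ x‖ ≤ 1)
    (μ : Fin 4) : ‖κ μ‖ ^ 2 * ‖lorentzFT f κ‖ ≤ ∫ x, ‖partial₂ f μ μ x‖ := by
  have h := lorentzFT_partial₂ hf hc κ μ
  have hs : tsupport (partial₂ f μ μ) ⊆ tsupport f :=
    closure_minimal (fun x hx => by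
      by_contra hn
      exact hx (partial₂_eq_zero_of_notMem hn μ μ)) (isClosed_tsupport f)
  have hc' : HasCompactSupport (partial₂ f μ μ) := hc.of_isClosed_subset (isClosed_tsupport _) hs
  have := norm_lorentzFT_le (continuous_partial₂ hf μ μ) hc' fun x hx => hκ x (hs hx)
  rwa [h, norm_mul, norm_neg, norm_pow] at this

/-- On the light cone the transform of `□ f` vanishes. -/
theorem lorentzFT_box {f : Spacetime → ℂ} (hf : ContDiff ℝ 2 f) (hc : HasCompactSupport f)
    {κ : Fin 4 → ℂ} (hκ : κ 0 ^ 2 = κ 1 ^ 2 + κ 2 ^ 2 + κ 3 ^ 2) : lorentzFT (box f) κ = 0 := by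
  have hi : ∀ μ, Integrable fun x => partial₂ f μ μ x * planeWave κ x := fun μ =>
    ((continuous_partial₂ hf μ μ).mul (continuous_planeWave κ)).integrable_of_hasCompactSupport
      (HasCompactSupport.intro hc fun x hx => by
        rw [Pi.mul_apply, partial₂_eq_zero_of_notMem hx, zero_mul])
  have h : lorentzFT (box f) κ =
      ∑ μ : Fin 4, (if μ = 0 then -1 else 1) * lorentzFT (partial₂ f μ μ) κ := by
    unfold lorentzFT
    simp only [← integral_const_mul]
    rw [← integral_finsetSum _ fun μ _ => (hi μ).const_mul _]
    refine integral_congr_ae (Filter.Eventually.of_forall fun x => ?_)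
    simp only [box, Fin.sum_univ_succ, Fin.sum_univ_zero]
    simp
    ring
  rw [h]
  simp only [lorentzFT_partial₂ hf hc, Fin.sum_univ_four]
  simp
  linear_combination lorentzFT f κ * hκ

theorem planeWave_neg (κ : Fin 4 → ℂ) (x : Spacetime) :
    planeWave (-κ) x = conj (planeWave (fun μ => conj (κ μ)) x) := by
  unfold planeWave phase
  rw [← Complex.exp_conj]
  congr 1
  simp
  ring

theorem lorentzFT_neg (f : Spacetime → ℂ) (κ : Fin 4 → ℂ) :
    lorentzFT f (-κ) = conj (lorentzFT (fun x => conj (f x)) fun μ => conj (κ μ)) := by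
  unfold lorentzFT
  rw [← integral_conj]
  simp only [planeWave_neg, map_mul, Complex.conj_conj]

end FourierLaplace

/-! ### Holomorphic dependence of integrals on a parameter -/

section Parametric

open MeasureTheory

/-- An integral that depends holomorphically on a parameter, with an integrable bound for the
integrand, is holomorphic: the derivative of the integrand is bounded by Cauchy's estimate. -/
theorem differentiableOn_integral_of_dominated {α : Type} [MeasurableSpace α] {m : Measure α}
    {U : Set ℂ} (hU : IsOpen U) {h : ℂ → α → ℂ} {b : α → ℝ}
    (hm : ∀ z ∈ U, AEStronglyMeasurable (h z) m)
    (hd : ∀ x, DifferentiableOn ℂ (fun z => h z x) U) (hb : ∀ z ∈ U, ∀ x, ‖h z x‖ ≤ b x)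
    (hbi : Integrable b m) : DifferentiableOn ℂ (fun z => ∫ x, h z x ∂m) U := by
  intro z₀ hz₀
  obtain ⟨r, hr, hrU⟩ := Metric.isOpen_iff.1 hU z₀ hz₀
  have hball : ∀ z ∈ Metric.ball z₀ (r / 2), Metric.closedBall z (r / 4) ⊆ U := by
    intro z hz y hy
    apply hrU
    rw [Metric.mem_ball] at hz ⊢
    rw [Metric.mem_closedBall] at hy
    have := dist_triangle y z z₀
    linarith
  have hdiff : ∀ x, ∀ z ∈ Metric.ball z₀ (r / 2),
      HasDerivAt (fun y => h y x) (deriv (fun y => h y x) z) z := fun x z hz =>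
    ((hd x).differentiableAt (hU.mem_nhds (hball z hz (Metric.mem_closedBall_self (by linarith))))
      ).hasDerivAt
  have hz₀' : z₀ ∈ Metric.ball z₀ (r / 2) := Metric.mem_ball_self (by positivity)
  -- the derivative is a limit of difference quotients, hence measurable
  have hmeas : AEStronglyMeasurable (fun x => deriv (fun y => h y x) z₀) m := by
    let t : ℕ → ℂ := fun n => z₀ + ((r / 4 * (1 / ((n : ℝ) + 1)) : ℝ) : ℂ)
    have ht0 : ∀ n : ℕ, 0 < r / 4 * (1 / ((n : ℝ) + 1)) := fun n => by positivity
    have htU : ∀ n, t n ∈ U := by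
      intro n
      apply hball z₀ hz₀'
      rw [Metric.mem_closedBall, dist_eq_norm, add_sub_cancel_left, Complex.norm_real,
        Real.norm_of_nonneg (ht0 n).le]
      have : 1 / ((n : ℝ) + 1) ≤ 1 := by
        rw [div_le_one (by positivity)]
        linarith [Nat.cast_nonneg (α := ℝ) n]
      nlinarith
    have ht : Filter.Tendsto t Filter.atTop (nhdsWithin z₀ {z₀}ᶜ) := by
      refine tendsto_nhdsWithin_iff.2 ⟨?_, Filter.Eventually.of_forall fun n => ?_⟩
      · have h1 := (tendsto_one_div_add_atTop_nhds_zero_nat (𝕜 := ℝ)).const_mul (r / 4)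
        have h2 := (Complex.continuous_ofReal.tendsto _).comp h1
        simpa [t] using h2.const_add z₀
      · simp only [t, Set.mem_compl_iff, Set.mem_singleton_iff, add_eq_left]
        exact_mod_cast (ht0 n).ne'
    refine aestronglyMeasurable_of_tendsto_ae Filter.atTop
      (f := fun n x => slope (fun y => h y x) z₀ (t n)) (fun n => ?_)
      (Filter.Eventually.of_forall fun x => ?_)
    · simp only [slope_def_field]
      have h1 : AEStronglyMeasurable (fun x => h (t n) x - h z₀ x) m :=
        (hm _ (htU n)).sub (hm _ hz₀)
      simpa only [div_eq_mul_inv] using h1.mul_const (t n - z₀)⁻¹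
    · exact (hasDerivAt_iff_tendsto_slope.1 (hdiff x z₀ hz₀')).comp ht
  have key := hasDerivAt_integral_of_dominated_loc_of_deriv_le (𝕜 := ℂ) (μ := m) (F := h)
    (F' := fun z x => deriv (fun y => h y x) z) (x₀ := z₀) (s := Metric.ball z₀ (r / 2))
    (bound := fun x => b x / (r / 4)) (Metric.ball_mem_nhds _ (by positivity))
    (Filter.eventually_of_mem (hU.mem_nhds hz₀) hm)
    (hbi.mono' (hm _ hz₀) (Filter.Eventually.of_forall (hb _ hz₀))) hmeas
    (Filter.Eventually.of_forall fun x z hz => ?_) (hbi.div_const _)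
    (Filter.Eventually.of_forall hdiff)
  · exact key.2.differentiableAt.differentiableWithinAt
  · refine Complex.norm_deriv_le_of_forall_mem_sphere_norm_le (by positivity) ?_ ?_
    · refine DifferentiableOn.diffContOnCl ?_
      rw [closure_ball _ (by positivity)]
      exact (hd x).mono (hball z hz)
    · exact fun y hy => hb y (hball z hz (Metric.sphere_subset_closedBall hy)) x

end Parametric

/-! ### The mass shell and its boosts -/

section MassShell

open MeasureTheory

/-- Spatial momenta. -/
abbrev Momentum : Type := EuclideanSpace ℝ (Fin 3)

/-- The energy of the massless momentum `k` after a boost with rapidity `τ`. -/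
def energy (τ : ℝ) (k : Momentum) : ℝ := Real.cosh τ * ‖k‖ + Real.sinh τ * k 0

/-- The boost with rapidity `τ` acting on the spatial part of a massless momentum. -/
def momBoost (τ : ℝ) (k : Momentum) : Momentum :=
  k + (Real.sinh τ * ‖k‖ + (Real.cosh τ - 1) * k 0) • EuclideanSpace.single 0 1

/-- The massless four-momentum over `k`, boosted with the complex rapidity `z`. -/
def onShell (z : ℂ) (k : Momentum) : Fin 4 → ℂ :=
  ![Complex.cosh z * ‖k‖ + Complex.sinh z * k 0, Complex.sinh z * ‖k‖ + Complex.cosh z * k 0,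
    k 1, k 2]

theorem momBoost_apply_zero (τ : ℝ) (k : Momentum) :
    momBoost τ k 0 = Real.sinh τ * ‖k‖ + Real.cosh τ * k 0 := by
  simp [momBoost]
  ring

theorem momBoost_apply_one (τ : ℝ) (k : Momentum) : momBoost τ k 1 = k 1 := by
  simp [momBoost]

theorem momBoost_apply_two (τ : ℝ) (k : Momentum) : momBoost τ k 2 = k 2 := by
  simp [momBoost]

theorem momentum_norm_sq (k : Momentum) : ‖k‖ ^ 2 = k 0 ^ 2 + k 1 ^ 2 + k 2 ^ 2 := by
  rw [EuclideanSpace.norm_sq_eq, Fin.sum_univ_three]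
  simp

theorem abs_momentum_le (k : Momentum) : |k 0| ≤ ‖k‖ := by
  refine abs_le.2 (abs_le_of_sq_le_sq' ?_ (norm_nonneg k))
  rw [momentum_norm_sq]
  nlinarith [sq_nonneg (k 1), sq_nonneg (k 2)]

theorem cosh_add_sinh_pos (τ : ℝ) : 0 < Real.cosh τ + Real.sinh τ := by
  rw [Real.cosh_add_sinh]
  exact Real.exp_pos τ

theorem cosh_sub_sinh_pos (τ : ℝ) : 0 < Real.cosh τ - Real.sinh τ := by
  rw [Real.cosh_sub_sinh]
  exact Real.exp_pos (-τ)

theorem exp_mul_norm_le_energy (τ : ℝ) (k : Momentum) : Real.exp (-|τ|) * ‖k‖ ≤ energy τ k := by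
  obtain ⟨h1, h2⟩ := abs_le.1 (abs_momentum_le k)
  have e1 : Real.exp (-|τ|) ≤ Real.exp τ := Real.exp_le_exp.2 (neg_abs_le τ)
  have e2 : Real.exp (-|τ|) ≤ Real.exp (-τ) := Real.exp_le_exp.2 (neg_le_neg (le_abs_self τ))
  rw [← Real.cosh_add_sinh τ] at e1
  rw [← Real.cosh_sub_sinh τ] at e2
  unfold energy
  nlinarith [mul_le_mul_of_nonneg_right e1 (show 0 ≤ ‖k‖ + k 0 by linarith),
    mul_le_mul_of_nonneg_right e2 (show 0 ≤ ‖k‖ - k 0 by linarith)]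

theorem energy_nonneg (τ : ℝ) (k : Momentum) : 0 ≤ energy τ k :=
  le_trans (by positivity) (exp_mul_norm_le_energy τ k)

theorem abs_momBoost_le_energy (τ : ℝ) (k : Momentum) :
    |Real.sinh τ * ‖k‖ + Real.cosh τ * k 0| ≤ energy τ k := by
  obtain ⟨h1, h2⟩ := abs_le.1 (abs_momentum_le k)
  unfold energy
  rw [abs_le]
  constructor
  · nlinarith [mul_nonneg (cosh_add_sinh_pos τ).le (show 0 ≤ ‖k‖ + k 0 by linarith)]
  · nlinarith [mul_nonneg (cosh_sub_sinh_pos τ).le (show 0 ≤ ‖k‖ - k 0 by linarith)]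

theorem norm_momBoost (τ : ℝ) (k : Momentum) : ‖momBoost τ k‖ = energy τ k := by
  have h : ‖momBoost τ k‖ ^ 2 = energy τ k ^ 2 := by
    rw [momentum_norm_sq, momBoost_apply_zero, momBoost_apply_one, momBoost_apply_two, energy]
    linear_combination (-1 : ℝ) * momentum_norm_sq k +
      (k 0 ^ 2 - ‖k‖ ^ 2) * Real.cosh_sq_sub_sinh_sq τ
  exact (pow_left_inj₀ (norm_nonneg _) (energy_nonneg τ k) two_ne_zero).1 h

theorem momBoost_add (s t : ℝ) (k : Momentum) :
    momBoost (s + t) k = momBoost s (momBoost t k) := by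
  ext i
  fin_cases i
  · change momBoost (s + t) k 0 = momBoost s (momBoost t k) 0
    rw [momBoost_apply_zero, momBoost_apply_zero, momBoost_apply_zero, norm_momBoost, energy,
      Real.sinh_add, Real.cosh_add]
    ring
  · change momBoost (s + t) k 1 = momBoost s (momBoost t k) 1
    simp only [momBoost_apply_one]
  · change momBoost (s + t) k 2 = momBoost s (momBoost t k) 2
    simp only [momBoost_apply_two]

theorem momBoost_zero_rapidity (k : Momentum) : momBoost 0 k = k := by
  simp [momBoost]

theorem momBoost_neg_momBoost (τ : ℝ) (k : Momentum) : momBoost (-τ) (momBoost τ k) = k := by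
  rw [← momBoost_add, neg_add_cancel, momBoost_zero_rapidity]

theorem onShell_add_ofReal (z : ℂ) (τ : ℝ) (k : Momentum) :
    onShell (z + τ) k = onShell z (momBoost τ k) := by
  unfold onShell
  rw [norm_momBoost, momBoost_apply_zero, momBoost_apply_one, momBoost_apply_two, energy,
    Complex.cosh_add, Complex.sinh_add]
  push_cast
  congr 1
  · ring
  · congr 1
    ring

theorem onShell_cone (z : ℂ) (k : Momentum) :
    onShell z k 0 ^ 2 = onShell z k 1 ^ 2 + onShell z k 2 ^ 2 + onShell z k 3 ^ 2 := by
  have h : (‖k‖ : ℂ) ^ 2 = (k 0 : ℂ) ^ 2 + (k 1 : ℂ) ^ 2 + (k 2 : ℂ) ^ 2 := by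
    exact_mod_cast momentum_norm_sq k
  simp only [onShell, Matrix.cons_val_zero, Matrix.cons_val_one, Matrix.cons_val]
  linear_combination h + ((‖k‖ : ℂ) ^ 2 - (k 0 : ℂ) ^ 2) * Complex.cosh_sq_sub_sinh_sq z

theorem onShell_conj (z : ℂ) (k : Momentum) :
    (fun μ => conj (onShell z k μ)) = onShell (conj z) k := by
  funext μ
  unfold onShell
  fin_cases μ <;> simp [← Complex.cosh_conj, ← Complex.sinh_conj]

theorem continuous_onShell (z : ℂ) : Continuous (onShell z) := by
  unfold onShell
  refine continuous_pi fun μ => ?_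
  fin_cases μ <;> simp <;> fun_prop

theorem differentiable_onShell (k : Momentum) (μ : Fin 4) :
    Differentiable ℂ fun z => onShell z k μ := by
  unfold onShell
  fin_cases μ <;> simp

/-- The rotation about the first axis by the angle `π`. -/
def momRotate : Momentum ≃ₗᵢ[ℝ] Momentum :=
  LinearIsometryEquiv.piLpCongrRight 2 fun i : Fin 3 =>
    if i = 0 then LinearIsometryEquiv.refl ℝ ℝ else LinearIsometryEquiv.neg ℝ

theorem momRotate_zero (k : Momentum) : momRotate k 0 = k 0 := by
  simp [momRotate]

theorem momRotate_one (k : Momentum) : momRotate k 1 = -k 1 := by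
  simp [momRotate]

theorem momRotate_two (k : Momentum) : momRotate k 2 = -k 2 := by
  simp [momRotate]

/-- A boost with imaginary rapidity `iπ` reflects time and the first coordinate. -/
theorem onShell_add_pi (z : ℂ) (k : Momentum) :
    onShell (z + Real.pi * Complex.I) k = -onShell z (momRotate k) := by
  have hc : Complex.cosh (z + Real.pi * Complex.I) = -Complex.cosh z := by
    rw [Complex.cosh_add, Complex.cosh_mul_I, Complex.sinh_mul_I]
    simp
  have hs : Complex.sinh (z + Real.pi * Complex.I) = -Complex.sinh z := by
    rw [Complex.sinh_add, Complex.cosh_mul_I, Complex.sinh_mul_I]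
    simp
  unfold onShell
  rw [hc, hs, momRotate.norm_map, momRotate_zero, momRotate_one, momRotate_two]
  funext μ
  fin_cases μ <;> simp <;> ring

/-- The Lorentz invariance of the measure `d³k / |k|`. -/
theorem integral_momBoost {E : Type} [NormedAddCommGroup E] [NormedSpace ℝ E] (τ : ℝ)
    (h : Momentum → E) : ∫ k, ‖k‖⁻¹ • h (momBoost τ k) = ∫ k, ‖k‖⁻¹ • h k := by
  let ℓ : Momentum → Momentum →L[ℝ] ℝ := fun k =>
    (Real.sinh τ * ‖k‖⁻¹) • innerSL ℝ k +
      (Real.cosh τ - 1) • (EuclideanSpace.proj 0 : Momentum →L[ℝ] ℝ)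
  let D : Momentum → Momentum →L[ℝ] Momentum := fun k =>
    ContinuousLinearMap.id ℝ Momentum + (ℓ k).smulRight (EuclideanSpace.single 0 1)
  have hD : ∀ k ∈ ({0}ᶜ : Set Momentum), HasFDerivWithinAt (momBoost τ) (D k) {0}ᶜ k := by
    intro k hk
    refine HasFDerivAt.hasFDerivWithinAt ?_
    have hn : HasFDerivAt (fun k : Momentum => ‖k‖) (‖k‖⁻¹ • innerSL ℝ k) k := by
      have := (hasStrictFDerivAt_norm_sq k).hasFDerivAt.sqrt (by simpa using hk)
      simp only [Real.sqrt_sq (norm_nonneg _)] at this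
      refine this.congr_fderiv (ContinuousLinearMap.ext fun v => ?_)
      simp
      ring
    have hp : HasFDerivAt (fun k : Momentum => k 0)
        (EuclideanSpace.proj 0 : Momentum →L[ℝ] ℝ) k :=
      (EuclideanSpace.proj 0 : Momentum →L[ℝ] ℝ).hasFDerivAt
    have h1 := ((hn.const_mul (Real.sinh τ)).add (hp.const_mul (Real.cosh τ - 1)))
    have h2 := (hasFDerivAt_id k).add (h1.smul_const (EuclideanSpace.single (0 : Fin 3) (1 : ℝ)))
    refine h2.congr_fderiv ?_
    simp only [D, ℓ, smul_smul]
  -- the derivative differs from the identity by a rank one map, so it is a transvection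
  have hdet : ∀ k ∈ ({0}ᶜ : Set Momentum), |(D k).det| = energy τ k * ‖k‖⁻¹ := by
    intro k hk
    have hk' : ‖k‖ ≠ 0 := by simpa using hk
    have h1 : (D k).det = energy τ k * ‖k‖⁻¹ := by
      have : ((D k : Momentum →L[ℝ] Momentum) : Momentum →ₗ[ℝ] Momentum) =
          LinearMap.transvection (ℓ k : Momentum →ₗ[ℝ] ℝ) (EuclideanSpace.single 0 1) := by
        ext v
        simp [D, LinearMap.transvection.apply]
      rw [ContinuousLinearMap.det, this, LinearMap.transvection.det]
      simp [ℓ, energy, EuclideanSpace.inner_single_right]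
      field_simp
      ring
    rw [h1, abs_of_nonneg]
    exact mul_nonneg (energy_nonneg _ _) (by positivity)
  have hinj : Set.InjOn (momBoost τ) ({0}ᶜ : Set Momentum) :=
    (Function.LeftInverse.injective (momBoost_neg_momBoost τ)).injOn
  have hne : ∀ σ : ℝ, ∀ k : Momentum, k ≠ 0 → momBoost σ k ≠ 0 := by
    intro σ k hk h0
    apply hk
    rw [← momBoost_neg_momBoost σ k, h0]
    simp [momBoost]
  have himg : momBoost τ '' ({0}ᶜ : Set Momentum) = {0}ᶜ := by
    ext k
    constructor
    · rintro ⟨k, hk, rfl⟩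
      exact hne τ k hk
    · intro hk
      refine ⟨momBoost (-τ) k, hne _ k hk, ?_⟩
      simpa using momBoost_neg_momBoost (-τ) k
  have hnull : ∀ g : Momentum → E, ∫ k in ({0}ᶜ : Set Momentum), g k = ∫ k, g k := fun g => by
    rw [restrict_compl_singleton]
  have key := integral_image_eq_integral_abs_det_fderiv_smul (volume : Measure Momentum)
    (measurableSet_singleton (0 : Momentum)).compl hD hinj fun k => ‖k‖⁻¹ • h k
  rw [himg, hnull] at key
  rw [key, ← hnull]
  refine setIntegral_congr_fun (measurableSet_singleton (0 : Momentum)).compl fun k hk => ?_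
  have hE : energy τ k ≠ 0 := by
    rw [← norm_momBoost]
    exact norm_ne_zero_iff.2 (hne τ k hk)
  rw [hdet k hk, norm_momBoost, smul_smul]
  congr 1
  field_simp

theorem integral_momRotate {E : Type} [NormedAddCommGroup E] [NormedSpace ℝ E]
    (h : Momentum → E) : ∫ k, h (momRotate k) = ∫ k, h k :=
  momRotate.measurePreserving.integral_comp
    momRotate.toHomeomorph.measurableEmbedding h

theorem integrable_inv_norm_mul : Integrable fun k : Momentum =>
    ‖k‖⁻¹ * ((1 + ‖k‖ ^ 2)⁻¹) ^ 2 := by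
  refine (integrable_fun_norm_addHaar (volume : Measure Momentum)
    (f := fun y => y⁻¹ * ((1 + y ^ 2)⁻¹) ^ 2)).2 ?_
  refine Integrable.mono' (g := fun y : ℝ => (1 + y ^ 2)⁻¹)
    integrable_inv_one_add_sq.integrableOn ?_ ?_
  · exact (Measurable.aestronglyMeasurable (by fun_prop))
  · refine (ae_restrict_iff' measurableSet_Ioi).2 (Filter.Eventually.of_forall fun y hy => ?_)
    have hy0 : 0 < y := hy
    rw [finrank_euclideanSpace, Fintype.card_fin, smul_eq_mul, Real.norm_of_nonneg (by positivity)]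
    have e : y ^ (3 - 1) * (y⁻¹ * ((1 + y ^ 2)⁻¹) ^ 2) = (y * (1 + y ^ 2)⁻¹) * (1 + y ^ 2)⁻¹ := by
      field_simp
    rw [e]
    refine mul_le_of_le_one_left (by positivity) ?_
    rw [← div_eq_mul_inv, div_le_one (by positivity)]
    nlinarith [sq_nonneg (y - 1)]

end MassShell

/-! ### Decay on the mass shell -/

section Decay

open MeasureTheory

theorem onShell_eq (z : ℂ) (k : Momentum) :
    onShell z k 0 = ((Real.cos z.im * energy z.re k : ℝ) : ℂ) +
        ((Real.sin z.im * (Real.sinh z.re * ‖k‖ + Real.cosh z.re * k 0) : ℝ) : ℂ) * Complex.I ∧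
      onShell z k 1 =
        ((Real.cos z.im * (Real.sinh z.re * ‖k‖ + Real.cosh z.re * k 0) : ℝ) : ℂ) +
        ((Real.sin z.im * energy z.re k : ℝ) : ℂ) * Complex.I := by
  have hz : z = (z.im : ℂ) * Complex.I + (z.re : ℂ) := by
    conv_lhs => rw [← Complex.re_add_im z]
    ring
  have h : onShell z k = onShell ((z.im : ℂ) * Complex.I) (momBoost z.re k) := by
    rw [← onShell_add_ofReal, ← hz]
  rw [h]
  simp only [onShell, Matrix.cons_val_zero, Matrix.cons_val_one, Complex.cosh_mul_I,
    Complex.sinh_mul_I, norm_momBoost, momBoost_apply_zero]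
  push_cast
  constructor <;> ring

theorem phase_onShell_im (z : ℂ) (k : Momentum) (x : Spacetime) :
    (phase (onShell z k) x).im = Real.sin z.im *
      (energy z.re k * x 1 - (Real.sinh z.re * ‖k‖ + Real.cosh z.re * k 0) * x 0) := by
  obtain ⟨h0, h1⟩ := onShell_eq z k
  unfold phase
  rw [h0, h1, mul_sub, ← mul_assoc, ← mul_assoc]
  generalize Real.sin z.im * energy z.re k = A
  generalize Real.sin z.im * (Real.sinh z.re * ‖k‖ + Real.cosh z.re * k 0) = B
  generalize Real.cos z.im * energy z.re k = A'
  generalize Real.cos z.im * (Real.sinh z.re * ‖k‖ + Real.cosh z.re * k 0) = B'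
  simp [onShell]

/-- For rapidities in the strip `0 ≤ Im z ≤ π` the plane waves are bounded on the wedge. -/
theorem norm_planeWave_onShell_le_one {z : ℂ} (h0 : 0 ≤ z.im) (h1 : z.im ≤ Real.pi) (k : Momentum)
    {x : Spacetime} (hx : x ∈ wedge) : ‖planeWave (onShell z k) x‖ ≤ 1 := by
  rw [norm_planeWave, Real.exp_le_one_iff, neg_nonpos, phase_onShell_im]
  refine mul_nonneg (Real.sin_nonneg_of_nonneg_of_le_pi h0 h1) ?_
  have hx' : |x 0| < x 1 := hx
  have hE := energy_nonneg z.re k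
  have hP := abs_momBoost_le_energy z.re k
  set P := Real.sinh z.re * ‖k‖ + Real.cosh z.re * k 0
  have : P * x 0 ≤ energy z.re k * x 1 :=
    calc P * x 0 ≤ |P * x 0| := le_abs_self _
      _ = |P| * |x 0| := abs_mul _ _
      _ ≤ _ := mul_le_mul hP hx'.le (abs_nonneg _) hE
  linarith

theorem norm_planeWave_onShell_real {z : ℂ} (hz : z.im = 0) (k : Momentum) (x : Spacetime) :
    ‖planeWave (onShell z k) x‖ ≤ 1 := by
  rw [norm_planeWave, phase_onShell_im, hz]
  simp

/-- The transform of a test function decays on the mass shell, uniformly in those rapidities for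
which the plane waves are bounded on the support. -/
theorem exists_lorentzFT_onShell_le {f : Spacetime → ℂ} (hf : ContDiff ℝ 2 f)
    (hc : HasCompactSupport f) : ∃ C : ℝ, 0 ≤ C ∧ ∀ (z : ℂ) (k : Momentum),
      (∀ x ∈ tsupport f, ‖planeWave (onShell z k) x‖ ≤ 1) →
        ‖lorentzFT f (onShell z k)‖ ≤ C * (1 + energy z.re k ^ 2)⁻¹ := by
  refine ⟨(∫ x, ‖f x‖) + (∫ x, ‖partial₂ f 0 0 x‖) + ∫ x, ‖partial₂ f 1 1 x‖, ?_,
    fun z k h => ?_⟩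
  · exact add_nonneg (add_nonneg (integral_nonneg fun _ => norm_nonneg _)
      (integral_nonneg fun _ => norm_nonneg _)) (integral_nonneg fun _ => norm_nonneg _)
  · have b := norm_lorentzFT_le hf.continuous hc h
    have b0 := sq_mul_norm_lorentzFT_le hf hc h 0
    have b1 := sq_mul_norm_lorentzFT_le hf hc h 1
    obtain ⟨h0, h1⟩ := onShell_eq z k
    -- the squares of the sine and the cosine of the imaginary part of the rapidity add up to one
    have hE : energy z.re k ^ 2 ≤ ‖onShell z k 0‖ ^ 2 + ‖onShell z k 1‖ ^ 2 := by
      rw [← Complex.normSq_eq_norm_sq, ← Complex.normSq_eq_norm_sq, h0, h1,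
        Complex.normSq_add_mul_I, Complex.normSq_add_mul_I]
      set P := Real.sinh z.re * ‖k‖ + Real.cosh z.re * k 0
      nlinarith [Real.sin_sq_add_cos_sq z.im, sq_nonneg P]
    rw [← div_eq_mul_inv, le_div_iff₀ (by positivity)]
    nlinarith [mul_le_mul_of_nonneg_right hE (norm_nonneg (lorentzFT f (onShell z k)))]

theorem inv_one_add_energy_sq_le (τ : ℝ) (k : Momentum) :
    (1 + energy τ k ^ 2)⁻¹ ≤ Real.exp (2 * |τ|) * (1 + ‖k‖ ^ 2)⁻¹ := by
  have h := exp_mul_norm_le_energy τ k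
  have h1 : Real.exp (-|τ|) ≤ 1 := Real.exp_le_one_iff.2 (neg_nonpos.2 (abs_nonneg τ))
  have h0 := Real.exp_pos (-|τ|)
  have e : Real.exp (2 * |τ|) = (Real.exp (-|τ|) ^ 2)⁻¹ := by
    rw [← Real.exp_nat_mul, ← Real.exp_neg]
    congr 1
    push_cast
    ring
  rw [e, ← mul_inv]
  refine inv_anti₀ (by positivity) ?_
  have h2 : (Real.exp (-|τ|) * ‖k‖) ^ 2 ≤ energy τ k ^ 2 := by gcongr
  nlinarith

theorem inv_one_add_energy_zero_sq (k : Momentum) :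
    (1 + energy 0 k ^ 2)⁻¹ = (1 + ‖k‖ ^ 2)⁻¹ := by
  simp [energy]

end Decay

/-! ### The vacuum two-point function -/

section TwoPoint

open MeasureTheory

theorem mode_eq (k : Momentum) (x : Spacetime) :
    mode k x = planeWave (onShell 0 k) x / (Real.sqrt (2 * ‖k‖) : ℂ) := by
  unfold mode planeWave phase onShell
  congr 3
  simp [Fin.sum_univ_three]

theorem conj_mode_eq (k : Momentum) (x : Spacetime) :
    conj (mode k x) = planeWave (-onShell 0 k) x / (Real.sqrt (2 * ‖k‖) : ℂ) := by
  rw [mode_eq, map_div₀, Complex.conj_ofReal, planeWave_neg, onShell_conj, map_zero]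

theorem integral_mul_mode (f : Spacetime → ℂ) (k : Momentum) :
    ∫ x, f x * mode k x = lorentzFT f (onShell 0 k) / (Real.sqrt (2 * ‖k‖) : ℂ) := by
  unfold lorentzFT
  rw [← integral_div]
  simp only [mode_eq, mul_div_assoc]

theorem integral_mul_conj_mode (f : Spacetime → ℂ) (k : Momentum) :
    ∫ x, f x * conj (mode k x) = lorentzFT f (-onShell 0 k) / (Real.sqrt (2 * ‖k‖) : ℂ) := by
  unfold lorentzFT
  rw [← integral_div]
  simp only [conj_mode_eq, mul_div_assoc]

/-- The integrand of the two-point function whose arguments are boosted by `-z` and `-z'`. -/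
def boostedIntegrand (f g : Spacetime → ℂ) (z z' : ℂ) (k : Momentum) : ℂ :=
  ‖k‖⁻¹ • (1 / 2 * (lorentzFT f (onShell z k) * lorentzFT g (-onShell z' k)))

theorem integrand_eq_boostedIntegrand (f g : Spacetime → ℂ) (k : Momentum) :
    (∫ x, f x * mode k x) * (∫ x, g x * conj (mode k x)) = boostedIntegrand f g 0 0 k := by
  rw [integral_mul_mode, integral_mul_conj_mode, div_mul_div_comm, ← Complex.ofReal_mul,
    Real.mul_self_sqrt (by positivity), boostedIntegrand, Complex.real_smul]
  push_cast
  rw [div_eq_mul_inv, mul_inv]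
  ring

theorem vacuumTwoPoint_eq (f g : Spacetime → ℂ) :
    vacuumTwoPoint f g = ((1 / (2 * Real.pi) ^ 3 : ℝ) : ℂ) * ∫ k, boostedIntegrand f g 0 0 k := by
  unfold vacuumTwoPoint
  simp only [integrand_eq_boostedIntegrand]
  exact integral_const_mul _ _

theorem continuous_boostedIntegrand_inner {f g : Spacetime → ℂ} (hf : Continuous f)
    (hfc : HasCompactSupport f) (hg : Continuous g) (hgc : HasCompactSupport g) (z z' : ℂ) :
    Continuous fun k => 1 / 2 * (lorentzFT f (onShell z k) * lorentzFT g (-onShell z' k)) :=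
  continuous_const.mul (((continuous_lorentzFT hf hfc).comp (continuous_onShell z)).mul
    ((continuous_lorentzFT hg hgc).comp (continuous_onShell z').neg))

theorem aestronglyMeasurable_boostedIntegrand {f g : Spacetime → ℂ} (hf : Continuous f)
    (hfc : HasCompactSupport f) (hg : Continuous g) (hgc : HasCompactSupport g) (z z' : ℂ) :
    AEStronglyMeasurable (boostedIntegrand f g z z') volume :=
  AEStronglyMeasurable.smul (measurable_norm.inv).aestronglyMeasurable
    (continuous_boostedIntegrand_inner hf hfc hg hgc z z').aestronglyMeasurable

theorem norm_boostedIntegrand (f g : Spacetime → ℂ) (z z' : ℂ) (k : Momentum) :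
    ‖boostedIntegrand f g z z' k‖ = ‖k‖⁻¹ * (1 / 2 * (‖lorentzFT f (onShell z k)‖ *
      ‖lorentzFT (fun x => conj (g x)) (onShell (conj z') k)‖)) := by
  unfold boostedIntegrand
  rw [lorentzFT_neg, onShell_conj, norm_smul, norm_mul, norm_mul, RCLike.norm_conj]
  simp

theorem contDiff_conj {g : Spacetime → ℂ} {n : WithTop ℕ∞} (hg : ContDiff ℝ n g) :
    ContDiff ℝ n fun x => conj (g x) :=
  Complex.conjCLE.contDiff.comp hg

theorem hasCompactSupport_conj {g : Spacetime → ℂ} (hg : HasCompactSupport g) :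
    HasCompactSupport fun x => conj (g x) :=
  hg.comp_left (g := conj) (map_zero _)

theorem tsupport_conj (g : Spacetime → ℂ) : tsupport (fun x => conj (g x)) = tsupport g := by
  unfold tsupport
  congr 1
  ext x
  simp

theorem exists_boostedIntegrand_le {f g : Spacetime → ℂ} (hf : ContDiff ℝ 2 f)
    (hfc : HasCompactSupport f) (hg : ContDiff ℝ 2 g) (hgc : HasCompactSupport g) :
    ∃ C : ℝ, 0 ≤ C ∧ ∀ (z z' : ℂ) (k : Momentum),
      (∀ x ∈ tsupport f, ‖planeWave (onShell z k) x‖ ≤ 1) →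
      (∀ x ∈ tsupport g, ‖planeWave (onShell (conj z') k) x‖ ≤ 1) →
        ‖boostedIntegrand f g z z' k‖ ≤
          C * (‖k‖⁻¹ * ((1 + energy z.re k ^ 2)⁻¹ * (1 + energy z'.re k ^ 2)⁻¹)) := by
  obtain ⟨C, hC, h⟩ := exists_lorentzFT_onShell_le hf hfc
  obtain ⟨C', hC', h'⟩ := exists_lorentzFT_onShell_le (contDiff_conj hg)
    (hasCompactSupport_conj hgc)
  refine ⟨1 / 2 * (C * C'), by positivity, fun z z' k hz hz' => ?_⟩
  rw [norm_boostedIntegrand]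
  have b := h z k hz
  have b' := h' (conj z') k (by rwa [tsupport_conj])
  rw [Complex.conj_re] at b'
  calc _ ≤ ‖k‖⁻¹ * (1 / 2 * ((C * (1 + energy z.re k ^ 2)⁻¹) *
        (C' * (1 + energy z'.re k ^ 2)⁻¹))) := by gcongr
    _ = _ := by ring

theorem integrable_boostedIntegrand_zero {f g : Spacetime → ℂ} (hf : ContDiff ℝ 2 f)
    (hfc : HasCompactSupport f) (hg : ContDiff ℝ 2 g) (hgc : HasCompactSupport g) :
    Integrable (boostedIntegrand f g 0 0) := by
  obtain ⟨C, hC, h⟩ := exists_boostedIntegrand_le hf hfc hg hgc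
  refine (integrable_inv_norm_mul.const_mul C).mono'
    (aestronglyMeasurable_boostedIntegrand hf.continuous hfc hg.continuous hgc 0 0)
    (Filter.Eventually.of_forall fun k => ?_)
  have := h 0 0 k (fun x _ => norm_planeWave_onShell_real rfl k x)
    (fun x _ => norm_planeWave_onShell_real (by simp) k x)
  rw [Complex.zero_re, inv_one_add_energy_zero_sq] at this
  rwa [sq (1 + ‖k‖ ^ 2)⁻¹]

theorem phase_onShell_boost (z : ℂ) (k : Momentum) (s : ℝ) (x : Spacetime) :
    phase (onShell z k) (boost s x) = phase (onShell (z - s) k) x := by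
  unfold phase onShell
  simp only [boost_apply, boostFun, Matrix.cons_val_zero, Matrix.cons_val_one, Matrix.cons_val,
    Complex.cosh_sub, Complex.sinh_sub]
  push_cast
  ring

theorem planeWave_neg_eq (κ : Fin 4 → ℂ) (x : Spacetime) :
    planeWave (-κ) x = Complex.exp (-(Complex.I * phase κ x)) := by
  unfold planeWave phase
  congr 1
  simp
  ring

theorem lorentzFT_boost (f : Spacetime → ℂ) (z : ℂ) (k : Momentum) (s : ℝ) :
    lorentzFT (fun x => f (boost (-s) x)) (onShell z k) = lorentzFT f (onShell (z - s) k) := by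
  unfold lorentzFT
  rw [← integral_comp_boost s]
  simp only [boost_neg_boost, planeWave, phase_onShell_boost]

theorem lorentzFT_boost_neg (f : Spacetime → ℂ) (z : ℂ) (k : Momentum) (s : ℝ) :
    lorentzFT (fun x => f (boost (-s) x)) (-onShell z k) = lorentzFT f (-onShell (z - s) k) := by
  unfold lorentzFT
  rw [← integral_comp_boost s]
  simp only [boost_neg_boost, planeWave_neg_eq, phase_onShell_boost]

/-- A common real boost of both arguments is absorbed by the invariant measure. -/
theorem integral_boostedIntegrand_add (f g : Spacetime → ℂ) (z z' : ℂ) (τ : ℝ) :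
    ∫ k, boostedIntegrand f g (z + τ) (z' + τ) k = ∫ k, boostedIntegrand f g z z' k := by
  unfold boostedIntegrand
  simp only [onShell_add_ofReal]
  exact integral_momBoost τ fun k =>
    1 / 2 * (lorentzFT f (onShell z k) * lorentzFT g (-onShell z' k))

/-- The two-point function depends only on the difference of the rapidities of the boosts. -/
theorem vacuumTwoPoint_boost (f g : Spacetime → ℂ) (s t : ℝ) :
    vacuumTwoPoint (fun x => f (boost (-s) x)) (fun x => g (boost (-t) x)) =
      ((1 / (2 * Real.pi) ^ 3 : ℝ) : ℂ) *
        ∫ k, boostedIntegrand f g (((t - s : ℝ) : ℂ) / 2) (-(((t - s : ℝ) : ℂ) / 2)) k := by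
  rw [vacuumTwoPoint_eq, ← integral_boostedIntegrand_add f g _ _ (-((s + t) / 2))]
  congr 2
  funext k
  unfold boostedIntegrand
  rw [lorentzFT_boost, lorentzFT_boost_neg]
  congr 5
  · push_cast
    ring
  · congr 2
    push_cast
    ring

end TwoPoint

/-! ### The thermal continuation -/

section Thermal

open MeasureTheory

theorem differentiable_lorentzFT_comp {f : Spacetime → ℂ} (hf : Continuous f)
    (hc : HasCompactSupport f) {γ : ℂ → Fin 4 → ℂ} (hγ : ∀ μ, Differentiable ℂ fun z => γ z μ) :
    Differentiable ℂ fun z => lorentzFT f (γ z) := by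
  intro z₀
  have hγc : Continuous γ := continuous_pi fun μ => (hγ μ).continuous
  obtain ⟨M, hM⟩ := ((isCompact_closedBall z₀ 1).prod hc).bddAbove_image
    (f := fun p : ℂ × Spacetime => ‖planeWave (γ p.1) p.2‖)
    (continuous_planeWave_uncurry.comp
      ((hγc.comp continuous_fst).prodMk continuous_snd)).norm.continuousOn
  have h : DifferentiableOn ℂ (fun z => ∫ x, f x * planeWave (γ z) x) (Metric.ball z₀ 1) := by
    refine differentiableOn_integral_of_dominated Metric.isOpen_ball (b := fun x => ‖f x‖ * M)
      (fun z _ => (hf.mul (continuous_planeWave _)).aestronglyMeasurable) (fun x => ?_)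
      (fun z hz x => ?_) ((hf.integrable_of_hasCompactSupport hc).norm.mul_const M)
    · refine Differentiable.differentiableOn ?_
      refine Differentiable.const_mul (Differentiable.cexp (Differentiable.const_mul ?_ _)) _
      unfold phase
      exact ((((hγ 1).mul_const _).add ((hγ 2).mul_const _)).add ((hγ 3).mul_const _)).sub
        ((hγ 0).mul_const _)
    · rw [norm_mul]
      by_cases hx : x ∈ tsupport f
      · refine mul_le_mul_of_nonneg_left ?_ (norm_nonneg _)
        exact hM ⟨(z, x), ⟨Metric.ball_subset_closedBall hz, hx⟩, rfl⟩
      · rw [image_eq_zero_of_notMem_tsupport hx]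
        simp
  exact h.differentiableAt (Metric.ball_mem_nhds z₀ one_pos)

/-- The continuation of the vacuum two-point function in the relative rapidity. The rapidity is
distributed evenly over both arguments, which keeps each of them in the strip of width `π` where the
plane waves decay on the wedge. -/
def thermalTwoPoint (f g : Spacetime → ℂ) (θ : ℂ) : ℂ :=
  ((1 / (2 * Real.pi) ^ 3 : ℝ) : ℂ) * ∫ k, boostedIntegrand f g (θ / 2) (-(θ / 2)) k

theorem differentiable_boostedIntegrand {f g : Spacetime → ℂ} (hf : Continuous f)
    (hfc : HasCompactSupport f) (hg : Continuous g) (hgc : HasCompactSupport g) (k : Momentum) :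
    Differentiable ℂ fun θ => boostedIntegrand f g (θ / 2) (-(θ / 2)) k := by
  have h1 : Differentiable ℂ fun θ => lorentzFT f (onShell (θ / 2) k) :=
    differentiable_lorentzFT_comp hf hfc fun μ =>
      (differentiable_onShell k μ).comp (differentiable_id.div_const 2)
  have h2 : Differentiable ℂ fun θ => lorentzFT g (-onShell (-(θ / 2)) k) :=
    differentiable_lorentzFT_comp hg hgc fun μ =>
      ((differentiable_onShell k μ).comp (differentiable_id.div_const 2).neg).neg
  exact ((h1.mul h2).const_mul (1 / 2)).const_smul ‖k‖⁻¹

theorem exists_boostedIntegrand_wedge_le (f g : TestFn wedge) :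
    ∃ C : ℝ, 0 ≤ C ∧ ∀ (θ : ℂ) (k : Momentum), 0 ≤ θ.im → θ.im ≤ 2 * Real.pi →
      ‖boostedIntegrand f g (θ / 2) (-(θ / 2)) k‖ ≤ C * (‖k‖⁻¹ *
        ((1 + energy (θ.re / 2) k ^ 2)⁻¹ * (1 + energy (-(θ.re / 2)) k ^ 2)⁻¹)) := by
  obtain ⟨C, hC, h⟩ := exists_boostedIntegrand_le (TestFn.contDiff_two f) f.hasCompactSupport
    (TestFn.contDiff_two g) g.hasCompactSupport
  refine ⟨C, hC, fun θ k h0 h1 => ?_⟩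
  have hre : (θ / 2).re = θ.re / 2 := by simp
  have him : (θ / 2).im = θ.im / 2 := by simp
  have := h (θ / 2) (-(θ / 2)) k
    (fun x hx => norm_planeWave_onShell_le_one (by rw [him]; linarith) (by rw [him]; linarith) k
      (f.tsupport_subset hx))
    (fun x hx => norm_planeWave_onShell_le_one
      (by rw [Complex.conj_im, Complex.neg_im, him]; linarith)
      (by rw [Complex.conj_im, Complex.neg_im, him]; linarith) k (g.tsupport_subset hx))
  rwa [Complex.neg_re, hre] at this

/-- A bound for the integrand that is uniform in bounded sets of rapidities. -/
theorem exists_boostedIntegrand_wedge_le_local (f g : TestFn wedge) (T : ℝ) :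
    ∃ C : ℝ, ∀ (θ : ℂ) (k : Momentum), 0 ≤ θ.im → θ.im ≤ 2 * Real.pi → |θ.re| < T →
      ‖boostedIntegrand f g (θ / 2) (-(θ / 2)) k‖ ≤ C * (‖k‖⁻¹ * ((1 + ‖k‖ ^ 2)⁻¹) ^ 2) := by
  obtain ⟨C, hC, h⟩ := exists_boostedIntegrand_wedge_le f g
  refine ⟨C * Real.exp T ^ 2, fun θ k h0 h1 hT => (h θ k h0 h1).trans ?_⟩
  have e : ∀ τ : ℝ, |τ| = |θ.re / 2| →
      (1 + energy τ k ^ 2)⁻¹ ≤ Real.exp T * (1 + ‖k‖ ^ 2)⁻¹ := by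
    intro τ hτ
    refine (inv_one_add_energy_sq_le τ k).trans ?_
    gcongr
    rw [hτ, abs_div, abs_two]
    linarith
  calc _ ≤ C * (‖k‖⁻¹ * ((Real.exp T * (1 + ‖k‖ ^ 2)⁻¹) * (Real.exp T * (1 + ‖k‖ ^ 2)⁻¹))) := by
        gcongr
        · exact e _ rfl
        · exact e _ (abs_neg _)
    _ = _ := by ring

theorem continuousOn_thermalTwoPoint (f g : TestFn wedge) :
    ContinuousOn (thermalTwoPoint f g) {θ | 0 ≤ θ.im ∧ θ.im ≤ 2 * Real.pi} := by
  intro θ₀ hθ₀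
  obtain ⟨C, hC⟩ := exists_boostedIntegrand_wedge_le_local f g (|θ₀.re| + 1)
  have hV : {θ : ℂ | |θ.re| < |θ₀.re| + 1} ∈ nhds θ₀ :=
    (isOpen_lt (Complex.continuous_re.abs) continuous_const).mem_nhds
      (by change |θ₀.re| < |θ₀.re| + 1; linarith)
  rw [← continuousWithinAt_inter hV]
  refine ContinuousOn.continuousWithinAt (continuousOn_const.mul ?_)
    ⟨hθ₀, mem_of_mem_nhds hV⟩
  refine continuousOn_of_dominated
    (bound := fun k => C * (‖k‖⁻¹ * ((1 + ‖k‖ ^ 2)⁻¹) ^ 2))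
    (fun θ _ => aestronglyMeasurable_boostedIntegrand f.continuous f.hasCompactSupport
      g.continuous g.hasCompactSupport _ _)
    (fun θ hθ => Filter.Eventually.of_forall fun k => hC θ k hθ.1.1 hθ.1.2 hθ.2)
    (integrable_inv_norm_mul.const_mul C) (Filter.Eventually.of_forall fun k => ?_)
  exact (differentiable_boostedIntegrand f.continuous f.hasCompactSupport
      g.continuous g.hasCompactSupport k).continuous.continuousOn

theorem differentiableOn_thermalTwoPoint (f g : TestFn wedge) :
    DifferentiableOn ℂ (thermalTwoPoint f g) {θ | 0 < θ.im ∧ θ.im < 2 * Real.pi} := by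
  intro θ₀ hθ₀
  obtain ⟨C, hC⟩ := exists_boostedIntegrand_wedge_le_local f g (|θ₀.re| + 1)
  have hU : IsOpen {θ : ℂ | (0 < θ.im ∧ θ.im < 2 * Real.pi) ∧ |θ.re| < |θ₀.re| + 1} :=
    ((isOpen_lt continuous_const Complex.continuous_im).inter
      (isOpen_lt Complex.continuous_im continuous_const)).inter
      (isOpen_lt (Complex.continuous_re.abs) continuous_const)
  have h := differentiableOn_integral_of_dominated (m := volume) hU
    (h := fun θ k => boostedIntegrand f g (θ / 2) (-(θ / 2)) k)
    (b := fun k => C * (‖k‖⁻¹ * ((1 + ‖k‖ ^ 2)⁻¹) ^ 2))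
    (fun θ _ => aestronglyMeasurable_boostedIntegrand f.continuous f.hasCompactSupport
      g.continuous g.hasCompactSupport _ _)
    (fun k => (differentiable_boostedIntegrand f.continuous f.hasCompactSupport
      g.continuous g.hasCompactSupport k).differentiableOn)
    (fun θ hθ k => hC θ k hθ.1.1.le hθ.1.2.le hθ.2) (integrable_inv_norm_mul.const_mul C)
  exact ((h.differentiableAt (hU.mem_nhds ⟨hθ₀, by linarith⟩)).const_mul _
    ).differentiableWithinAt

/-- The continuation is bounded, uniformly in the real part of the rapidity, because the measure
`d³k / |k|` is Lorentz invariant. -/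
theorem exists_thermalTwoPoint_le (f g : TestFn wedge) : ∃ C : ℝ, ∀ θ : ℂ,
    0 ≤ θ.im → θ.im ≤ 2 * Real.pi → ‖thermalTwoPoint f g θ‖ ≤ C := by
  obtain ⟨C, hC, h⟩ := exists_boostedIntegrand_wedge_le f g
  have hint : ∀ τ : ℝ, Integrable fun k : Momentum => ‖k‖⁻¹ * ((1 + energy τ k ^ 2)⁻¹) ^ 2 := by
    intro τ
    refine (integrable_inv_norm_mul.const_mul (Real.exp (2 * |τ|) ^ 2)).mono' ?_
      (Filter.Eventually.of_forall fun k => ?_)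
    · refine Measurable.aestronglyMeasurable ?_
      unfold energy
      fun_prop
    · rw [Real.norm_of_nonneg (by positivity)]
      calc _ ≤ ‖k‖⁻¹ * (Real.exp (2 * |τ|) * (1 + ‖k‖ ^ 2)⁻¹) ^ 2 := by
            gcongr
            exact inv_one_add_energy_sq_le τ k
        _ = _ := by ring
  have hval : ∀ τ : ℝ, ∫ k : Momentum, ‖k‖⁻¹ * ((1 + energy τ k ^ 2)⁻¹) ^ 2 =
      ∫ k : Momentum, ‖k‖⁻¹ * ((1 + ‖k‖ ^ 2)⁻¹) ^ 2 := by
    intro τ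
    have := integral_momBoost τ fun k => ((1 + ‖k‖ ^ 2)⁻¹) ^ 2
    simpa only [norm_momBoost, smul_eq_mul] using this
  refine ⟨‖((1 / (2 * Real.pi) ^ 3 : ℝ) : ℂ)‖ *
    (C * ∫ k : Momentum, ‖k‖⁻¹ * ((1 + ‖k‖ ^ 2)⁻¹) ^ 2), fun θ h0 h1 => ?_⟩
  unfold thermalTwoPoint
  rw [norm_mul]
  refine mul_le_mul_of_nonneg_left ?_ (norm_nonneg _)
  have hb := (((hint (θ.re / 2)).add (hint (-(θ.re / 2)))).div_const 2).const_mul C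
  refine (norm_integral_le_of_norm_le hb (Filter.Eventually.of_forall fun k => ?_)).trans ?_
  · refine (h θ k h0 h1).trans ?_
    simp only [Pi.add_apply]
    rw [← mul_add, mul_div_assoc]
    gcongr
    -- `x y ≤ (x² + y²) / 2`, and each square alone is a boosted copy of the same function
    nlinarith [sq_nonneg ((1 + energy (θ.re / 2) k ^ 2)⁻¹ - (1 + energy (-(θ.re / 2)) k ^ 2)⁻¹)]
  · rw [integral_const_mul, integral_div]
    simp only [Pi.add_apply]
    rw [integral_add (hint _) (hint _), hval, hval]
    simp

theorem thermalTwoPoint_lower (f g : Spacetime → ℂ) (s t : ℝ) :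
    thermalTwoPoint f g ((t - s : ℝ) : ℂ) =
      vacuumTwoPoint (fun x => f (boost (-s) x)) (fun x => g (boost (-t) x)) :=
  (vacuumTwoPoint_boost f g s t).symm

theorem momRotate_momRotate (k : Momentum) : momRotate (momRotate k) = k := by
  ext i
  fin_cases i
  · exact (momRotate_zero _).trans (momRotate_zero k)
  · exact (momRotate_one _).trans ((congrArg Neg.neg (momRotate_one k)).trans (neg_neg _))
  · exact (momRotate_two _).trans ((congrArg Neg.neg (momRotate_two k)).trans (neg_neg _))

theorem onShell_sub_pi (z : ℂ) (k : Momentum) :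
    onShell (z - Real.pi * Complex.I) k = -onShell z (momRotate k) := by
  have h := onShell_add_pi (z - Real.pi * Complex.I) (momRotate k)
  rw [sub_add_cancel, momRotate_momRotate] at h
  rw [h, neg_neg]

/-- At the upper boundary of the strip both arguments are reflected by a boost with rapidity `iπ`,
which exchanges positive with negative frequencies. -/
theorem thermalTwoPoint_upper (f g : Spacetime → ℂ) (s t : ℝ) :
    thermalTwoPoint f g ((t - s : ℝ) + 2 * Real.pi * Complex.I) =
      vacuumTwoPoint (fun x => g (boost (-t) x)) (fun x => f (boost (-s) x)) := by
  rw [vacuumTwoPoint_boost, thermalTwoPoint, ← integral_momRotate (boostedIntegrand g f _ _)]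
  congr 2
  funext k
  unfold boostedIntegrand
  have h1 : (((t - s : ℝ) : ℂ) + 2 * Real.pi * Complex.I) / 2 =
      -(((s - t : ℝ) : ℂ) / 2) + Real.pi * Complex.I := by
    push_cast
    ring
  have h2 : -((((t - s : ℝ) : ℂ) + 2 * Real.pi * Complex.I) / 2) =
      ((s - t : ℝ) : ℂ) / 2 - Real.pi * Complex.I := by
    push_cast
    ring
  rw [h2, h1, onShell_add_pi, onShell_sub_pi, neg_neg, momRotate.norm_map, mul_comm (lorentzFT f _)]

theorem isThermalTwoPoint_vacuum :
    IsThermalTwoPoint (fun f g => vacuumTwoPoint f g) fun f g => thermalTwoPoint f g where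
  continuousOn := continuousOn_thermalTwoPoint
  bounded := exists_thermalTwoPoint_le
  differentiableOn := differentiableOn_thermalTwoPoint
  lower f g := thermalTwoPoint_lower f g
  upper f g := thermalTwoPoint_upper f g

end Thermal

/-! ### Fourier transforms of time slices -/

section Slices

open MeasureTheory FourierTransform

/-- The spacetime point with time `s` and spatial position `y`. -/
def slice (s : ℝ) (y : Momentum) : Spacetime := ![s, y 0, y 1, y 2]

/-- The purely spatial momentum `k`. -/
def spatial (k : Momentum) : Fin 4 → ℂ := ![0, k 0, k 1, k 2]

theorem slice_apply_zero (s : ℝ) (y : Momentum) : slice s y 0 = s := rfl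

theorem continuous_slice : Continuous fun p : ℝ × Momentum => slice p.1 p.2 := by
  unfold slice
  refine continuous_pi fun μ => ?_
  fin_cases μ <;> simp <;> fun_prop

theorem continuous_spatial : Continuous spatial := by
  unfold spatial
  refine continuous_pi fun μ => ?_
  fin_cases μ <;> simp <;> fun_prop

theorem slice_add_smul (s : ℝ) (y : Momentum) (i : Fin 3) (t : ℝ) :
    slice s (y + t • EuclideanSpace.single i 1) = slice s y + t • unitVec i.succ := by
  funext μ
  fin_cases i <;> fin_cases μ <;> simp [slice, unitVec]

/-- The splitting of spacetime into time and space. -/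
def sliceEquiv : ℝ × Momentum ≃ᵐ Spacetime :=
  (MeasurableEquiv.prodCongr (MeasurableEquiv.refl ℝ)
    (MeasurableEquiv.toLp 2 (Fin 3 → ℝ)).symm).trans
    (MeasurableEquiv.piFinSuccAbove (fun _ : Fin 4 => ℝ) 0).symm

theorem sliceEquiv_apply (p : ℝ × Momentum) : sliceEquiv p = slice p.1 p.2 := by
  funext μ
  fin_cases μ <;> rfl

theorem measurePreserving_sliceEquiv : MeasurePreserving sliceEquiv := by
  have h1 : MeasurePreserving (MeasurableEquiv.prodCongr (MeasurableEquiv.refl ℝ)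
      (MeasurableEquiv.toLp 2 (Fin 3 → ℝ)).symm) :=
    (MeasurePreserving.id (volume : Measure ℝ)).prod
      (EuclideanSpace.volume_preserving_symm_measurableEquiv_toLp (Fin 3))
  exact h1.trans (volume_preserving_piFinSuccAbove (fun _ : Fin 4 => ℝ) 0).symm

theorem integral_eq_integral_slice {F : Spacetime → ℂ} (hF : Integrable F) :
    ∫ x, F x = ∫ s, ∫ y, F (slice s y) := by
  rw [← measurePreserving_sliceEquiv.integral_comp sliceEquiv.measurableEmbedding]
  have h := (measurePreserving_sliceEquiv.integrable_comp_emb sliceEquiv.measurableEmbedding).2 hF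
  rw [Measure.volume_eq_prod, integral_prod _ (by exact h)]
  simp only [sliceEquiv_apply]

/-- The spatial Fourier transform of a function at the time `s`. -/
def sliceFT (f : Spacetime → ℂ) (s : ℝ) (k : Momentum) : ℂ :=
  ∫ y, f (slice s y) * planeWave (spatial k) (slice s y)

theorem norm_planeWave_spatial (k : Momentum) (x : Spacetime) : ‖planeWave (spatial k) x‖ = 1 := by
  rw [norm_planeWave]
  simp [phase, spatial]

theorem exists_slice_compact {f : Spacetime → ℂ} (hc : HasCompactSupport f) :
    ∃ R : ℝ, ∀ s y, y ∉ Metric.closedBall (0 : Momentum) R → slice s y ∉ tsupport f := by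
  obtain ⟨R, hR⟩ := hc.isBounded.subset_closedBall (0 : Spacetime)
  refine ⟨2 * R, fun s y hy hx => hy ?_⟩
  have h := hR hx
  rw [mem_closedBall_zero_iff] at h ⊢
  have hR0 : 0 ≤ R := (norm_nonneg _).trans h
  have hi : ∀ μ, |slice s y μ| ≤ R := fun μ => (norm_le_pi_norm (slice s y) μ).trans h
  have h1 : |y 0| ≤ R := hi 1
  have h2 : |y 1| ≤ R := hi 2
  have h3 : |y 2| ≤ R := hi 3
  rw [← sq_le_sq₀ (norm_nonneg _) (by positivity), momentum_norm_sq]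
  nlinarith [sq_le_sq' (abs_le.1 h1).1 (abs_le.1 h1).2, sq_le_sq' (abs_le.1 h2).1 (abs_le.1 h2).2,
    sq_le_sq' (abs_le.1 h3).1 (abs_le.1 h3).2]

theorem hasCompactSupport_slice {f : Spacetime → ℂ} (hc : HasCompactSupport f) (s : ℝ) :
    HasCompactSupport fun y => f (slice s y) := by
  obtain ⟨R, hR⟩ := exists_slice_compact hc
  exact HasCompactSupport.intro (isCompact_closedBall 0 R) fun y hy =>
    image_eq_zero_of_notMem_tsupport (hR s y hy)

theorem continuous_slice_right (s : ℝ) : Continuous (slice s) :=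
  continuous_slice.comp (Continuous.prodMk_right s)

theorem continuous_planeWave_comp {X : Type} [TopologicalSpace X] {κ : X → Fin 4 → ℂ}
    {x : X → Spacetime} (hκ : Continuous κ) (hx : Continuous x) :
    Continuous fun p => planeWave (κ p) (x p) := by
  unfold planeWave phase
  fun_prop

theorem continuous_sliceFT {f : Spacetime → ℂ} (hf : Continuous f) (hc : HasCompactSupport f) :
    Continuous fun p : ℝ × Momentum => sliceFT f p.1 p.2 := by
  obtain ⟨R, hR⟩ := exists_slice_compact hc
  have hs : Continuous fun q : (ℝ × Momentum) × Momentum => slice q.1.1 q.2 :=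
    continuous_slice.comp ((continuous_fst.comp continuous_fst).prodMk continuous_snd)
  have hp : Continuous fun q : (ℝ × Momentum) × Momentum => spatial q.1.2 :=
    continuous_spatial.comp (continuous_snd.comp continuous_fst)
  have hF : Continuous fun q : (ℝ × Momentum) × Momentum =>
      f (slice q.1.1 q.2) * planeWave (spatial q.1.2) (slice q.1.1 q.2) :=
    (hf.comp hs).mul (continuous_planeWave_comp hp hs)
  have h : Continuous fun p : ℝ × Momentum => ∫ y in Metric.closedBall (0 : Momentum) R,
      f (slice p.1 y) * planeWave (spatial p.2) (slice p.1 y) :=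
    continuous_parametric_integral_of_continuous hF (isCompact_closedBall (0 : Momentum) R)
  refine h.congr fun p => ?_
  refine setIntegral_eq_integral_of_forall_compl_eq_zero fun y hy => ?_
  rw [image_eq_zero_of_notMem_tsupport (hR _ y hy), zero_mul]

theorem exists_norm_sliceFT_le {f : Spacetime → ℂ} (hf : Continuous f)
    (hc : HasCompactSupport f) : ∃ C : ℝ, 0 ≤ C ∧ ∀ s k, ‖sliceFT f s k‖ ≤ C := by
  obtain ⟨R, hR⟩ := exists_slice_compact hc
  obtain ⟨M, hM⟩ := hf.bounded_above_of_compact_support hc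
  have hM0 : 0 ≤ M := (norm_nonneg _).trans (hM 0)
  refine ⟨∫ y in Metric.closedBall (0 : Momentum) R, M, by positivity, fun s k => ?_⟩
  unfold sliceFT
  rw [← setIntegral_eq_integral_of_forall_compl_eq_zero (s := Metric.closedBall (0 : Momentum) R)]
  · refine norm_integral_le_of_norm_le ?_ (Filter.Eventually.of_forall fun y => ?_)
    · exact integrableOn_const (isCompact_closedBall (0 : Momentum) R).measure_lt_top.ne
    · rw [norm_mul, norm_planeWave_spatial, mul_one]
      exact hM _
  · intro y hy
    rw [image_eq_zero_of_notMem_tsupport (hR _ y hy), zero_mul]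

/-- The derivative in a spatial direction. -/
def spatialDeriv (i : Fin 3) (f : Spacetime → ℂ) (x : Spacetime) : ℂ :=
  fderiv ℝ f x (unitVec i.succ)

theorem contDiff_spatialDeriv {f : Spacetime → ℂ} (hf : ContDiff ℝ (⊤ : ℕ∞) f) (i : Fin 3) :
    ContDiff ℝ (⊤ : ℕ∞) (spatialDeriv i f) :=
  (hf.fderiv_right (m := (⊤ : ℕ∞)) (by simp)).clm_apply contDiff_const

theorem hasCompactSupport_spatialDeriv {f : Spacetime → ℂ} (hc : HasCompactSupport f) (i : Fin 3) :
    HasCompactSupport (spatialDeriv i f) :=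
  hc.fderiv_apply ℝ (unitVec i.succ)

theorem sliceFT_spatialDeriv {f : Spacetime → ℂ} (hf : ContDiff ℝ 1 f) (hc : HasCompactSupport f)
    (i : Fin 3) (s : ℝ) (k : Momentum) :
    sliceFT (spatialDeriv i f) s k = -(Complex.I * k i) * sliceFT f s k := by
  have hlow : lower (spatial k) i.succ = k i := by
    fin_cases i <;> simp [lower, spatial]
  have hp : Continuous fun y => planeWave (spatial k) (slice s y) :=
    (continuous_planeWave _).comp (continuous_slice_right s)
  have hf' : Continuous fun y => f (slice s y) := hf.continuous.comp (continuous_slice_right s)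
  have hd' : Continuous fun y => spatialDeriv i f (slice s y) :=
    ((hf.continuous_fderiv (by norm_num)).clm_apply continuous_const).comp
      (continuous_slice_right s)
  have hcs := hasCompactSupport_slice hc s
  have hcd := hasCompactSupport_slice (hasCompactSupport_spatialDeriv hc i) s
  have key := integral_bilinear_hasLineDerivAt_right_eq_neg_left_of_integrable
    (μ := (volume : Measure Momentum)) (B := ContinuousLinearMap.mul ℝ ℂ)
    (f := fun y => planeWave (spatial k) (slice s y))
    (f' := fun y => Complex.I * k i * planeWave (spatial k) (slice s y))
    (g := fun y => f (slice s y)) (g' := fun y => spatialDeriv i f (slice s y))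
    (v := EuclideanSpace.single i 1)
    (((continuous_const.mul hp).mul hf').integrable_of_hasCompactSupport hcs.mul_left)
    ((hp.mul hd').integrable_of_hasCompactSupport hcd.mul_left)
    ((hp.mul hf').integrable_of_hasCompactSupport hcs.mul_left)
    (fun y _ => by
      have := hasLineDerivAt_planeWave (spatial k) (slice s y) i.succ
      rw [hlow] at this
      unfold HasLineDerivAt at this ⊢
      simpa only [slice_add_smul] using this)
    (fun y _ => by
      have : HasLineDerivAt ℝ f (spatialDeriv i f (slice s y)) (slice s y) (unitVec i.succ) :=
        ((hf.differentiable (by norm_num)).differentiableAt).hasFDerivAt.hasLineDerivAt _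
      unfold HasLineDerivAt at this ⊢
      simpa only [slice_add_smul] using this)
  simp only [ContinuousLinearMap.mul_apply'] at key
  unfold sliceFT
  rw [← integral_const_mul]
  calc ∫ y, spatialDeriv i f (slice s y) * planeWave (spatial k) (slice s y)
      = ∫ y, planeWave (spatial k) (slice s y) * spatialDeriv i f (slice s y) := by
        simp only [mul_comm]
    _ = _ := key
    _ = _ := by
        rw [← integral_neg]
        refine integral_congr_ae (Filter.Eventually.of_forall fun y => ?_)
        simp only
        ring

/-- The spatial Fourier transform of a test function decays rapidly, uniformly in time. -/
theorem exists_norm_sliceFT_decay {f : Spacetime → ℂ} (hf : ContDiff ℝ (⊤ : ℕ∞) f)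
    (hc : HasCompactSupport f) :
    ∃ C : ℝ, 0 ≤ C ∧ ∀ s k, ‖sliceFT f s k‖ ≤ C * ((1 + ‖k‖ ^ 2)⁻¹) ^ 2 := by
  have one_le : ∀ {g : Spacetime → ℂ}, ContDiff ℝ (⊤ : ℕ∞) g → ContDiff ℝ 1 g := fun hg =>
    hg.of_le (WithTop.coe_le_coe.2 le_top)
  have h4 : ∀ i : Fin 3, ∃ C : ℝ, 0 ≤ C ∧ ∀ s k, k i ^ 4 * ‖sliceFT f s k‖ ≤ C := by
    intro i
    have s1 := contDiff_spatialDeriv hf i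
    have s2 := contDiff_spatialDeriv s1 i
    have s3 := contDiff_spatialDeriv s2 i
    have c1 := hasCompactSupport_spatialDeriv hc i
    have c2 := hasCompactSupport_spatialDeriv c1 i
    have c3 := hasCompactSupport_spatialDeriv c2 i
    obtain ⟨C, hC, h⟩ := exists_norm_sliceFT_le (contDiff_spatialDeriv s3 i).continuous
      (hasCompactSupport_spatialDeriv c3 i)
    refine ⟨C, hC, fun s k => ?_⟩
    have := h s k
    rw [sliceFT_spatialDeriv (one_le s3) c3, sliceFT_spatialDeriv (one_le s2) c2,
      sliceFT_spatialDeriv (one_le s1) c1, sliceFT_spatialDeriv (one_le hf) hc] at this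
    simp only [norm_mul, norm_neg, Complex.norm_I, one_mul, Complex.norm_real] at this
    have e : k i ^ 4 = ‖k i‖ * (‖k i‖ * (‖k i‖ * ‖k i‖)) := by
      rw [Real.norm_eq_abs, ← mul_assoc, abs_mul_abs_self]
      ring
    rw [e]
    linarith
  obtain ⟨C, hC, h⟩ := exists_norm_sliceFT_le hf.continuous hc
  obtain ⟨C₀, hC₀, h₀⟩ := h4 0
  obtain ⟨C₁, hC₁, h₁⟩ := h4 1
  obtain ⟨C₂, hC₂, h₂⟩ := h4 2
  refine ⟨2 * C + 6 * (C₀ + C₁ + C₂), by positivity, fun s k => ?_⟩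
  rw [inv_pow, ← div_eq_mul_inv, le_div_iff₀ (by positivity), momentum_norm_sq]
  have hle : (1 + (k 0 ^ 2 + k 1 ^ 2 + k 2 ^ 2)) ^ 2 ≤ 2 + 6 * (k 0 ^ 4 + k 1 ^ 4 + k 2 ^ 4) := by
    nlinarith [sq_nonneg (k 0 ^ 2 + k 1 ^ 2 + k 2 ^ 2 - 1), sq_nonneg (k 0 ^ 2 - k 1 ^ 2),
      sq_nonneg (k 0 ^ 2 - k 2 ^ 2), sq_nonneg (k 1 ^ 2 - k 2 ^ 2)]
  have := mul_le_mul_of_nonneg_left hle (norm_nonneg (sliceFT f s k))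
  nlinarith [h s k, h₀ s k, h₁ s k, h₂ s k]

theorem integrable_inv_sq : Integrable fun k : Momentum => ((1 + ‖k‖ ^ 2)⁻¹) ^ 2 := by
  refine (integrable_fun_norm_addHaar (volume : Measure Momentum)
    (f := fun y => ((1 + y ^ 2)⁻¹) ^ 2)).2 ?_
  refine Integrable.mono' (g := fun y : ℝ => (1 + y ^ 2)⁻¹)
    integrable_inv_one_add_sq.integrableOn ?_ (Filter.Eventually.of_forall fun y => ?_)
  · exact (Measurable.aestronglyMeasurable (by fun_prop))
  · have e : y ^ (3 - 1) * ((1 + y ^ 2)⁻¹) ^ 2 = (y ^ 2 * (1 + y ^ 2)⁻¹) * (1 + y ^ 2)⁻¹ := by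
      rw [show 3 - 1 = 2 from rfl, sq (1 + y ^ 2)⁻¹, mul_assoc]
    rw [finrank_euclideanSpace, Fintype.card_fin, smul_eq_mul, e,
      Real.norm_of_nonneg (by positivity)]
    refine mul_le_of_le_one_left (by positivity) ?_
    rw [← div_eq_mul_inv, div_le_one (by positivity)]
    linarith

theorem integrable_sliceFT {f : Spacetime → ℂ} (hf : ContDiff ℝ (⊤ : ℕ∞) f)
    (hc : HasCompactSupport f) (s : ℝ) : Integrable (sliceFT f s) := by
  obtain ⟨C, hC, h⟩ := exists_norm_sliceFT_decay hf hc
  exact (integrable_inv_sq.const_mul C).mono'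
    ((continuous_sliceFT hf.continuous hc).comp (Continuous.prodMk_right s)).aestronglyMeasurable
    (Filter.Eventually.of_forall fun k => h s k)

theorem phase_spatial_slice (k : Momentum) (s : ℝ) (y : Momentum) :
    phase (spatial k) (slice s y) = ((inner ℝ y k : ℝ) : ℂ) := by
  simp [phase, spatial, slice, PiLp.inner_apply, Fin.sum_univ_three]

/-- Fourier inversion on time slices. -/
theorem eq_integral_sliceFT {f : Spacetime → ℂ} (hf : ContDiff ℝ (⊤ : ℕ∞) f)
    (hc : HasCompactSupport f) (s : ℝ) (y : Momentum) :
    f (slice s y) = ((1 / (2 * Real.pi) ^ 3 : ℝ) : ℂ) *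
      ∫ k, sliceFT f s k * planeWave (spatial (-k)) (slice s y) := by
  set F : Momentum → ℂ := fun y => f (slice s y) with hF
  have hFc : Continuous F := hf.continuous.comp (continuous_slice_right s)
  have hFi : Integrable F := hFc.integrable_of_hasCompactSupport (hasCompactSupport_slice hc s)
  have hinv : ∀ ξ, 𝓕⁻ F ξ = sliceFT f s ((2 * Real.pi) • ξ) := by
    intro ξ
    rw [Real.fourierInv_eq']
    unfold sliceFT
    refine integral_congr_ae (Filter.Eventually.of_forall fun y => ?_)
    simp only [planeWave, phase_spatial_slice, inner_smul_right, smul_eq_mul, hF]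
    rw [mul_comm, mul_comm Complex.I]
  have hFou : Integrable (𝓕 F) := by
    have : 𝓕 F = fun ξ => sliceFT f s ((-(2 * Real.pi)) • ξ) := by
      funext ξ
      rw [← neg_neg ξ, ← Real.fourierInv_eq_fourier_neg, hinv]
      simp
    rw [this]
    exact (integrable_sliceFT hf hc s).comp_smul (by simp [Real.pi_ne_zero])
  have h := congrFun (hFc.fourier_fourierInv_eq hFi hFou) y
  change F y = _
  rw [← h, Real.fourier_eq']
  have hsub := Measure.integral_comp_smul (volume : Measure Momentum)
    (fun k => sliceFT f s k * planeWave (spatial (-k)) (slice s y)) (2 * Real.pi)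
  rw [finrank_euclideanSpace, Fintype.card_fin, abs_of_nonneg (by positivity)] at hsub
  rw [one_div, ← Complex.real_smul, ← hsub]
  refine integral_congr_ae (Filter.Eventually.of_forall fun ξ => ?_)
  simp only [hinv, planeWave, phase_spatial_slice, inner_neg_right, inner_smul_right, smul_eq_mul]
  rw [mul_comm, mul_comm Complex.I, real_inner_comm]
  congr 3
  push_cast
  ring

end Slices

/-! ### Duhamel's formula and Green's identity -/

section Duhamel

open MeasureTheory

/-- The integral `∫ h(r) exp(-iwr) dr` from `b` to `s`. -/
def expIntegral (h : ℝ → ℂ) (w b s : ℝ) : ℂ :=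
  ∫ r in b..s, h r * Complex.exp (-(Complex.I * w * r))

/-- The solution `c` of `-c'' - w² c = h` with vanishing data at `b`. -/
def duhamel (h : ℝ → ℂ) (w b s : ℝ) : ℂ :=
  -(1 / (2 * Complex.I * w)) * (Complex.exp (Complex.I * w * s) * expIntegral h w b s -
    Complex.exp (-(Complex.I * w * s)) * expIntegral h (-w) b s)

/-- The derivative of `duhamel`. -/
def duhamelDeriv (h : ℝ → ℂ) (w b s : ℝ) : ℂ :=
  -(1 / 2) * (Complex.exp (Complex.I * w * s) * expIntegral h w b s +
    Complex.exp (-(Complex.I * w * s)) * expIntegral h (-w) b s)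

variable {h : ℝ → ℂ}

theorem hasDerivAt_expIntegral (hh : Continuous h) (w b s : ℝ) :
    HasDerivAt (expIntegral h w b) (h s * Complex.exp (-(Complex.I * w * s))) s := by
  have hc : Continuous fun r : ℝ => h r * Complex.exp (-(Complex.I * w * r)) := by fun_prop
  exact (hc.integral_hasStrictDerivAt b s).hasDerivAt

theorem hasDerivAt_exp_mul (z : ℂ) (s : ℝ) :
    HasDerivAt (fun s : ℝ => Complex.exp (z * s)) (z * Complex.exp (z * s)) s := by
  have h1 : HasDerivAt (fun t : ℂ => Complex.exp (z * t)) (Complex.exp (z * s) * (z * 1)) (s : ℂ) :=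
    ((hasDerivAt_id (s : ℂ)).const_mul z).cexp
  have h2 := h1.comp_ofReal
  rwa [mul_one, mul_comm] at h2

theorem hasDerivAt_exp_mul_expIntegral (hh : Continuous h) (w b s : ℝ) :
    HasDerivAt (fun s : ℝ => Complex.exp (Complex.I * w * s) * expIntegral h w b s)
      (Complex.I * w * (Complex.exp (Complex.I * w * s) * expIntegral h w b s) + h s) s := by
  refine ((hasDerivAt_exp_mul (Complex.I * w) s).mul (hasDerivAt_expIntegral hh w b s)).congr_deriv
    ?_
  have e : Complex.exp (Complex.I * w * s) * Complex.exp (-(Complex.I * w * s)) = 1 := by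
    rw [← Complex.exp_add, add_neg_cancel, Complex.exp_zero]
  linear_combination h s * e

theorem hasDerivAt_exp_neg_mul_expIntegral (hh : Continuous h) (w b s : ℝ) :
    HasDerivAt (fun s : ℝ => Complex.exp (-(Complex.I * w * s)) * expIntegral h (-w) b s)
      (-(Complex.I * w * (Complex.exp (-(Complex.I * w * s)) * expIntegral h (-w) b s)) + h s)
      s := by
  have := hasDerivAt_exp_mul_expIntegral hh (-w) b s
  simpa using this

theorem hasDerivAt_duhamel (hh : Continuous h) {w : ℝ} (hw : w ≠ 0) (b s : ℝ) :
    HasDerivAt (duhamel h w b) (duhamelDeriv h w b s) s := by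
  have := ((hasDerivAt_exp_mul_expIntegral hh w b s).sub
    (hasDerivAt_exp_neg_mul_expIntegral hh w b s)).const_mul (-(1 / (2 * Complex.I * w)))
  refine this.congr_deriv ?_
  unfold duhamelDeriv
  have hw' : (w : ℂ) ≠ 0 := by exact_mod_cast hw
  field_simp [Complex.I_ne_zero]
  ring

theorem hasDerivAt_duhamelDeriv (hh : Continuous h) {w : ℝ} (hw : w ≠ 0) (b s : ℝ) :
    HasDerivAt (duhamelDeriv h w b) (-(w : ℂ) ^ 2 * duhamel h w b s - h s) s := by
  have := ((hasDerivAt_exp_mul_expIntegral hh w b s).add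
    (hasDerivAt_exp_neg_mul_expIntegral hh w b s)).const_mul (-(1 / 2) : ℂ)
  refine this.congr_deriv ?_
  unfold duhamel
  have hw' : (w : ℂ) ≠ 0 := by exact_mod_cast hw
  set X := Complex.exp (Complex.I * w * s) * expIntegral h w b s
  set Y := Complex.exp (-(Complex.I * w * s)) * expIntegral h (-w) b s
  have e : (w : ℂ) ^ 2 * (1 / (2 * Complex.I * w)) = -(Complex.I * w / 2) := by
    field_simp [Complex.I_ne_zero]
    simp
  linear_combination (Y - X) * e

theorem expIntegral_eq_zero {w b s : ℝ} (h0 : ∀ r ∈ Set.uIcc b s, h r = 0) :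
    expIntegral h w b s = 0 := by
  unfold expIntegral
  rw [intervalIntegral.integral_congr (g := fun _ => (0 : ℂ)), intervalIntegral.integral_zero]
  intro r hr
  simp only [h0 r hr, zero_mul]

theorem duhamel_eq_zero {w b s : ℝ} (h0 : ∀ r ∈ Set.uIcc b s, h r = 0) :
    duhamel h w b s = 0 ∧ duhamelDeriv h w b s = 0 ∧ h s = 0 := by
  unfold duhamel duhamelDeriv
  rw [expIntegral_eq_zero h0, expIntegral_eq_zero h0]
  simp [h0 s Set.right_mem_uIcc]

/-- The difference of the solutions vanishing in the far future and in the far past. -/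
theorem duhamel_sub_duhamel (hh : Continuous h) (w R s : ℝ) :
    duhamel h w R s - duhamel h w (-R) s = 1 / (2 * Complex.I * w) *
      (Complex.exp (Complex.I * w * s) * expIntegral h w (-R) R -
        Complex.exp (-(Complex.I * w * s)) * expIntegral h (-w) (-R) R) := by
  have hi : ∀ v : ℝ, expIntegral h v (-R) s = expIntegral h v (-R) R + expIntegral h v R s := by
    intro v
    have hc : Continuous fun r : ℝ => h r * Complex.exp (-(Complex.I * v * r)) := by fun_prop
    exact (intervalIntegral.integral_add_adjacent_intervals (hc.intervalIntegrable _ _)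
      (hc.intervalIntegrable _ _)).symm
  unfold duhamel
  rw [hi w, hi (-w)]
  ring

end Duhamel

section GreenBox

open MeasureTheory

theorem hasLineDerivAt_mul_planeWave {c : ℝ → ℂ} {c' : ℂ} (κ : Fin 4 → ℂ) (x : Spacetime)
    (μ : Fin 4) (hc : HasDerivAt c c' (x 0)) :
    HasLineDerivAt ℝ (fun x => c (x 0) * planeWave κ x)
      ((if μ = 0 then c' else 0) * planeWave κ x +
        Complex.I * lower κ μ * (c (x 0) * planeWave κ x)) x (unitVec μ) := by
  have h1 : HasDerivAt (fun t : ℝ => c ((x + t • unitVec μ) 0)) (if μ = 0 then c' else 0) 0 := by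
    by_cases hμ : μ = 0
    · subst hμ
      have h2 : HasDerivAt (fun t : ℝ => x 0 + t) 1 0 := (hasDerivAt_id (0 : ℝ)).const_add (x 0)
      have h3 : HasDerivAt c c' (x 0 + 0) := by rwa [add_zero]
      have := HasDerivAt.scomp (0 : ℝ) h3 h2
      simpa [unitVec, Function.comp_def] using this
    · have : (fun t : ℝ => c ((x + t • unitVec μ) 0)) = fun _ => c (x 0) := by
        funext t
        simp [unitVec, Ne.symm hμ]
      rw [this, if_neg hμ]
      exact hasDerivAt_const _ _
  have h4 : HasDerivAt (fun t : ℝ => planeWave κ (x + t • unitVec μ)) _ 0 :=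
    hasLineDerivAt_planeWave κ x μ
  refine HasDerivAt.congr_deriv (h1.mul h4) ?_
  simp only [zero_smul, add_zero]
  ring

/-- Green's identity for the d'Alembertian and a function with separated variables. -/
theorem integral_mul_box {u : Spacetime → ℂ} (hu : ContDiff ℝ 2 u) {c c₁ c₂ : ℝ → ℂ}
    (hc : ∀ s, HasDerivAt c (c₁ s) s) (hc₁ : ∀ s, HasDerivAt c₁ (c₂ s) s) (hc₂ : Continuous c₂)
    (k : Momentum) {S : Set Spacetime} (hS : IsCompact S)
    (hz : ∀ x ∉ S, (c (x 0) = 0 ∧ c₁ (x 0) = 0 ∧ c₂ (x 0) = 0) ∨ x ∉ tsupport u) :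
    ∫ x, c (x 0) * planeWave (spatial k) x * box u x =
      ∫ x, (-c₂ (x 0) - (‖k‖ : ℂ) ^ 2 * c (x 0)) * planeWave (spatial k) x * u x := by
  have hcc : Continuous c := continuous_iff_continuousAt.2 fun s => (hc s).continuousAt
  have hcc₁ : Continuous c₁ := continuous_iff_continuousAt.2 fun s => (hc₁ s).continuousAt
  have hp := continuous_planeWave (spatial k)
  have hx0 : Continuous fun x : Spacetime => x 0 := continuous_apply 0
  have hχ : ∀ {d : ℝ → ℂ}, Continuous d →
      Continuous fun x : Spacetime => d (x 0) * planeWave (spatial k) x := fun hd =>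
    (hd.comp hx0).mul hp
  have hint : ∀ {d : ℝ → ℂ} {q : Spacetime → ℂ}, Continuous d → Continuous q →
      (∀ x ∉ S, d (x 0) = 0 ∨ q x = 0) →
      Integrable fun x => d (x 0) * planeWave (spatial k) x * q x := fun hd hq hdq =>
    ((hχ hd).mul hq).integrable_of_hasCompactSupport (HasCompactSupport.intro hS fun x hx => by
      rcases hdq x hx with h | h <;> simp [h])
  have time := integral_mul_partial₂ hu 0 (χ := fun x => c (x 0) * planeWave (spatial k) x)
    (χ₁ := fun x => c₁ (x 0) * planeWave (spatial k) x)
    (χ₂ := fun x => c₂ (x 0) * planeWave (spatial k) x) (hχ hcc) (hχ hcc₁) (hχ hc₂)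
    (fun x => by
      simpa [lower, spatial] using hasLineDerivAt_mul_planeWave (spatial k) x 0 (hc (x 0)))
    (fun x => by
      simpa [lower, spatial] using hasLineDerivAt_mul_planeWave (spatial k) x 0 (hc₁ (x 0)))
    hS (fun x hx => by
      rcases hz x hx with ⟨h, h₁, h₂⟩ | h
      · left
        simp [h, h₁, h₂]
      · exact Or.inr h)
  have space : ∀ i : Fin 3, ∫ x, c (x 0) * planeWave (spatial k) x * partial₂ u i.succ i.succ x =
      -(k i : ℂ) ^ 2 * ∫ x, c (x 0) * planeWave (spatial k) x * u x := by
    intro i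
    have hlow : lower (spatial k) i.succ = k i := by
      fin_cases i <;> simp [lower, spatial]
    have hd : ∀ x, HasLineDerivAt ℝ (fun x : Spacetime => c (x 0) * planeWave (spatial k) x)
        (Complex.I * k i * (c (x 0) * planeWave (spatial k) x)) x (unitVec i.succ) := fun x => by
      have := hasLineDerivAt_mul_planeWave (spatial k) x i.succ (hc (x 0))
      rwa [if_neg (Fin.succ_ne_zero i), hlow, zero_mul, zero_add] at this
    have := integral_mul_partial₂ hu i.succ (χ := fun x => c (x 0) * planeWave (spatial k) x)
      (χ₁ := fun x => Complex.I * k i * (c (x 0) * planeWave (spatial k) x))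
      (χ₂ := fun x => Complex.I * k i * (Complex.I * k i * (c (x 0) * planeWave (spatial k) x)))
      (hχ hcc) (continuous_const.mul (hχ hcc))
      (continuous_const.mul (continuous_const.mul (hχ hcc)))
      hd (fun x => HasDerivAt.const_mul (Complex.I * k i) (hd x)) hS (fun x hx => by
        rcases hz x hx with ⟨h, h₁, h₂⟩ | h
        · left
          simp [h]
        · exact Or.inr h)
    rw [this, ← integral_const_mul]
    refine integral_congr_ae (Filter.Eventually.of_forall fun x => ?_)
    simp only
    linear_combination ((k i : ℂ) ^ 2 * (c (x 0) * planeWave (spatial k) x * u x)) * Complex.I_sq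
  have hi : ∀ μ, Integrable fun x => c (x 0) * planeWave (spatial k) x * partial₂ u μ μ x :=
    fun μ =>
    hint hcc (continuous_partial₂ hu μ μ) fun x hx => by
      rcases hz x hx with ⟨h, -, -⟩ | h
      · exact Or.inl h
      · exact Or.inr (partial₂_eq_zero_of_notMem h μ μ)
  have hiu : Integrable fun x => c (x 0) * planeWave (spatial k) x * u x :=
    hint hcc hu.continuous fun x hx => by
      rcases hz x hx with ⟨h, -, -⟩ | h
      · exact Or.inl h
      · exact Or.inr (image_eq_zero_of_notMem_tsupport h)
  have hiu₂ : Integrable fun x => c₂ (x 0) * planeWave (spatial k) x * u x :=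
    hint hc₂ hu.continuous fun x hx => by
      rcases hz x hx with ⟨-, -, h⟩ | h
      · exact Or.inl h
      · exact Or.inr (image_eq_zero_of_notMem_tsupport h)
  have hl : ∫ x, c (x 0) * planeWave (spatial k) x * box u x = ∑ μ : Fin 4,
      (if μ = 0 then -1 else 1) * ∫ x, c (x 0) * planeWave (spatial k) x * partial₂ u μ μ x := by
    simp only [← integral_const_mul]
    rw [← integral_finsetSum _ fun μ _ => (hi μ).const_mul _]
    refine integral_congr_ae (Filter.Eventually.of_forall fun x => ?_)
    simp only [box, Fin.sum_univ_succ, Fin.sum_univ_zero]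
    simp
    ring
  have hr : ∫ x, (-c₂ (x 0) - (‖k‖ : ℂ) ^ 2 * c (x 0)) * planeWave (spatial k) x * u x =
      -(∫ x, c₂ (x 0) * planeWave (spatial k) x * u x) -
        (‖k‖ : ℂ) ^ 2 * ∫ x, c (x 0) * planeWave (spatial k) x * u x := by
    have hn : Integrable fun x => -(c₂ (x 0) * planeWave (spatial k) x * u x) := hiu₂.neg
    rw [← integral_const_mul, ← integral_neg, ← integral_sub hn (hiu.const_mul _)]
    refine integral_congr_ae (Filter.Eventually.of_forall fun x => ?_)
    ring
  have hk : (‖k‖ : ℂ) ^ 2 = (k 0 : ℂ) ^ 2 + (k 1 : ℂ) ^ 2 + (k 2 : ℂ) ^ 2 := by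
    exact_mod_cast momentum_norm_sq k
  rw [hl, hr, hk, Fin.sum_univ_succ, Fin.sum_univ_three, time, space 0, space 1, space 2]
  simp
  ring

end GreenBox

/-! ### The commutator function -/

section Commutator

open MeasureTheory

/-- The momentum with frequency `w` and spatial part `k`. -/
def fourMomentum (w : ℝ) (k : Momentum) : Fin 4 → ℂ := ![w, k 0, k 1, k 2]

theorem planeWave_fourMomentum (w : ℝ) (k : Momentum) (x : Spacetime) :
    planeWave (fourMomentum w k) x =
      Complex.exp (-(Complex.I * w * (x 0 : ℂ))) * planeWave (spatial k) x := by
  unfold planeWave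
  rw [← Complex.exp_add]
  congr 1
  simp [phase, fourMomentum, spatial]
  ring

theorem onShell_zero (k : Momentum) : onShell 0 k = fourMomentum ‖k‖ k := by
  simp [onShell, fourMomentum]

theorem neg_onShell_zero (k : Momentum) : -onShell 0 k = fourMomentum (-‖k‖) (-k) := by
  rw [onShell_zero]
  funext μ
  fin_cases μ <;> simp [fourMomentum]

/-- The spacetime transform is the transform in time of the spatial transforms. -/
theorem lorentzFT_fourMomentum {f : Spacetime → ℂ} (hf : Continuous f) (hc : HasCompactSupport f)
    (w : ℝ) (k : Momentum) : lorentzFT f (fourMomentum w k) =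
      ∫ s : ℝ, sliceFT f s k * Complex.exp (-(Complex.I * w * s)) := by
  have hi : Integrable fun x => f x * planeWave (fourMomentum w k) x :=
    (hf.mul (continuous_planeWave _)).integrable_of_hasCompactSupport hc.mul_right
  unfold lorentzFT
  rw [integral_eq_integral_slice hi]
  congr 1
  funext s
  unfold sliceFT
  rw [← integral_mul_const]
  congr 1
  funext y
  rw [planeWave_fourMomentum, slice_apply_zero]
  ring

theorem sliceFT_eq_zero {f : Spacetime → ℂ} {ρ : ℝ}
    (hρ : tsupport f ⊆ Metric.closedBall (0 : Spacetime) ρ) {s : ℝ} (hs : ρ < |s|) (k : Momentum) :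
    sliceFT f s k = 0 := by
  unfold sliceFT
  have h : ∀ y, f (slice s y) = 0 := fun y => image_eq_zero_of_notMem_tsupport fun hy => by
    have h1 := hρ hy
    rw [mem_closedBall_zero_iff] at h1
    have h2 : |s| ≤ ‖slice s y‖ := norm_le_pi_norm (slice s y) 0
    linarith
  simp [h]

theorem expIntegral_sliceFT {f : Spacetime → ℂ} (hf : Continuous f) (hc : HasCompactSupport f)
    {ρ R : ℝ} (hρ : tsupport f ⊆ Metric.closedBall (0 : Spacetime) ρ) (hR : ρ < R) (w : ℝ)
    (k : Momentum) :
    expIntegral (fun s => sliceFT f s k) w (-R) R = lorentzFT f (fourMomentum w k) := by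
  rw [lorentzFT_fourMomentum hf hc]
  refine intervalIntegral.integral_eq_integral_of_support_subset fun s hs => ?_
  have h : |s| ≤ ρ := by
    by_contra hn
    exact hs (by simp only [sliceFT_eq_zero hρ (not_le.1 hn), zero_mul])
  obtain ⟨h1, h2⟩ := abs_le.1 h
  exact ⟨by linarith, by linarith⟩

theorem IsRetardedSolution.tsupport_subset {g u : Spacetime → ℂ} (h : IsRetardedSolution g u)
    {R : ℝ} (hR : tsupport g ⊆ Metric.closedBall (0 : Spacetime) R) :
    tsupport u ⊆ {x | -R ≤ x 0 ∧ ∀ i : Fin 3, |x i.succ| ≤ x 0 + 2 * R} := by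
  refine closure_minimal (h.supp.trans ?_) ?_
  · rintro x ⟨y, hy, h0, h1⟩
    have hy' := hR hy
    rw [mem_closedBall_zero_iff] at hy'
    have hμ : ∀ μ, |y μ| ≤ R := fun μ => (norm_le_pi_norm y μ).trans hy'
    refine ⟨by linarith [(abs_le.1 (hμ 0)).1], fun i => ?_⟩
    have h2 : (x i.succ - y i.succ) ^ 2 ≤ (x 0 - y 0) ^ 2 :=
      (Finset.single_le_sum (f := fun i : Fin 3 => (x i.succ - y i.succ) ^ 2)
        (fun _ _ => sq_nonneg _) (Finset.mem_univ i)).trans h1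
    obtain ⟨h3, h4⟩ := abs_le_of_sq_le_sq' h2 (by linarith)
    obtain ⟨h5, h6⟩ := abs_le.1 (hμ i.succ)
    obtain ⟨h7, h8⟩ := abs_le.1 (hμ 0)
    rw [abs_le]
    constructor <;> linarith
  · simp only [Set.ofPred_and, Set.ofPred_forall]
    refine (isClosed_le continuous_const (continuous_apply 0)).inter (isClosed_iInter fun i => ?_)
    exact isClosed_le (continuous_apply _).abs ((continuous_apply 0).add continuous_const)

theorem IsAdvancedSolution.tsupport_subset {g v : Spacetime → ℂ} (h : IsAdvancedSolution g v)
    {R : ℝ} (hR : tsupport g ⊆ Metric.closedBall (0 : Spacetime) R) :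
    tsupport v ⊆ {x | x 0 ≤ R ∧ ∀ i : Fin 3, |x i.succ| ≤ 2 * R - x 0} := by
  refine closure_minimal (h.supp.trans ?_) ?_
  · rintro x ⟨y, hy, h0, h1⟩
    have hy' := hR hy
    rw [mem_closedBall_zero_iff] at hy'
    have hμ : ∀ μ, |y μ| ≤ R := fun μ => (norm_le_pi_norm y μ).trans hy'
    refine ⟨by linarith [(abs_le.1 (hμ 0)).2], fun i => ?_⟩
    have h2 : (y i.succ - x i.succ) ^ 2 ≤ (y 0 - x 0) ^ 2 :=
      (Finset.single_le_sum (f := fun i : Fin 3 => (y i.succ - x i.succ) ^ 2)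
        (fun _ _ => sq_nonneg _) (Finset.mem_univ i)).trans h1
    obtain ⟨h3, h4⟩ := abs_le_of_sq_le_sq' h2 (by linarith)
    obtain ⟨h5, h6⟩ := abs_le.1 (hμ i.succ)
    obtain ⟨h7, h8⟩ := abs_le.1 (hμ 0)
    rw [abs_le]
    constructor <;> linarith
  · simp only [Set.ofPred_and, Set.ofPred_forall]
    refine (isClosed_le (continuous_apply 0) continuous_const).inter (isClosed_iInter fun i => ?_)
    exact isClosed_le (continuous_apply _).abs (continuous_const.sub (continuous_apply 0))

/-- In a bounded time interval a retarded solution has bounded support. -/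
theorem IsRetardedSolution.mem_closedBall {g u : Spacetime → ℂ} (h : IsRetardedSolution g u)
    {R : ℝ} (hR : tsupport g ⊆ Metric.closedBall (0 : Spacetime) R) {x : Spacetime}
    (hx : x ∈ tsupport u) (h0 : x 0 ≤ R) : x ∈ Metric.closedBall (0 : Spacetime) (3 * R) := by
  obtain ⟨h1, h2⟩ := h.tsupport_subset hR hx
  have hR0 : 0 ≤ R := by linarith
  rw [mem_closedBall_zero_iff, pi_norm_le_iff_of_nonneg (by positivity)]
  intro μ
  rw [Real.norm_eq_abs]
  refine Fin.cases ?_ (fun i => ?_) μ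
  · rw [abs_le]
    constructor <;> linarith
  · linarith [h2 i]

/-- In a bounded time interval an advanced solution has bounded support. -/
theorem IsAdvancedSolution.mem_closedBall {g v : Spacetime → ℂ} (h : IsAdvancedSolution g v)
    {R : ℝ} (hR : tsupport g ⊆ Metric.closedBall (0 : Spacetime) R) {x : Spacetime}
    (hx : x ∈ tsupport v) (h0 : -R ≤ x 0) : x ∈ Metric.closedBall (0 : Spacetime) (3 * R) := by
  obtain ⟨h1, h2⟩ := h.tsupport_subset hR hx
  have hR0 : 0 ≤ R := by linarith
  rw [mem_closedBall_zero_iff, pi_norm_le_iff_of_nonneg (by positivity)]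
  intro μ
  rw [Real.norm_eq_abs]
  refine Fin.cases ?_ (fun i => ?_) μ
  · rw [abs_le]
    constructor <;> linarith
  · linarith [h2 i]

variable {f g u v : Spacetime → ℂ}

/-- The pairing of a partial wave of `f` with the commutator function of `g`: by Green's identity,
the solution of the wave equation with source the partial wave that vanishes in the future
(respectively past) may be paired with `g` in place of `u` (respectively `v`). -/
theorem integral_sliceFT_mul_sub (hf : Continuous f) (hfc : HasCompactSupport f)
    (hg : Continuous g) (hgc : HasCompactSupport g) (hu : IsRetardedSolution g u)
    (hv : IsAdvancedSolution g v) {k : Momentum} (hk : k ≠ 0) :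
    ∫ x : Spacetime, sliceFT f (x 0) k * planeWave (spatial (-k)) x * (u x - v x) =
      1 / (2 * Complex.I * ‖k‖) *
        (lorentzFT f (fourMomentum ‖k‖ k) * lorentzFT g (fourMomentum (-‖k‖) (-k)) -
          lorentzFT f (fourMomentum (-‖k‖) k) * lorentzFT g (fourMomentum ‖k‖ (-k))) := by
  obtain ⟨ρ, hρ⟩ := (hfc.isBounded.union hgc.isBounded).subset_closedBall (0 : Spacetime)
  have hρf : tsupport f ⊆ Metric.closedBall 0 ρ := Set.subset_union_left.trans hρ
  have hρg : tsupport g ⊆ Metric.closedBall 0 (ρ + 1) :=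
    (Set.subset_union_right.trans hρ).trans (Metric.closedBall_subset_closedBall (by linarith))
  -- a radius that exceeds `ρ`, so that the half-open interval from `-R` to `R` contains the support
  set R := ρ + 1 with hR
  have hw : ‖k‖ ≠ 0 := norm_ne_zero_iff.2 hk
  set h : ℝ → ℂ := fun s => sliceFT f s k with hh
  have hhc : Continuous h := (continuous_sliceFT hf hfc).comp (Continuous.prodMk_left k)
  have hsupp : ∀ r, R ≤ |r| → h r = 0 := fun r hr => sliceFT_eq_zero hρf (by linarith) k
  have two_le : ∀ {q : Spacetime → ℂ}, ContDiff ℝ (⊤ : ℕ∞) q → ContDiff ℝ 2 q := fun hq =>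
    hq.of_le (WithTop.coe_le_coe.2 le_top)
  have hc₂ : ∀ b, Continuous fun s => -((‖k‖ : ℝ) : ℂ) ^ 2 * duhamel h ‖k‖ b s - h s := fun b =>
    (continuous_const.mul (continuous_iff_continuousAt.2 fun s =>
      (hasDerivAt_duhamel hhc hw b s).continuousAt)).sub hhc
  have hsource : ∀ b s, -(-((‖k‖ : ℝ) : ℂ) ^ 2 * duhamel h ‖k‖ b s - h s) -
      (‖k‖ : ℂ) ^ 2 * duhamel h ‖k‖ b s = h s := by
    intro b s
    ring
  have adv : ∀ s, R < s → duhamel h ‖k‖ R s = 0 ∧ duhamelDeriv h ‖k‖ R s = 0 ∧ h s = 0 := by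
    intro s hs
    refine duhamel_eq_zero fun r hr => hsupp r ?_
    rw [Set.uIcc_of_le hs.le] at hr
    exact hr.1.trans (le_abs_self r)
  have ret : ∀ s, s < -R → duhamel h ‖k‖ (-R) s = 0 ∧ duhamelDeriv h ‖k‖ (-R) s = 0 ∧ h s = 0 := by
    intro s hs
    refine duhamel_eq_zero fun r hr => hsupp r ?_
    rw [Set.uIcc_of_ge hs.le] at hr
    linarith [hr.2, neg_le_abs r]
  have hS := isCompact_closedBall (0 : Spacetime) (3 * R)
  have e1 := integral_mul_box (two_le hu.smooth) (fun s => hasDerivAt_duhamel hhc hw R s)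
    (fun s => hasDerivAt_duhamelDeriv hhc hw R s) (hc₂ R) (-k) hS (fun x hx => by
      by_cases hxu : x ∈ tsupport u
      · left
        have hx0 : R < x 0 := by
          by_contra hn
          exact hx (hu.mem_closedBall hρg hxu (not_lt.1 hn))
        obtain ⟨h1, h2, h3⟩ := adv _ hx0
        simp [h1, h2, h3]
      · exact Or.inr hxu)
  have e2 := integral_mul_box (two_le hv.smooth) (fun s => hasDerivAt_duhamel hhc hw (-R) s)
    (fun s => hasDerivAt_duhamelDeriv hhc hw (-R) s) (hc₂ (-R)) (-k) hS (fun x hx => by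
      by_cases hxv : x ∈ tsupport v
      · left
        have hx0 : x 0 < -R := by
          by_contra hn
          exact hx (hv.mem_closedBall hρg hxv (not_lt.1 hn))
        obtain ⟨h1, h2, h3⟩ := ret _ hx0
        simp [h1, h2, h3]
      · exact Or.inr hxv)
  simp only [norm_neg, hsource, hu.eqn, hv.eqn] at e1 e2
  have hx0 : Continuous fun x : Spacetime => x 0 := continuous_apply 0
  have hp := continuous_planeWave (spatial (-k))
  have hψ : Continuous fun x : Spacetime => h (x 0) * planeWave (spatial (-k)) x :=
    (hhc.comp hx0).mul hp
  have iu : Integrable fun x : Spacetime => h (x 0) * planeWave (spatial (-k)) x * u x :=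
    (hψ.mul hu.smooth.continuous).integrable_of_hasCompactSupport
      (HasCompactSupport.intro hS fun x hx => by
        by_cases hxu : x ∈ tsupport u
        · have hn : R < x 0 := by
            by_contra hn
            exact hx (hu.mem_closedBall hρg hxu (not_lt.1 hn))
          simp [(adv _ hn).2.2]
        · simp [image_eq_zero_of_notMem_tsupport hxu])
  have iv : Integrable fun x : Spacetime => h (x 0) * planeWave (spatial (-k)) x * v x :=
    (hψ.mul hv.smooth.continuous).integrable_of_hasCompactSupport
      (HasCompactSupport.intro hS fun x hx => by
        by_cases hxv : x ∈ tsupport v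
        · have hn : x 0 < -R := by
            by_contra hn
            exact hx (hv.mem_closedBall hρg hxv (not_lt.1 hn))
          simp [(ret _ hn).2.2]
        · simp [image_eq_zero_of_notMem_tsupport hxv])
  have ig : ∀ b, Integrable fun x : Spacetime =>
      duhamel h ‖k‖ b (x 0) * planeWave (spatial (-k)) x * g x := fun b =>
    ((((continuous_iff_continuousAt.2 fun s =>
      (hasDerivAt_duhamel hhc hw b s).continuousAt).comp hx0).mul hp).mul
        hg).integrable_of_hasCompactSupport hgc.mul_left
  have iw : ∀ w : ℝ, Integrable fun x : Spacetime => g x * planeWave (fourMomentum w (-k)) x :=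
    fun w => (hg.mul (continuous_planeWave _)).integrable_of_hasCompactSupport hgc.mul_right
  simp only [mul_sub]
  rw [integral_sub iu iv, ← e1, ← e2, ← integral_sub (ig R) (ig (-R))]
  have hcongr : ∀ x : Spacetime, duhamel h ‖k‖ R (x 0) * planeWave (spatial (-k)) x * g x -
      duhamel h ‖k‖ (-R) (x 0) * planeWave (spatial (-k)) x * g x =
      1 / (2 * Complex.I * ‖k‖) * lorentzFT f (fourMomentum ‖k‖ k) *
          (g x * planeWave (fourMomentum (-‖k‖) (-k)) x) -
        1 / (2 * Complex.I * ‖k‖) * lorentzFT f (fourMomentum (-‖k‖) k) *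
          (g x * planeWave (fourMomentum ‖k‖ (-k)) x) := by
    intro x
    have hd := duhamel_sub_duhamel hhc ‖k‖ R (x 0)
    rw [expIntegral_sliceFT hf hfc hρf (by linarith), expIntegral_sliceFT hf hfc hρf (by linarith)]
      at hd
    rw [← sub_mul, ← sub_mul, hd, planeWave_fourMomentum, planeWave_fourMomentum]
    push_cast
    rw [show -(Complex.I * -(‖k‖ : ℂ) * (x 0 : ℂ)) = Complex.I * ‖k‖ * (x 0 : ℂ) by ring]
    ring
  simp only [hcongr]
  rw [integral_sub ((iw _).const_mul _) ((iw _).const_mul _), integral_const_mul,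
    integral_const_mul]
  unfold lorentzFT
  ring

/-- The pairing with the commutator function as a superposition of partial waves. -/
theorem integral_mul_sub_eq (hf : ContDiff ℝ (⊤ : ℕ∞) f) (hfc : HasCompactSupport f)
    (hgc : HasCompactSupport g) (hu : IsRetardedSolution g u)
    (hv : IsAdvancedSolution g v) : ∫ x, f x * (u x - v x) =
      ((1 / (2 * Real.pi) ^ 3 : ℝ) : ℂ) *
        ∫ k, ∫ x : Spacetime, sliceFT f (x 0) k * planeWave (spatial (-k)) x * (u x - v x) := by
  obtain ⟨ρ, hρ⟩ := (hfc.isBounded.union hgc.isBounded).subset_closedBall (0 : Spacetime)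
  have hρf : tsupport f ⊆ Metric.closedBall 0 ρ := Set.subset_union_left.trans hρ
  have hρg : tsupport g ⊆ Metric.closedBall 0 ρ := Set.subset_union_right.trans hρ
  have hS := isCompact_closedBall (0 : Spacetime) (3 * ρ)
  have hD : Continuous fun x => u x - v x := hu.smooth.continuous.sub hv.smooth.continuous
  obtain ⟨M, hM⟩ := hS.exists_bound_of_continuousOn hD.continuousOn
  obtain ⟨C, hC, hdecay⟩ := exists_norm_sliceFT_decay hf hfc
  have hzero : ∀ (x : Spacetime) k, x ∉ Metric.closedBall (0 : Spacetime) (3 * ρ) →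
      sliceFT f (x 0) k * planeWave (spatial (-k)) x * (u x - v x) = 0 := by
    intro x k hx
    by_cases h0 : ρ < |x 0|
    · rw [sliceFT_eq_zero hρf h0]
      ring
    · obtain ⟨h1, h2⟩ := abs_le.1 (not_lt.1 h0)
      have hxu : x ∉ tsupport u := fun h => hx (hu.mem_closedBall hρg h h2)
      have hxv : x ∉ tsupport v := fun h => hx (hv.mem_closedBall hρg h h1)
      rw [image_eq_zero_of_notMem_tsupport hxu, image_eq_zero_of_notMem_tsupport hxv]
      ring
  have hcont : Continuous fun p : Spacetime × Momentum =>
      sliceFT f (p.1 0) p.2 * planeWave (spatial (-p.2)) p.1 * (u p.1 - v p.1) := by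
    have h1 : Continuous fun p : Spacetime × Momentum => (p.1 0, p.2) :=
      ((continuous_apply 0).comp continuous_fst).prodMk continuous_snd
    have h2 : Continuous fun p : Spacetime × Momentum => sliceFT f (p.1 0) p.2 :=
      (continuous_sliceFT hf.continuous hfc).comp h1
    have h3 : Continuous fun p : Spacetime × Momentum => spatial (-p.2) :=
      continuous_spatial.comp continuous_snd.neg
    exact (h2.mul (continuous_planeWave_comp h3 continuous_fst)).mul (hD.comp continuous_fst)
  have hint : Integrable (Function.uncurry fun (x : Spacetime) (k : Momentum) =>
      sliceFT f (x 0) k * planeWave (spatial (-k)) x * (u x - v x))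
      ((volume : Measure Spacetime).prod (volume : Measure Momentum)) := by
    have hb1 : Integrable ((Metric.closedBall (0 : Spacetime) (3 * ρ)).indicator fun _ => M) :=
      (integrable_indicator_iff hS.measurableSet).2 (integrableOn_const hS.measure_lt_top.ne)
    refine (hb1.mul_prod (integrable_inv_sq.const_mul C)).mono' hcont.aestronglyMeasurable
      (Filter.Eventually.of_forall ?_)
    rintro ⟨x, k⟩
    simp only [Function.uncurry_apply_pair]
    by_cases hx : x ∈ Metric.closedBall (0 : Spacetime) (3 * ρ)
    · rw [Set.indicator_of_mem hx, norm_mul, norm_mul, norm_planeWave_spatial, mul_one, mul_comm]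
      exact mul_le_mul (hM x hx) (hdecay _ k) (norm_nonneg _) ((norm_nonneg _).trans (hM x hx))
    · rw [hzero x k hx, Set.indicator_of_notMem hx]
      simp
  rw [← integral_integral_swap hint, ← integral_const_mul]
  refine integral_congr_ae (Filter.Eventually.of_forall fun x => ?_)
  obtain ⟨⟨s, y⟩, rfl⟩ := sliceEquiv.surjective x
  simp only [sliceEquiv_apply, slice_apply_zero]
  rw [integral_mul_const, ← mul_assoc, ← eq_integral_sliceFT hf hfc]

/-- The antisymmetric part of the vacuum two-point function is `i` times the commutator function. -/
theorem vacuumTwoPoint_sub (hf : ContDiff ℝ (⊤ : ℕ∞) f) (hfc : HasCompactSupport f)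
    (hg : ContDiff ℝ (⊤ : ℕ∞) g) (hgc : HasCompactSupport g) (hu : IsRetardedSolution g u)
    (hv : IsAdvancedSolution g v) :
    vacuumTwoPoint f g - vacuumTwoPoint g f = Complex.I * ∫ x, f x * (u x - v x) := by
  have two_le : ∀ {q : Spacetime → ℂ}, ContDiff ℝ (⊤ : ℕ∞) q → ContDiff ℝ 2 q := fun hq =>
    hq.of_le (WithTop.coe_le_coe.2 le_top)
  have ifg := integrable_boostedIntegrand_zero (two_le hf) hfc (two_le hg) hgc
  have igf := integrable_boostedIntegrand_zero (two_le hg) hgc (two_le hf) hfc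
  -- reflecting the momentum in the second term matches the partial waves of `f` in both terms
  have igf' : Integrable fun k => boostedIntegrand g f 0 0 (-k) := igf.comp_neg
  have hneg : ∫ k, boostedIntegrand g f 0 0 k = ∫ k, boostedIntegrand g f 0 0 (-k) :=
    (integral_neg_eq_self (boostedIntegrand g f 0 0) volume).symm
  rw [integral_mul_sub_eq hf hfc hgc hu hv, vacuumTwoPoint_eq, vacuumTwoPoint_eq, ← mul_sub,
    hneg, ← integral_sub ifg igf', mul_left_comm, ← integral_const_mul Complex.I]
  congr 1
  have hne : ∀ᵐ k : Momentum, k ≠ 0 := by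
    rw [ae_iff]
    simp
  refine integral_congr_ae (hne.mono fun k hk => ?_)
  simp only
  rw [integral_sliceFT_mul_sub hf.continuous hfc hg.continuous hgc hu hv hk]
  unfold boostedIntegrand
  rw [neg_onShell_zero, neg_onShell_zero, onShell_zero, onShell_zero, norm_neg, neg_neg,
    ← smul_sub, Complex.real_smul]
  have hw : (‖k‖ : ℂ) ≠ 0 := by
    exact_mod_cast norm_ne_zero_iff.2 hk
  push_cast
  field_simp [Complex.I_ne_zero]

end Commutator

/-! ### The one-particle space -/

section OneParticle

open MeasureTheory

/-- The one-particle wave function `(2π)^{-3/2} ∫ f conj(u_k)` of a test function. -/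
def waveFunction (f : Spacetime → ℂ) (k : Momentum) : ℂ :=
  (Real.sqrt (1 / (2 * Real.pi) ^ 3) : ℂ) * ∫ x, f x * conj (mode k x)

theorem inner_waveFunction (f g : Spacetime → ℂ) (k : Momentum) :
    inner ℂ (waveFunction f k) (waveFunction g k) = ((1 / (2 * Real.pi) ^ 3 : ℝ) : ℂ) *
      ((∫ x, conj (f x) * mode k x) * ∫ x, g x * conj (mode k x)) := by
  have h : conj (∫ x, f x * conj (mode k x)) = ∫ x, conj (f x) * mode k x := by
    rw [← integral_conj]
    simp only [map_mul, Complex.conj_conj]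
  have hs : (Real.sqrt (1 / (2 * Real.pi) ^ 3) : ℂ) * Real.sqrt (1 / (2 * Real.pi) ^ 3) =
      ((1 / (2 * Real.pi) ^ 3 : ℝ) : ℂ) := by
    rw [← Complex.ofReal_mul, Real.mul_self_sqrt (by positivity)]
  rw [RCLike.inner_apply, waveFunction, waveFunction, map_mul, Complex.conj_ofReal, h, ← hs]
  ring

theorem memLp_waveFunction {f : Spacetime → ℂ} (hf : ContDiff ℝ 2 f) (hc : HasCompactSupport f) :
    MemLp (waveFunction f) 2 volume := by
  have hm : AEStronglyMeasurable (waveFunction f) volume := by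
    have h1 : Continuous fun k : Momentum => lorentzFT f (-onShell 0 k) :=
      (continuous_lorentzFT hf.continuous hc).comp (continuous_onShell 0).neg
    have h2 : Measurable fun k : Momentum => (Real.sqrt (2 * ‖k‖) : ℂ) := by fun_prop
    have h3 := (h1.measurable.div h2).const_mul (Real.sqrt (1 / (2 * Real.pi) ^ 3) : ℂ)
    refine h3.aestronglyMeasurable.congr (Filter.Eventually.of_forall fun k => ?_)
    simp only [waveFunction, integral_mul_conj_mode, Pi.div_apply]
  rw [memLp_two_iff_integrable_sq_norm hm]
  have hi := ((integrable_boostedIntegrand_zero (contDiff_conj hf) (hasCompactSupport_conj hc)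
    hf hc).const_mul ((1 / (2 * Real.pi) ^ 3 : ℝ) : ℂ)).norm
  refine hi.congr (Filter.Eventually.of_forall fun k => ?_)
  simp only
  rw [← integrand_eq_boostedIntegrand, ← inner_waveFunction, inner_self_eq_norm_sq_to_K]
  simp

/-- The wave function of a test function as an element of the one-particle space `L²(ℝ³)`. -/
def oneParticle {O : TopologicalSpace.Opens Spacetime} (f : TestFn O) :
    Lp ℂ 2 (volume : Measure Momentum) :=
  (memLp_waveFunction (TestFn.contDiff_two f) f.hasCompactSupport).toLp

theorem inner_oneParticle {O : TopologicalSpace.Opens Spacetime} (f g : TestFn O) :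
    inner ℂ (oneParticle (conjFn f)) (oneParticle g) = vacuumTwoPoint f g := by
  rw [L2.inner_def]
  refine integral_congr_ae ?_
  filter_upwards [(memLp_waveFunction (TestFn.contDiff_two (conjFn f))
    (conjFn f).hasCompactSupport).coeFn_toLp, (memLp_waveFunction (TestFn.contDiff_two g)
      g.hasCompactSupport).coeFn_toLp] with k h1 h2
  unfold oneParticle
  rw [h1, h2, inner_waveFunction]
  have e : ∀ x, conj (conjFn f x) = f x := fun x => Complex.conj_conj (f x)
  simp only [e]

theorem waveFunction_linear {O : TopologicalSpace.Opens Spacetime} (c₁ c₂ : ℂ)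
    (f₁ f₂ : TestFn O) :
    waveFunction (c₁ • f₁ + c₂ • f₂ : TestFn O) = c₁ • waveFunction f₁ + c₂ • waveFunction f₂ := by
  funext k
  have hi : ∀ f : TestFn O, Integrable fun x => f x * conj (mode k x) := fun f => by
    simp only [conj_mode_eq]
    exact (f.continuous.mul ((continuous_planeWave _).div_const _)).integrable_of_hasCompactSupport
      f.hasCompactSupport.mul_right
  have h : ∫ x, (c₁ • f₁ + c₂ • f₂ : TestFn O) x * conj (mode k x) =
      c₁ * (∫ x, f₁ x * conj (mode k x)) + c₂ * ∫ x, f₂ x * conj (mode k x) := by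
    rw [← integral_const_mul, ← integral_const_mul,
      ← integral_add ((hi f₁).const_mul _) ((hi f₂).const_mul _)]
    refine integral_congr_ae (Filter.Eventually.of_forall fun x => ?_)
    change (c₁ * f₁ x + c₂ * f₂ x) * _ = _
    ring
  simp only [waveFunction, h, Pi.add_apply, Pi.smul_apply, smul_eq_mul]
  ring

theorem waveFunction_box {f : Spacetime → ℂ} (hf : ContDiff ℝ 2 f) (hc : HasCompactSupport f) :
    waveFunction (box f) = 0 := by
  funext k
  have h := onShell_cone 0 k
  rw [waveFunction, integral_mul_conj_mode, lorentzFT_box hf hc, zero_div, mul_zero, Pi.zero_apply]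
  simpa only [Pi.neg_apply, neg_sq] using h

theorem isOneParticle_oneParticle (O : TopologicalSpace.Opens Spacetime) :
    IsOneParticle (oneParticle (O := O)) where
  linear c₁ c₂ f₁ f₂ := by
    have h₁ := memLp_waveFunction (TestFn.contDiff_two f₁) f₁.hasCompactSupport
    have h₂ := memLp_waveFunction (TestFn.contDiff_two f₂) f₂.hasCompactSupport
    have h := memLp_waveFunction (TestFn.contDiff_two (c₁ • f₁ + c₂ • f₂))
      (c₁ • f₁ + c₂ • f₂).hasCompactSupport
    have e : h.toLp = ((h₁.const_smul c₁).add (h₂.const_smul c₂)).toLp :=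
      MemLp.toLp_congr _ _ (Filter.EventuallyEq.of_eq (waveFunction_linear c₁ c₂ f₁ f₂))
    change h.toLp = c₁ • h₁.toLp + c₂ • h₂.toLp
    rw [e, MemLp.toLp_add (h₁.const_smul c₁) (h₂.const_smul c₂), MemLp.toLp_const_smul,
      MemLp.toLp_const_smul]
  field f h hfh := by
    have e : waveFunction h = 0 := by
      rw [show ⇑h = box f from funext hfh,
        waveFunction_box (TestFn.contDiff_two f) f.hasCompactSupport]
    have hh := memLp_waveFunction (TestFn.contDiff_two h) h.hasCompactSupport
    have h0 : MemLp (0 : Momentum → ℂ) 2 volume := MemLp.zero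
    have e' : hh.toLp = h0.toLp := MemLp.toLp_congr _ _ (Filter.EventuallyEq.of_eq e)
    change hh.toLp = 0
    rw [e', MemLp.toLp_zero]
  commutator f g u v hu hv := by
    rw [inner_oneParticle, inner_oneParticle]
    exact vacuumTwoPoint_sub f.contDiff f.hasCompactSupport g.contDiff g.hasCompactSupport hu hv

end OneParticle

/-! ### The Minkowski vacuum and its restriction to the wedge -/

theorem existsUnique_isMinkowskiVacuum : ∃! ω : FieldAlgebra ⊤ →ₗ[ℂ] ℂ, IsMinkowskiVacuum ω := by
  obtain ⟨ω, hs, hg⟩ := (isOneParticle_oneParticle ⊤).exists_state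
  simp only [inner_oneParticle] at hg
  exact ⟨ω, ⟨hs, hg⟩, fun ω' h => h.gaussian.unique h.state.normalized hg hs.normalized⟩

theorem IsState.comp {A B : Type} [Ring A] [StarRing A] [Algebra ℂ A] [Ring B] [StarRing B]
    [Algebra ℂ B] {ω : B →ₗ[ℂ] ℂ} (h : IsState ω) (F : A →⋆ₐ[ℂ] B) :
    IsState (ω ∘ₗ F.toAlgHom.toLinearMap) where
  normalized := by
    change ω (F 1) = 1
    rw [map_one, h.normalized]
  positive a := by
    change 0 ≤ ω (F (star a * a))
    rw [map_mul, map_star]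
    exact h.positive (F a)

theorem inclusion_word {O₁ O₂ : TopologicalSpace.Opens Spacetime} (h : O₁ ≤ O₂)
    (l : List (TestFn O₁)) : inclusion h (l.map FieldAlgebra.φ).prod =
      ((l.map (inclFn h)).map FieldAlgebra.φ).prod := by
  rw [map_list_prod, List.map_map, List.map_map]
  congr 2
  funext f
  exact FieldAlgebra.map_φ _ _ f

theorem IsMinkowskiVacuum.isKMSState {ω : FieldAlgebra ⊤ →ₗ[ℂ] ℂ} (h : IsMinkowskiVacuum ω)
    {a : ℝ} (ha : 0 < a) : IsKMSState (rindlerGroup a) (2 * Real.pi / a)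
      (ω ∘ₗ (inclusion (le_top : wedge ≤ ⊤)).toAlgHom.toLinearMap) where
  state := h.state.comp _
  kms n b := by
    refine isThermalTwoPoint_vacuum.hasKMSContinuation (fun l => ?_) ha b
    change ω (inclusion _ (l.map FieldAlgebra.φ).prod) = _
    rw [inclusion_word, h.gaussian.apply_word h.state.normalized, wickSum_map]
    rfl

end

end Unruh

theorem theorem1 (a : ℝ) (ha : 0 < a) :
    (∃! ω : Unruh.FieldAlgebra ⊤ →ₗ[ℂ] ℂ, Unruh.IsMinkowskiVacuum ω) ∧
    ∀ ω : Unruh.FieldAlgebra ⊤ →ₗ[ℂ] ℂ, Unruh.IsMinkowskiVacuum ω →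
      Unruh.IsKMSState (Unruh.rindlerGroup a) (2 * Real.pi / a)
        (ω ∘ₗ (Unruh.inclusion (le_top : Unruh.wedge ≤ ⊤)).toAlgHom.toLinearMap) :=
  ⟨Unruh.existsUnique_isMinkowskiVacuum, fun _ hω => hω.isKMSState ha⟩
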